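/- **Setting.** For each sample size $n$ let $p_n\in\mathbb N$, let $X_n$ be a real $n\times p_n$ design matrix and $A_{p_n}$ a real symmetric $p_n\times p_n$ matrix. A model is a subset $k\subseteq\{1,\dots,p_n\}$ of size $|k|$; $X_k$ denotes the columns of $X_n$ indexed by $k$, $A_k$ the principal submatrix of $A_{p_n}$ indexed by $k$, and $\beta_k\in\mathbb R^{k}$. Fix an integer $r\ge 1$ and $\alpha_1,\alpha_2>0$. Given a prior probability distribution $\pi_n$ on the models, consider the hierarchical model $$Y_n\mid\beta_k,\sigma^2,k\sim N(X_k\beta_k,\sigma^2I_n),$$ $$\pi(\beta_k\mid\tau,\sigma^2,k)=d_k(2\pi)^{-|k|/2}(\tau\sigma^2)^{-r|k|-|k|/2}\,(\det A_k)^{1/2}\exp\Big(-\frac{\beta_k^TA_k\beta_k}{2\tau\sigma^2}\Big)\prod_{i\in k}\beta_i^{2r},$$ $$\tau\sim\text{Inverse-Gamma}(1/2,\,n/2),\qquad \sigma^2\sim\text{Inverse-Gamma}(\alpha_1,\alpha_2),$$ where $d_k$ is the normalizing constant (independent of $\tau,\sigma^2$). Let $m_k(y)$ be the marginal density of the data under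 model $k$, obtained by integrating out $\beta_k,\sigma^2,\tau$, and $\pi(k\mid y)=\pi_n(k)m_k(y)/\sum_j\pi_n(j)m_j(y)$ the posterior probability of $k$. The data are generated as $y_n=X_n\beta_0+\epsilon_n$, where the entries of $\epsilon_n$ are i.i.d. $N(0,\sigma_0^2)$ with $\sigma_0^2>0$ fixed, and $\beta_0$ has the fixed finite support $t$ (the true model, contained in $\{1,\dots,p_n\}$ for all large $n$) with fixed nonzero entries on $t$. **Assumptions** (for all large $n$). 1. There are $0<\varepsilon_n<1$ with $\varepsilon_n^{-1}=O((\log n)^{1/8})$ such that for every model $k\subseteq\{1,\dots,p_n\}$ the $\min(n,|k|)$ largest eigenvalues of $X_k^TX_k/n$, counted with multiplicity, lie in $[\varepsilon_n,\varepsilon_n^{-1}]$ (so $X_k$ has rank $\min(n,|k|)$, and these are all its nonzero eigenvalues). 2. $\pi_n(k)=0$ whenever $|k|>q_n$, where $q_n=O(n^{\xi})$ for some $\xi<1$. 3. There is a constant $\omega>0$, not depending on $n$, with $\pi_n(t)/\pi_n(k)>\omega$ for every $k$ with $\pi_n(k)>0$. 4. All eigenvalues of $A_{p_n}$ lie in $(a_1,a_2)$,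 where $0<a_1<a_2<\infty$ do not depend on $n$. No further condition on $p_n$ is imposed. **Theorem.** As $n\to\infty$, $$\max_{k\ne t}\frac{\pi(k\mid y_n)}{\pi(t\mid y_n)}\longrightarrow 0\quad\text{in probability},$$ and the posterior mode is the true model with probability tending to one: $$P\big(t=\operatorname{argmax}_k\pi(k\mid y_n)\big)=P\big(\pi(k\mid y_n)<\pi(t\mid y_n)\text{ for all }k\ne t\big)\longrightarrow 1 .$$ -/

import Mathlib

open MeasureTheory ProbabilityTheory Filter Topology Asymptotics
open scoped ENNReal NNReal Matrix

noncomputable section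

namespace HyperPMOM

/-- A model on `p` covariates: the set of indices of the nonzero regression coefficients. -/
abbrev Model (p : ℕ) : Type := Finset (Fin p)

/-- `X_k`: the columns of the design matrix belonging to the model `k`. -/
def designSub {n p : ℕ} (X : Matrix (Fin n) (Fin p) ℝ) (k : Model p) : Matrix (Fin n) k ℝ :=
  X.submatrix id Subtype.val

/-- `A_k`: the `k × k` principal submatrix of `A` belonging to the model `k`. -/
def prinSub {p : ℕ} (A : Matrix (Fin p) (Fin p) ℝ) (k : Model p) : Matrix k k ℝ :=
  A.submatrix Subtype.val Subtype.val

/-- The Gram matrix `X_kᵀ X_k / n`. -/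
def gram {n p : ℕ} (X : Matrix (Fin n) (Fin p) ℝ) (k : Model p) : Matrix k k ℝ :=
  (n : ℝ)⁻¹ • ((designSub X k)ᵀ * designSub X k)

theorem gram_isHermitian {n p : ℕ} (X : Matrix (Fin n) (Fin p) ℝ) (k : Model p) :
    (gram X k).IsHermitian := by
  unfold gram
  have h : ((designSub X k)ᵀ * designSub X k).IsHermitian := by
    have := Matrix.isHermitian_conjTranspose_mul_self (designSub X k)
    rwa [Matrix.conjTranspose_eq_transpose_of_trivial] at this
  unfold Matrix.IsHermitian at h ⊢
  rw [Matrix.conjTranspose_smul, h]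
  simp

/-- The density of `N(X_k β_k, v I_n)` at `y`, where `v` is the variance `σ²`. -/
def likelihood {n p : ℕ} (X : Matrix (Fin n) (Fin p) ℝ) (k : Model p)
    (b : k → ℝ) (v : ℝ) (y : Fin n → ℝ) : ℝ :=
  (2 * Real.pi * v) ^ (-(n : ℝ) / 2) *
    Real.exp (-(∑ i, (y i - (designSub X k *ᵥ b) i) ^ 2) / (2 * v))

/-- The pMOM density of order `r` on `ℝ^k` without its normalizing constant, at scale
`s = τ σ²`. -/
def pMOMKernel {p : ℕ} (r : ℕ) (A : Matrix (Fin p) (Fin p) ℝ) (k : Model p)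
    (s : ℝ) (b : k → ℝ) : ℝ :=
  (2 * Real.pi) ^ (-(k.card : ℝ) / 2) * s ^ (-(r : ℝ) * k.card - (k.card : ℝ) / 2) *
    (prinSub A k).det ^ (1 / 2 : ℝ) *
    Real.exp (-(b ⬝ᵥ (prinSub A k *ᵥ b)) / (2 * s)) * ∏ i, b i ^ (2 * r)

/-- The normalizing constant `d_k` of the pMOM density. The integral of `pMOMKernel` does not
depend on the scale `s > 0` (substitute `b = √s b'`), so it is taken at `s = 1`. -/
def normConst {p : ℕ} (r : ℕ) (A : Matrix (Fin p) (Fin p) ℝ) (k : Model p) : ℝ :=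
  (∫ b : k → ℝ, pMOMKernel r A k 1 b)⁻¹

/-- The pMOM prior density `π(β_k | τ, σ², k)`, where `v` is `σ²`. -/
def pMOMDensity {p : ℕ} (r : ℕ) (A : Matrix (Fin p) (Fin p) ℝ) (k : Model p)
    (τ v : ℝ) (b : k → ℝ) : ℝ :=
  normConst r A k * pMOMKernel r A k (τ * v) b

/-- The density of the Inverse-Gamma distribution with shape `a` and scale `c` at `x > 0`. -/
def invGammaDensity (a c x : ℝ) : ℝ :=
  c ^ a / Real.Gamma a * x ^ (-(a + 1)) * Real.exp (-c / x)

/-- The marginal density `m_k(y)` of the data under the model `k`: the coefficients, `σ²`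
(Inverse-Gamma `(α₁, α₂)`) and `τ` (Inverse-Gamma `(1/2, n/2)`) are integrated out. -/
def marginal {n p : ℕ} (r : ℕ) (α₁ α₂ : ℝ) (X : Matrix (Fin n) (Fin p) ℝ)
    (A : Matrix (Fin p) (Fin p) ℝ) (k : Model p) (y : Fin n → ℝ) : ℝ≥0∞ :=
  ∫⁻ τ in Set.Ioi (0 : ℝ), ∫⁻ v in Set.Ioi (0 : ℝ), ∫⁻ b : k → ℝ,
    ENNReal.ofReal (likelihood X k b v y * pMOMDensity r A k τ v b *
      invGammaDensity (1 / 2) ((n : ℝ) / 2) τ * invGammaDensity α₁ α₂ v)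

/-- The posterior probability `π(k | y)`, by Bayes' rule. -/
def posterior {n p : ℕ} (r : ℕ) (α₁ α₂ : ℝ) (X : Matrix (Fin n) (Fin p) ℝ)
    (A : Matrix (Fin p) (Fin p) ℝ) (prior : PMF (Model p)) (y : Fin n → ℝ) (k : Model p) :
    ℝ≥0∞ :=
  prior k * marginal r α₁ α₂ X A k y / ∑ j, prior j * marginal r α₁ α₂ X A j y

/-- For every model `k`, the `min(n, |k|)` largest eigenvalues `ν_j` of `X_kᵀ X_k / n` lie in
`[ε, ε⁻¹]`; the remaining ones are zero because the rank is at most `min(n, |k|)`.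
(`eigenvalues₀` lists the eigenvalues in decreasing order, with multiplicity.) -/
def EigenBound {n p : ℕ} (X : Matrix (Fin n) (Fin p) ℝ) (ε : ℝ) : Prop :=
  ∀ k : Model p, ∀ j : Fin (Fintype.card k), (j : ℕ) < min n k.card →
    ε ≤ (gram_isHermitian X k).eigenvalues₀ j ∧ (gram_isHermitian X k).eigenvalues₀ j ≤ ε⁻¹

/-- `A` is symmetric with all its eigenvalues strictly between `a₁` and `a₂`. -/
def ScaleMatrixBound {p : ℕ} (A : Matrix (Fin p) (Fin p) ℝ) (a₁ a₂ : ℝ) : Prop :=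
  ∃ hA : A.IsHermitian, ∀ i, a₁ < hA.eigenvalues i ∧ hA.eigenvalues i < a₂

/-- The true model as a model on `p` covariates; covariates are numbered from `0`. -/
def trueModel (t : Finset ℕ) (p : ℕ) : Model p :=
  Finset.univ.filter fun i => (i : ℕ) ∈ t

/-- The responses `y = X β₀ + noise`. -/
def response {n p : ℕ} (X : Matrix (Fin n) (Fin p) ℝ) (β₀ : ℕ → ℝ) (noise : Fin n → ℝ) :
    Fin n → ℝ :=
  X *ᵥ (fun i : Fin p => β₀ i) + noise

/-- `max_{k ≠ t} post k / post t`, with values in `[0, ∞]` (and `0` if there is no `k ≠ t`). -/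
def maxRatio {p : ℕ} (post : Model p → ℝ≥0∞) (t : Model p) : ℝ≥0∞ :=
  ⨆ k, ⨆ _ : k ≠ t, post k / post t

/-- `t` is the unique maximizer of `post`, i.e. `t = argmax_k post k`. -/
def IsUniqueMode {p : ℕ} (post : Model p → ℝ≥0∞) (t : Model p) : Prop :=
  ∀ k, k ≠ t → post k < post t

end HyperPMOM

end

noncomputable section

namespace HyperPMOM

/-! ### Quadratic forms -/

/-! Write L = log n, T = |t|, and for a model k let m = |k| and s = |k \ t|. The marginal of k is
bounded above and that of t below, with no least squares estimator and no Laplace expansion: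
expanding around the true coefficients is enough.

Upper bound for k (`le_residual_sum_sq`, `marginal_le`). The residual sum of squares is at least Q +
κ∑(b_i - β_i)² + ∑ l_i b_i², where κ = nε/64, l_i = κ for spurious i and l_i = 1 for true i. The
l-part absorbs the nonlocal factor ∏ b_i^{2r} and yields n^{-rs}. The κ-part integrates to n^{-m/2}.
The prior of τ, which has little mass well below n, yields (m/n)^{(r+1/2)m}. All this is up to
powers of constants and of ε⁻¹.

Lower bound for t (`residual_sum_sq_le`, `le_marginal`). Restricting β to a cube of side n^{-1/2} at
the truth and τ to [n, 2n] loses n^{-(r+1)T} up to constants. The integrals over σ² leave powers of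
B = α₂ + Q/2 for k and of its analogue B' for t. Log-convexity of Γ cancels the surplus exponent,
and the rest is at most exp((n/2 + α₁)(B' - B)/B) (`exists_marginalUpper_le`).

If k properly contains t, B' - B comes from the noise projected onto the s columns of k outside t,
after the columns of t are projected out. A chi-square tail and a union bound over all column sets
control it by a constant close to 1 times σ₀² s L; the union bound closes because the eigenvalue
condition forces p ≤ n ε⁻² (`EigenBound.card_le`). So fitting noise gains at most (5/4)sL in the
exponent. Since m log m ≤ sL + Tm, the powers of n leave -(r + 1/2)sL, which wins because r ≥ 1
(`exponent_le_of_superset`).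

If k omits a true covariate, B exceeds B' by a multiple of nε. That beats every term of order (1 +
q)L, because q is O(n^ξ) with ξ < 1 and ε⁻¹ = o(L) (`exponent_le_of_not_superset`).

Both cases give a ratio of marginals at most n^{-1/8}, for all admissible k at once, on the single
event `TameNoise`, whose probability tends to 1. The bound on prior ratios costs only a constant. -/

theorem _root_.Matrix.IsHermitian.dotProduct_mulVec_eq_sum {ι : Type*} [Fintype ι] [DecidableEq ι]
    {A : Matrix ι ι ℝ} (hA : A.IsHermitian) (x : ι → ℝ) :
    x ⬝ᵥ (A *ᵥ x) =
      ∑ i, hA.eigenvalues i * (inner ℝ (hA.eigenvectorBasis i) (WithLp.toLp 2 x)) ^ 2 := by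
  have h1 : x ⬝ᵥ (A *ᵥ x) = inner ℝ (WithLp.toLp 2 x) (WithLp.toLp 2 (A *ᵥ x)) := by
    rw [EuclideanSpace.inner_toLp_toLp]; simp [dotProduct_comm]
  rw [h1, ← hA.eigenvectorBasis.sum_inner_mul_inner]
  refine Finset.sum_congr rfl fun i _ => ?_
  have h2 : inner ℝ (hA.eigenvectorBasis i) (WithLp.toLp 2 (A *ᵥ x)) =
      hA.eigenvalues i * inner ℝ (hA.eigenvectorBasis i) (WithLp.toLp 2 x) := by
    have h3 : inner ℝ (hA.eigenvectorBasis i) (WithLp.toLp 2 (A *ᵥ x)) =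
        (A *ᵥ (hA.eigenvectorBasis i).ofLp) ⬝ᵥ x := by
      rw [EuclideanSpace.inner_eq_star_dotProduct]
      have hAt : Aᵀ = A := by
        have := hA; rwa [Matrix.IsHermitian, Matrix.conjTranspose_eq_transpose_of_trivial] at this
      simp only [star_trivial]
      rw [dotProduct_comm, Matrix.dotProduct_mulVec, ← Matrix.mulVec_transpose, hAt]
    rw [h3, hA.mulVec_eigenvectorBasis, EuclideanSpace.inner_eq_star_dotProduct]
    simp [dotProduct_comm]
  rw [h2, real_inner_comm (hA.eigenvectorBasis i)]
  ring

theorem sum_sq_eq_sum_inner_sq {ι : Type*} [Fintype ι]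
    (b : OrthonormalBasis ι ℝ (EuclideanSpace ℝ ι)) (x : ι → ℝ) :
    ∑ i, x i ^ 2 = ∑ i, (inner ℝ (b i) (WithLp.toLp 2 x)) ^ 2 := by
  have h := b.sum_inner_mul_inner (WithLp.toLp 2 x) (WithLp.toLp 2 x)
  rw [real_inner_self_eq_norm_sq, EuclideanSpace.norm_sq_eq] at h
  simp only [Real.norm_eq_abs, sq_abs] at h
  rw [← h]
  refine Finset.sum_congr rfl fun i _ => ?_
  rw [real_inner_comm]; ring

theorem _root_.Matrix.IsHermitian.dotProduct_mulVec_le {ι : Type*} [Fintype ι] [DecidableEq ι]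
    {A : Matrix ι ι ℝ} (hA : A.IsHermitian) {c : ℝ} (hc : ∀ i, hA.eigenvalues i ≤ c)
    (x : ι → ℝ) : x ⬝ᵥ (A *ᵥ x) ≤ c * ∑ i, x i ^ 2 := by
  rw [hA.dotProduct_mulVec_eq_sum, sum_sq_eq_sum_inner_sq hA.eigenvectorBasis, Finset.mul_sum]
  exact Finset.sum_le_sum fun i _ => mul_le_mul_of_nonneg_right (hc i) (sq_nonneg _)

theorem _root_.Matrix.IsHermitian.le_dotProduct_mulVec {ι : Type*} [Fintype ι] [DecidableEq ι]
    {A : Matrix ι ι ℝ} (hA : A.IsHermitian) {c : ℝ} (hc : ∀ i, c ≤ hA.eigenvalues i)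
    (x : ι → ℝ) : c * ∑ i, x i ^ 2 ≤ x ⬝ᵥ (A *ᵥ x) := by
  rw [hA.dotProduct_mulVec_eq_sum, sum_sq_eq_sum_inner_sq hA.eigenvectorBasis, Finset.mul_sum]
  exact Finset.sum_le_sum fun i _ => mul_le_mul_of_nonneg_right (hc i) (sq_nonneg _)

/-- The vector of all coefficients that agrees with `b` on the model `k` and vanishes off it. -/
def extendZero {p : ℕ} (k : Model p) (b : k → ℝ) : Fin p → ℝ :=
  fun j => if h : j ∈ k then b ⟨j, h⟩ else 0

theorem extendZero_of_mem {p : ℕ} {k : Model p} (b : k → ℝ) (j : k) :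
    extendZero k b j = b j := by
  simp [extendZero]

theorem extendZero_of_notMem {p : ℕ} {k : Model p} (b : k → ℝ) {j : Fin p} (hj : j ∉ k) :
    extendZero k b j = 0 := by
  simp [extendZero, hj]

theorem sum_subtype_eq_sum {p : ℕ} {k : Model p} (f : Fin p → ℝ) (hf : ∀ j ∉ k, f j = 0) :
    ∑ j : k, f j = ∑ j, f j := by
  rw [Finset.sum_coe_sort k f]
  exact Finset.sum_subset (Finset.subset_univ k) fun j _ hj => hf j hj

theorem designSub_mulVec {n p : ℕ} (X : Matrix (Fin n) (Fin p) ℝ) (k : Model p) (b : k → ℝ) :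
    designSub X k *ᵥ b = X *ᵥ extendZero k b := by
  funext i
  simp only [Matrix.mulVec, dotProduct]
  rw [← sum_subtype_eq_sum (k := k) (fun j => X i j * extendZero k b j)
    (fun j hj => by simp [extendZero_of_notMem b hj])]
  simp [extendZero_of_mem, designSub]

theorem dotProduct_prinSub {p : ℕ} (A : Matrix (Fin p) (Fin p) ℝ) (k : Model p) (b : k → ℝ) :
    b ⬝ᵥ (prinSub A k *ᵥ b) = extendZero k b ⬝ᵥ (A *ᵥ extendZero k b) := by
  simp only [Matrix.mulVec, dotProduct]
  rw [← sum_subtype_eq_sum (k := k) _ (fun j hj => by simp [extendZero_of_notMem b hj])]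
  refine Finset.sum_congr rfl fun i _ => ?_
  rw [← sum_subtype_eq_sum (k := k) (fun j => A i j * extendZero k b j)
    (fun j hj => by simp [extendZero_of_notMem b hj])]
  simp [extendZero_of_mem, prinSub]

theorem sum_extendZero_sq {p : ℕ} (k : Model p) (b : k → ℝ) :
    ∑ j, extendZero k b j ^ 2 = ∑ j, b j ^ 2 := by
  rw [← sum_subtype_eq_sum (k := k) _ (fun j hj => by simp [extendZero_of_notMem b hj])]
  simp [extendZero_of_mem]

/-- A principal submatrix is the full quadratic form on vectors extended by zero, so the eigenvalue
bounds pass to it without interlacing. -/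
theorem ScaleMatrixBound.le_dotProduct_prinSub {p : ℕ} {A : Matrix (Fin p) (Fin p) ℝ} {a₁ a₂ : ℝ}
    (hA : ScaleMatrixBound A a₁ a₂) (k : Model p) (b : k → ℝ) :
    a₁ * ∑ i, b i ^ 2 ≤ b ⬝ᵥ (prinSub A k *ᵥ b) := by
  obtain ⟨hA, h⟩ := hA
  rw [dotProduct_prinSub, ← sum_extendZero_sq]
  exact hA.le_dotProduct_mulVec (fun i => (h i).1.le) _

theorem ScaleMatrixBound.dotProduct_prinSub_le {p : ℕ} {A : Matrix (Fin p) (Fin p) ℝ} {a₁ a₂ : ℝ}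
    (hA : ScaleMatrixBound A a₁ a₂) (k : Model p) (b : k → ℝ) :
    b ⬝ᵥ (prinSub A k *ᵥ b) ≤ a₂ * ∑ i, b i ^ 2 := by
  obtain ⟨hA, h⟩ := hA
  rw [dotProduct_prinSub, ← sum_extendZero_sq]
  exact hA.dotProduct_mulVec_le (fun i => (h i).2.le) _

theorem ScaleMatrixBound.det_prinSub_pos {p : ℕ} {A : Matrix (Fin p) (Fin p) ℝ} {a₁ a₂ : ℝ}
    (hA : ScaleMatrixBound A a₁ a₂) (ha₁ : 0 < a₁) (k : Model p) : 0 < (prinSub A k).det := by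
  refine Matrix.PosDef.det_pos ?_
  obtain ⟨hA, h⟩ := hA
  have hpd : A.PosDef := hA.posDef_iff_eigenvalues_pos.2 fun i => ha₁.trans (h i).1
  exact hpd.submatrix Subtype.val_injective

/-! ### Consequences of the eigenvalue bounds on the design -/

theorem dotProduct_gram {n p : ℕ} (hn : 1 ≤ n) (X : Matrix (Fin n) (Fin p) ℝ) (k : Model p)
    (b : k → ℝ) :
    ∑ i, (X *ᵥ extendZero k b) i ^ 2 = n * (b ⬝ᵥ (gram X k *ᵥ b)) := by
  have hn' : (n : ℝ) ≠ 0 := by positivity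
  rw [gram, Matrix.smul_mulVec, dotProduct_smul, smul_eq_mul, mul_inv_cancel_left₀ hn',
    ← Matrix.mulVec_mulVec, Matrix.dotProduct_mulVec, Matrix.vecMul_transpose, designSub_mulVec]
  simp [dotProduct, sq]

/-- The full model is itself a model, and its largest eigenvalue bounds the quadratic form of every
vector. -/
theorem EigenBound.sum_mulVec_sq_le {n p : ℕ} {X : Matrix (Fin n) (Fin p) ℝ} {ε : ℝ}
    (hX : EigenBound X ε) (hn : 1 ≤ n) (h : Fin p → ℝ) :
    ∑ i, (X *ᵥ h) i ^ 2 ≤ n * ε⁻¹ * ∑ j, h j ^ 2 := by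
  have hext : extendZero Finset.univ (fun j : (Finset.univ : Model p) => h j) = h := by
    funext j; simp [extendZero]
  have h1 := dotProduct_gram hn X Finset.univ (fun j => h j)
  have h2 := sum_extendZero_sq Finset.univ (fun j : (Finset.univ : Model p) => h j)
  rw [hext] at h1 h2
  rw [h1, h2, mul_assoc]
  refine mul_le_mul_of_nonneg_left ?_ (by positivity)
  refine (gram_isHermitian X Finset.univ).dotProduct_mulVec_le (fun i => ?_) _
  set j := (Fintype.equivOfCardEq (Fintype.card_fin _)).symm i with hj
  -- The index j may lie beyond min(n, p), where `EigenBound` says nothing; monotonicity compares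
  -- with index 0, which it does cover.
  change (gram_isHermitian X Finset.univ).eigenvalues₀ j ≤ _
  have hpos : 0 < Fintype.card (Finset.univ : Model p) := Fintype.card_pos_iff.2 ⟨i⟩
  have := (hX Finset.univ ⟨0, hpos⟩ (by
    simp only [lt_min_iff]; exact ⟨hn, by rwa [Fintype.card_coe] at hpos⟩)).2
  exact ((gram_isHermitian X Finset.univ).eigenvalues₀_antitone (Nat.zero_le _)).trans this

/-- When |u| ≤ n every eigenvalue of the Gram matrix of u is among the min(n, |u|) largest, so none
of them can vanish. -/
theorem EigenBound.le_sum_mulVec_sq {n p : ℕ} {X : Matrix (Fin n) (Fin p) ℝ} {ε : ℝ}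
    (hX : EigenBound X ε) (hn : 1 ≤ n) {u : Model p} (hu : u.card ≤ n) {h : Fin p → ℝ}
    (hh : ∀ j ∉ u, h j = 0) :
    n * ε * ∑ j, h j ^ 2 ≤ ∑ i, (X *ᵥ h) i ^ 2 := by
  have hext : extendZero u (fun j : u => h j) = h := by
    funext j
    by_cases hj : j ∈ u <;> simp [extendZero, hj, hh]
  have h1 := dotProduct_gram hn X u (fun j => h j)
  have h2 := sum_extendZero_sq u (fun j => h j)
  rw [hext] at h1 h2
  rw [h1, h2, mul_assoc]
  refine mul_le_mul_of_nonneg_left ?_ (by positivity)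
  refine (gram_isHermitian X u).le_dotProduct_mulVec (fun i => ?_) _
  set j := (Fintype.equivOfCardEq (Fintype.card_fin _)).symm i with hj
  change _ ≤ (gram_isHermitian X u).eigenvalues₀ j
  refine (hX u j ?_).1
  have := j.2.trans_eq (Fintype.card_coe u)
  omega

/-- The eigenvalue bounds restrict the number of covariates. -/
theorem EigenBound.card_le {n p : ℕ} {X : Matrix (Fin n) (Fin p) ℝ} {ε : ℝ}
    (hX : EigenBound X ε) (hn : 1 ≤ n) (hε : 0 < ε) : (p : ℝ) ≤ n * (ε⁻¹) ^ 2 := by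
  have hn' : (0 : ℝ) < n := by exact_mod_cast hn
  -- The squared Frobenius norm is counted twice: each column contributes at least nε, each row at
  -- most nε⁻¹. For the row, X applied to row i has i-th entry equal to the squared norm of that
  -- row.
  have hcol : ∀ j, n * ε ≤ ∑ i, X i j ^ 2 := fun j => by
    have := hX.le_sum_mulVec_sq hn (u := {j}) (by simpa using hn) (h := Pi.single j 1)
      (fun l hl => by simp at hl; simp [hl])
    simpa [Matrix.mulVec_single, Pi.single_apply, ite_pow] using this
  have hrow : ∀ i, ∑ j, X i j ^ 2 ≤ n * ε⁻¹ := fun i => by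
    have h1 := hX.sum_mulVec_sq_le hn (X i)
    have h2 : (∑ j, X i j ^ 2) ^ 2 ≤ ∑ l, (X *ᵥ X i) l ^ 2 := by
      have h3 : (X *ᵥ X i) i = ∑ j, X i j ^ 2 := by simp [Matrix.mulVec, dotProduct, sq]
      rw [← h3]
      exact Finset.single_le_sum (f := fun l => (X *ᵥ X i) l ^ 2) (fun _ _ => sq_nonneg _)
        (Finset.mem_univ i)
    have h4 := h2.trans h1
    rcases (Finset.sum_nonneg fun j _ => sq_nonneg (X i j)).eq_or_lt with h0 | h0
    · rw [← h0]; positivity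
    · rw [sq] at h4
      exact le_of_mul_le_mul_right h4 h0
  have h5 : (p : ℝ) * (n * ε) ≤ n * (n * ε⁻¹) :=
    calc (p : ℝ) * (n * ε) = ∑ _j : Fin p, n * ε := by simp
      _ ≤ ∑ j, ∑ i, X i j ^ 2 := Finset.sum_le_sum fun j _ => hcol j
      _ = ∑ i, ∑ j, X i j ^ 2 := Finset.sum_comm
      _ ≤ ∑ _i : Fin n, n * ε⁻¹ := Finset.sum_le_sum fun i _ => hrow i
      _ = n * (n * ε⁻¹) := by simp
  have h6 : (n * (ε⁻¹) ^ 2) * (n * ε) = n * (n * ε⁻¹) := by field_simp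
  rw [← h6] at h5
  exact le_of_mul_le_mul_right h5 (by positivity)

/-! ### Chi-square tail bounds -/

theorem lintegral_pi_prod {ι : Type*} [Fintype ι] (μ : ι → Measure ℝ)
    [∀ i, IsProbabilityMeasure (μ i)] (f : ι → ℝ → ℝ≥0∞) (hf : ∀ i, Measurable (f i)) :
    ∫⁻ x, ∏ i, f i (x i) ∂Measure.pi μ = ∏ i, ∫⁻ x, f i x ∂μ i := by
  rw [lintegral_prod_eq_prod_lintegral_of_indepFun Finset.univ (fun i (x : ι → ℝ) => f i (x i))
    (iIndepFun_pi fun i => (hf i).aemeasurable) (fun i => (hf i).comp (measurable_pi_apply i))]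
  refine Finset.prod_congr rfl fun i _ => ?_
  exact (measurePreserving_eval μ i).lintegral_comp (hf i)

theorem lintegral_exp_mul_gaussianReal (v : ℝ≥0) (c : ℝ) :
    ∫⁻ g, ENNReal.ofReal (Real.exp (c * g)) ∂gaussianReal 0 v =
      ENNReal.ofReal (Real.exp (v * c ^ 2 / 2)) := by
  rw [← ofReal_integral_eq_lintegral_ofReal (integrable_exp_mul_gaussianReal c)
    (ae_of_all _ fun _ => (Real.exp_pos _).le)]
  have := congrFun (mgf_fun_id_gaussianReal (μ := 0) (v := v)) c
  rw [mgf] at this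
  rw [this]; simp

theorem lintegral_exp_sq_gaussianReal {θ : ℝ} (hθ : θ < 1) :
    ∫⁻ g, ENNReal.ofReal (Real.exp (θ * g ^ 2 / 2)) ∂gaussianReal 0 1 =
      ENNReal.ofReal ((1 - θ) ^ (-(1 / 2) : ℝ)) := by
  have h1 : 0 < 1 - θ := by linarith
  rw [gaussianReal_of_var_ne_zero _ one_ne_zero,
    lintegral_withDensity_eq_lintegral_mul _ (measurable_gaussianPDF _ _) (by fun_prop)]
  have h2 : ∀ g : ℝ, (gaussianPDF 0 1 * fun g => ENNReal.ofReal (Real.exp (θ * g ^ 2 / 2))) g =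
      ENNReal.ofReal ((√(2 * Real.pi))⁻¹ * Real.exp (-((1 - θ) / 2) * g ^ 2)) := fun g => by
    simp only [Pi.mul_apply, gaussianPDF]
    rw [← ENNReal.ofReal_mul (gaussianPDFReal_nonneg _ _ _), gaussianPDFReal_def]
    simp only [NNReal.coe_one, mul_one, sub_zero, mul_assoc, ← Real.exp_add]
    congr 3; ring
  simp_rw [h2]
  rw [← ofReal_integral_eq_lintegral_ofReal
    ((integrable_exp_neg_mul_sq (by positivity)).const_mul _)
    (ae_of_all _ fun _ => by positivity), integral_const_mul, integral_gaussian]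
  congr 1
  rw [Real.rpow_neg h1.le, ← Real.sqrt_eq_rpow, ← Real.sqrt_inv, ← Real.sqrt_inv,
    ← Real.sqrt_mul (by positivity)]
  congr 1
  have := Real.pi_pos
  field_simp

/-- The squared norm of the projection of Gaussian noise onto a `d`-dimensional subspace is a
scaled chi-square variable with `d` degrees of freedom. -/
theorem lintegral_exp_norm_starProjection_sq {n : ℕ} {v : ℝ≥0} (hv : 0 < v)
    (V : Submodule ℝ (EuclideanSpace ℝ (Fin n))) {θ : ℝ} (hθ0 : 0 ≤ θ) (hθ : θ < 1) :
    ∫⁻ e, ENNReal.ofReal (Real.exp (θ / (2 * v) * ‖V.starProjection (WithLp.toLp 2 e)‖ ^ 2))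
        ∂(Measure.pi fun _ : Fin n => gaussianReal 0 v) =
      ENNReal.ofReal ((1 - θ) ^ (-(1 / 2) : ℝ)) ^ (Module.finrank ℝ V) := by
  set d := Module.finrank ℝ V
  have hv' : (0 : ℝ) < v := by exact_mod_cast hv
  set u := stdOrthonormalBasis ℝ V
  set γ := Measure.pi fun _ : Fin d => gaussianReal 0 1
  set μ := Measure.pi fun _ : Fin n => gaussianReal 0 v
  -- Linearization: exp(c²x²/2) is the expectation of exp(cgx) for an auxiliary standard Gaussian g.
  -- With one such g per basis vector the exponent is linear in the noise. Swapping the integrals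
  -- and using orthonormality leaves ∏ exp(θ g_i²/2), a product of one-dimensional integrals.
  set c : ℝ := √(θ / v) with hc
  have hc2 : c ^ 2 = θ / v := Real.sq_sqrt (by positivity)
  have hinner : ∀ (i : Fin d) (e : Fin n → ℝ), inner ℝ (u i) (V.orthogonalProjectionOnto
      (WithLp.toLp 2 e)) = ∑ j, (u i : EuclideanSpace ℝ (Fin n)) j * e j := fun i e => by
    rw [Submodule.inner_orthogonalProjectionOnto_eq_of_mem_left]
    simp [PiLp.inner_apply, mul_comm]
  have hnorm : ∀ e : Fin n → ℝ, ‖V.starProjection (WithLp.toLp 2 e)‖ ^ 2 =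
      ∑ i, (∑ j, (u i : EuclideanSpace ℝ (Fin n)) j * e j) ^ 2 := fun e => by
    rw [Submodule.starProjection_apply, ← Submodule.coe_norm, ← u.sum_sq_norm_inner_right]
    simp_rw [hinner, Real.norm_eq_abs, sq_abs]
  have hwnorm : ∀ g : Fin d → ℝ, ∑ j, (∑ i, g i * (u i : EuclideanSpace ℝ (Fin n)) j) ^ 2 =
      ∑ i, g i ^ 2 := fun g => by
    have h1 := u.repr.symm.norm_map (WithLp.toLp 2 g)
    rw [← u.sum_repr_symm] at h1
    have h2 : ‖((∑ i, (WithLp.toLp 2 g) i • u i : V) : EuclideanSpace ℝ (Fin n))‖ ^ 2 =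
      ‖(WithLp.toLp 2 g : EuclideanSpace ℝ (Fin d))‖ ^ 2 := by rw [← h1]; rfl
    rw [EuclideanSpace.norm_sq_eq, EuclideanSpace.norm_sq_eq] at h2
    simpa using h2
  have hexp : ∀ e : Fin n → ℝ,
      ENNReal.ofReal (Real.exp (θ / (2 * v) * ‖V.starProjection (WithLp.toLp 2 e)‖ ^ 2)) =
      ∫⁻ g, ENNReal.ofReal (Real.exp
        (c * ∑ i, ∑ j, g i * ((u i : EuclideanSpace ℝ (Fin n)) j * e j))) ∂γ := fun e => by
    have h1 : ∀ g : Fin d → ℝ, ENNReal.ofReal (Real.exp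
        (c * ∑ i, ∑ j, g i * ((u i : EuclideanSpace ℝ (Fin n)) j * e j))) =
        ∏ i, ENNReal.ofReal (Real.exp
          ((c * ∑ j, (u i : EuclideanSpace ℝ (Fin n)) j * e j) * g i)) := fun g => by
      rw [← ENNReal.ofReal_prod_of_nonneg fun _ _ => (Real.exp_pos _).le, ← Real.exp_sum,
        Finset.mul_sum]
      congr 2
      refine Finset.sum_congr rfl fun i _ => ?_
      rw [← Finset.mul_sum]; ring
    simp_rw [h1]
    rw [lintegral_pi_prod _ (fun i g => ENNReal.ofReal (Real.exp
      ((c * ∑ j, (u i : EuclideanSpace ℝ (Fin n)) j * e j) * g))) fun i => by fun_prop]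
    simp_rw [lintegral_exp_mul_gaussianReal]
    rw [← ENNReal.ofReal_prod_of_nonneg fun _ _ => (Real.exp_pos _).le, ← Real.exp_sum, hnorm,
      Finset.mul_sum]
    congr 2
    refine Finset.sum_congr rfl fun i _ => ?_
    rw [mul_pow, hc2, NNReal.coe_one]; field_simp
  simp_rw [hexp]
  rw [lintegral_lintegral_swap (by fun_prop)]
  have hin : ∀ g : Fin d → ℝ, ∫⁻ e, ENNReal.ofReal (Real.exp
      (c * ∑ i, ∑ j, g i * ((u i : EuclideanSpace ℝ (Fin n)) j * e j))) ∂μ =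
      ∏ i, ENNReal.ofReal (Real.exp (θ * g i ^ 2 / 2)) := fun g => by
    have h1 : ∀ e : Fin n → ℝ, ENNReal.ofReal (Real.exp
        (c * ∑ i, ∑ j, g i * ((u i : EuclideanSpace ℝ (Fin n)) j * e j))) =
        ∏ j, ENNReal.ofReal (Real.exp
          ((c * ∑ i, g i * (u i : EuclideanSpace ℝ (Fin n)) j) * e j)) := fun e => by
      rw [← ENNReal.ofReal_prod_of_nonneg fun _ _ => (Real.exp_pos _).le, ← Real.exp_sum,
        Finset.sum_comm, Finset.mul_sum]
      congr 2
      refine Finset.sum_congr rfl fun i _ => ?_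
      rw [mul_assoc, Finset.sum_mul]
      simp_rw [mul_assoc]
    simp_rw [h1]
    rw [lintegral_pi_prod _ (fun j e => ENNReal.ofReal (Real.exp
      ((c * ∑ i, g i * (u i : EuclideanSpace ℝ (Fin n)) j) * e))) fun i => by fun_prop]
    simp_rw [lintegral_exp_mul_gaussianReal]
    rw [← ENNReal.ofReal_prod_of_nonneg fun _ _ => (Real.exp_pos _).le, ← Real.exp_sum,
      ← ENNReal.ofReal_prod_of_nonneg fun _ _ => (Real.exp_pos _).le, ← Real.exp_sum]
    congr 2
    have h2 : ∑ i, θ * g i ^ 2 / 2 = θ / 2 * ∑ i, g i ^ 2 := by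
      rw [Finset.mul_sum]; exact Finset.sum_congr rfl fun i _ => by ring
    rw [h2, ← hwnorm, Finset.mul_sum]
    refine Finset.sum_congr rfl fun i _ => ?_
    rw [mul_pow, hc2]; field_simp
  simp_rw [hin]
  rw [lintegral_pi_prod _ (fun _ g => ENNReal.ofReal (Real.exp (θ * g ^ 2 / 2)))
    fun i => by fun_prop, lintegral_exp_sq_gaussianReal hθ]
  simp

theorem measurable_norm_starProjection_sq {n : ℕ} (V : Submodule ℝ (EuclideanSpace ℝ (Fin n))) :
    Measurable fun e : Fin n → ℝ => ‖V.starProjection (WithLp.toLp 2 e)‖ ^ 2 := by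
  have : Continuous fun e : Fin n → ℝ => ‖V.starProjection (WithLp.toLp 2 e)‖ ^ 2 := by fun_prop
  exact this.measurable

/-- Chernoff bound at tilt θ. The dimension may be replaced by any larger d, since (1 - θ)^{-1/2} ≥
1; so linear independence of the columns never matters. -/
theorem measure_norm_starProjection_sq_ge_le {n : ℕ} {v : ℝ≥0} (hv : 0 < v)
    (V : Submodule ℝ (EuclideanSpace ℝ (Fin n))) {θ : ℝ} (hθ0 : 0 ≤ θ) (hθ : θ < 1) (x : ℝ)
    {d : ℕ} (hd : Module.finrank ℝ V ≤ d) :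
    (Measure.pi fun _ : Fin n => gaussianReal 0 v)
        {e | 2 * v * x ≤ ‖V.starProjection (WithLp.toLp 2 e)‖ ^ 2} ≤
      ENNReal.ofReal (((1 - θ) ^ (-(1 / 2) : ℝ)) ^ d * Real.exp (-(θ * x))) := by
  have hv' : (0 : ℝ) < v := by exact_mod_cast hv
  set μ := Measure.pi fun _ : Fin n => gaussianReal 0 v
  have hmeas : Measurable fun e : Fin n → ℝ => ENNReal.ofReal
      (Real.exp (θ / (2 * v) * ‖V.starProjection (WithLp.toLp 2 e)‖ ^ 2)) :=
    (Real.measurable_exp.comp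
      ((measurable_norm_starProjection_sq V).const_mul _)).ennreal_ofReal
  have h1 := mul_meas_ge_le_lintegral (μ := μ) hmeas (ENNReal.ofReal (Real.exp (θ * x)))
  rw [lintegral_exp_norm_starProjection_sq hv V hθ0 hθ] at h1
  have hsub : {e | 2 * v * x ≤ ‖V.starProjection (WithLp.toLp 2 e)‖ ^ 2} ⊆
      {e : Fin n → ℝ | ENNReal.ofReal (Real.exp (θ * x)) ≤ ENNReal.ofReal
        (Real.exp (θ / (2 * v) * ‖V.starProjection (WithLp.toLp 2 e)‖ ^ 2))} := fun e he => by
    simp only [Set.mem_ofPred_eq] at he ⊢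
    refine ENNReal.ofReal_le_ofReal (Real.exp_le_exp.2 ?_)
    calc θ * x = θ / (2 * v) * (2 * v * x) := by field_simp
      _ ≤ _ := by gcongr
  have hpos : 0 < Real.exp (θ * x) := Real.exp_pos _
  have hone : 1 ≤ (1 - θ) ^ (-(1 / 2) : ℝ) :=
    Real.one_le_rpow_of_pos_of_le_one_of_nonpos (by linarith) (by linarith) (by norm_num)
  calc μ _ ≤ μ _ := measure_mono hsub
    _ ≤ ENNReal.ofReal ((1 - θ) ^ (-(1 / 2) : ℝ)) ^ (Module.finrank ℝ V) /
        ENNReal.ofReal (Real.exp (θ * x)) := by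
      rw [ENNReal.le_div_iff_mul_le (by simp [hpos]) (by simp), mul_comm]
      exact h1
    _ ≤ ENNReal.ofReal ((1 - θ) ^ (-(1 / 2) : ℝ)) ^ d / ENNReal.ofReal (Real.exp (θ * x)) := by
      gcongr
      simpa using hone
    _ = _ := by
      rw [Real.exp_neg, ← div_eq_mul_inv, ENNReal.ofReal_div_of_pos hpos,
        ENNReal.ofReal_pow (by linarith)]

/-- Weak law of large numbers for the squared norm of the noise. -/
theorem measure_sum_sq_deviation_le {n : ℕ} (v : ℝ≥0) {c : ℝ} (hc : 0 < c) (hn : 1 ≤ n) :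
    (Measure.pi fun _ : Fin n => gaussianReal 0 v) {e | c * n ≤ |∑ i, e i ^ 2 - n * v|} ≤
      ENNReal.ofReal (Var[fun x => x ^ 2; gaussianReal 0 v] / c ^ 2 / n) := by
  have hn' : (0 : ℝ) < n := by exact_mod_cast hn
  set μ := Measure.pi fun _ : Fin n => gaussianReal 0 v
  have hL : MemLp (fun x : ℝ => x ^ 2) 2 (gaussianReal 0 v) := by
    have h4 := memLp_id_gaussianReal' (μ := 0) (v := v) (2 * 2)
      (ENNReal.mul_ne_top (by simp) (by simp))
    have h5 := h4.norm_rpow_div 2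
    rw [ENNReal.mul_div_cancel_right (by simp) (by simp)] at h5
    simpa using h5
  have hmp : ∀ i : Fin n, MeasurePreserving (fun e : Fin n → ℝ => e i) μ (gaussianReal 0 v) :=
    fun i => measurePreserving_eval _ i
  have hLi : ∀ i : Fin n, MemLp (fun e : Fin n → ℝ => e i ^ 2) 2 μ := fun i =>
    hL.comp_measurePreserving (hmp i)
  have hind : iIndepFun (fun (i : Fin n) (e : Fin n → ℝ) => e i ^ 2) μ :=
    iIndepFun_pi (X := fun _ x => x ^ 2) fun i => by fun_prop
  have hvi : ∀ i : Fin n, Var[fun e : Fin n → ℝ => e i ^ 2; μ] =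
      Var[fun x => x ^ 2; gaussianReal 0 v] := fun i =>
    (hmp i).variance_fun_comp (f := fun x => x ^ 2) (by fun_prop)
  have hmi : ∀ i : Fin n, ∫ e, e i ^ 2 ∂μ = v := fun i => by
    have h1 : ∫ x, x ^ 2 ∂gaussianReal 0 v = v := by
      rw [← variance_of_integral_eq_zero (by fun_prop) integral_id_gaussianReal]
      exact variance_fun_id_gaussianReal
    rw [← h1, ← (hmp i).map_eq, integral_map (hmp i).aemeasurable (by fun_prop)]
  have hvar : Var[fun e : Fin n → ℝ => ∑ i, e i ^ 2; μ] =
      n * Var[fun x => x ^ 2; gaussianReal 0 v] := by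
    have := IndepFun.variance_sum (s := Finset.univ) (fun i _ => hLi i)
      (fun i _ j _ hij => hind.indepFun hij)
    simp only [Finset.sum_fn] at this
    rw [this, Finset.sum_congr rfl fun i _ => hvi i]
    simp
  have hmean : ∫ e, ∑ i, e i ^ 2 ∂μ = n * v := by
    rw [integral_finsetSum _ fun i _ => (hLi i).integrable (by norm_num),
      Finset.sum_congr rfl fun i _ => hmi i]
    simp
  have hLs : MemLp (fun e : Fin n → ℝ => ∑ i, e i ^ 2) 2 μ := memLp_finsetSum _ fun i _ => hLi i
  have := meas_ge_le_variance_div_sq hLs (c := c * n) (by positivity)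
  rw [hmean, hvar] at this
  refine this.trans (ENNReal.ofReal_le_ofReal (le_of_eq ?_))
  field_simp

/-! ### Noise projected onto the column spaces -/

/-- The `j`-th column of the design matrix. -/
def column {n p : ℕ} (X : Matrix (Fin n) (Fin p) ℝ) (j : Fin p) : EuclideanSpace ℝ (Fin n) :=
  WithLp.toLp 2 fun i => X i j

/-- The column space of the model `t`. -/
def columnSpan {n p : ℕ} (X : Matrix (Fin n) (Fin p) ℝ) (t : Model p) :
    Submodule ℝ (EuclideanSpace ℝ (Fin n)) :=
  Submodule.span ℝ (Set.range fun j : t => column X j)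

/-- The space spanned by the columns in `s` after projecting out the columns in `t`. -/
def residualSpan {n p : ℕ} (X : Matrix (Fin n) (Fin p) ℝ) (t s : Model p) :
    Submodule ℝ (EuclideanSpace ℝ (Fin n)) :=
  Submodule.span ℝ (Set.range fun j : s =>
    column X j - (columnSpan X t).starProjection (column X j))

theorem finrank_columnSpan_le {n p : ℕ} (X : Matrix (Fin n) (Fin p) ℝ) (t : Model p) :
    Module.finrank ℝ (columnSpan X t) ≤ t.card :=
  (finrank_range_le_card _).trans_eq (Fintype.card_coe t)

theorem finrank_residualSpan_le {n p : ℕ} (X : Matrix (Fin n) (Fin p) ℝ) (t s : Model p) :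
    Module.finrank ℝ (residualSpan X t s) ≤ s.card :=
  (finrank_range_le_card _).trans_eq (Fintype.card_coe s)

theorem toLp_mulVec {n p : ℕ} (X : Matrix (Fin n) (Fin p) ℝ) (h : Fin p → ℝ) :
    (WithLp.toLp 2 (X *ᵥ h) : EuclideanSpace ℝ (Fin n)) = ∑ j, h j • column X j := by
  ext i
  simp [Matrix.mulVec, dotProduct, column, mul_comm]

theorem inner_sq_le_norm_starProjection_sq {n : ℕ} (V : Submodule ℝ (EuclideanSpace ℝ (Fin n)))
    (e : EuclideanSpace ℝ (Fin n)) {z : EuclideanSpace ℝ (Fin n)} (hz : z ∈ V) :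
    |inner ℝ e z| ≤ ‖V.starProjection e‖ * ‖z‖ := by
  have h1 : inner ℝ e z = inner ℝ (V.starProjection e) z := by
    rw [Submodule.inner_starProjection_left_eq_right, Submodule.starProjection_eq_self_iff.2 hz]
  rw [h1]
  exact abs_real_inner_le_norm _ _

/-- Cauchy--Schwarz for the noise against a vector in the column space of `t ∪ s`. -/
theorem inner_mulVec_sq_le {n p : ℕ} (X : Matrix (Fin n) (Fin p) ℝ) (t s : Model p)
    (e : Fin n → ℝ) {h : Fin p → ℝ} (hh : ∀ j, j ∉ t → j ∉ s → h j = 0) :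
    (∑ i, e i * (X *ᵥ h) i) ^ 2 ≤
      (‖(columnSpan X t).starProjection (WithLp.toLp 2 e)‖ ^ 2 +
        ‖(residualSpan X t s).starProjection (WithLp.toLp 2 e)‖ ^ 2) *
        ∑ i, (X *ᵥ h) i ^ 2 := by
  set z : EuclideanSpace ℝ (Fin n) := WithLp.toLp 2 (X *ᵥ h) with hz
  set e' : EuclideanSpace ℝ (Fin n) := WithLp.toLp 2 e with he'
  set V := columnSpan X t with hV
  have hzsq : ∑ i, (X *ᵥ h) i ^ 2 = ‖z‖ ^ 2 := by
    rw [EuclideanSpace.norm_sq_eq]; simp [hz]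
  have hez : ∑ i, e i * (X *ᵥ h) i = inner ℝ e' z := by
    simp [PiLp.inner_apply, hz, he', mul_comm]
  have hz1 : V.starProjection z ∈ V := Submodule.starProjection_apply_mem V z
  -- Columns in t are fixed by the projection and drop out; those in s leave exactly the generators
  -- of the residual span.
  have hz2 : z - V.starProjection z ∈ residualSpan X t s := by
    rw [hz, toLp_mulVec, map_sum, ← Finset.sum_sub_distrib]
    refine Submodule.sum_mem _ fun j _ => ?_
    rw [map_smul, ← smul_sub]
    by_cases hjs : j ∈ s
    · exact Submodule.smul_mem _ _ (Submodule.subset_span ⟨⟨j, hjs⟩, rfl⟩)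
    by_cases hjt : j ∈ t
    · have : column X j ∈ V := Submodule.subset_span ⟨⟨j, hjt⟩, rfl⟩
      rw [Submodule.starProjection_eq_self_iff.2 this]
      simp
    · simp [hh j hjt hjs]
  have hpyth : ‖z‖ ^ 2 = ‖V.starProjection z‖ ^ 2 + ‖z - V.starProjection z‖ ^ 2 := by
    rw [Submodule.norm_sq_eq_add_norm_sq_starProjection z V, Submodule.starProjection_orthogonal_val]
  have hsplit : inner ℝ e' z = inner ℝ e' (V.starProjection z) +
      inner ℝ e' (z - V.starProjection z) := by
    rw [← inner_add_right]; simp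
  have h1 := inner_sq_le_norm_starProjection_sq V e' hz1
  have h2 := inner_sq_le_norm_starProjection_sq _ e' hz2
  rw [hez, hzsq, hsplit, hpyth]
  set A := ‖V.starProjection e'‖
  set B := ‖(residualSpan X t s).starProjection e'‖
  set x := ‖V.starProjection z‖
  set y := ‖z - V.starProjection z‖
  have h3 : |inner ℝ e' (V.starProjection z) + inner ℝ e' (z - V.starProjection z)| ≤
      A * x + B * y := (abs_add_le _ _).trans (add_le_add h1 h2)
  calc _ ≤ (A * x + B * y) ^ 2 := by
        rw [← sq_abs]; gcongr
    -- This is (Ax + By)² ≤ (A² + B²)(x² + y²).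
    _ ≤ _ := by nlinarith [sq_nonneg (A * y - B * x)]

/-- The noise is well behaved: its norm is of the expected size, and no projection onto a span of
columns is too large. -/
structure TameNoise {n p : ℕ} (X : Matrix (Fin n) (Fin p) ℝ) (t : Model p) (v : ℝ)
    (e : Fin n → ℝ) : Prop where
  lower : n * v * (127 / 128) ≤ ∑ i, e i ^ 2
  upper : ∑ i, e i ^ 2 ≤ 2 * n * v
  proj : ‖(columnSpan X t).starProjection (WithLp.toLp 2 e)‖ ^ 2 ≤ v / 64 * Real.log n
  resid : ∀ s : Model p, ‖(residualSpan X t s).starProjection (WithLp.toLp 2 e)‖ ^ 2 ≤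
    2 * v * (67 / 64 * (s.card * Real.log n))

/-- The residual span of s has dimension at most |s|, so its tail bound is a^{|s|}. Summed over all
nonempty s this is (1 + a)^p - 1, small once pa is small. Projecting out t first makes the cost
depend on |s| alone. -/
theorem measure_not_tameNoise_le {n p : ℕ} (X : Matrix (Fin n) (Fin p) ℝ) (t : Model p) {v : ℝ≥0}
    (hv : 0 < v) (hn : 1 ≤ n) :
    (Measure.pi fun _ : Fin n => gaussianReal 0 v) {e | ¬ TameNoise X t v e} ≤
      ENNReal.ofReal (Var[fun x => x ^ 2; gaussianReal 0 v] / (v / 128 : ℝ) ^ 2 / n) +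
      ENNReal.ofReal (8 ^ t.card * Real.exp (-(63 / 64 * (1 / 128 * Real.log n)))) +
      ENNReal.ofReal (Real.exp (p * (8 * Real.exp (-(4221 / 4096 * Real.log n)))) - 1) := by
  have hv' : (0 : ℝ) < v := by exact_mod_cast hv
  have hn' : (1 : ℝ) ≤ n := by exact_mod_cast hn
  set μ := Measure.pi fun _ : Fin n => gaussianReal 0 v
  -- The tilt θ = 63/64 gives the factor 8 per dimension. Together with the threshold 67/64 it gives
  -- the exponent 63·67/64² = 4221/4096, just above 1; the excess 125/4096 later beats the
  -- logarithms in p.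
  have h8 : (1 - 63 / 64 : ℝ) ^ (-(1 / 2) : ℝ) = 8 := by
    rw [show (1 - 63 / 64 : ℝ) = (8 : ℝ) ^ (-2 : ℝ) by
      rw [Real.rpow_neg (by norm_num)]; norm_num, ← Real.rpow_mul (by norm_num)]
    norm_num
  set a : ℝ := 8 * Real.exp (-(4221 / 4096 * Real.log n)) with ha
  have ha0 : 0 ≤ a := by positivity
  have hsub : {e | ¬ TameNoise X t v e} ⊆
      ({e | (v / 128 : ℝ) * n ≤ |∑ i, e i ^ 2 - n * v|} ∪
      {e | 2 * v * (1 / 128 * Real.log n) ≤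
        ‖(columnSpan X t).starProjection (WithLp.toLp 2 e)‖ ^ 2}) ∪
      ⋃ s ∈ (Finset.univ.erase ∅ : Finset (Model p)), {e | 2 * v * (67 / 64 * (s.card * Real.log n)) ≤
        ‖(residualSpan X t s).starProjection (WithLp.toLp 2 e)‖ ^ 2} := fun e he => by
    by_contra hcon
    simp only [Set.mem_union, Set.mem_iUnion, Set.mem_ofPred_eq, not_or, not_exists, not_le,
      Finset.mem_erase, Finset.mem_univ, and_true] at hcon
    obtain ⟨⟨h1, h2⟩, h3⟩ := hcon
    rw [abs_lt] at h1
    refine he ⟨?_, ?_, ?_, fun s => ?_⟩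
    · nlinarith
    · nlinarith
    · linarith
    -- For s = ∅ the bound reads 0 ≤ 0 and holds surely. Leaving ∅ out of the union removes the term
    -- 1 from the binomial sum.
    · rcases s.eq_empty_or_nonempty with rfl | hs
      · have : residualSpan X t ∅ = ⊥ := by simp [residualSpan]
        simp [this]
      · exact (h3 s hs.ne_empty).le
  refine (measure_mono hsub).trans ((measure_union_le _ _).trans (add_le_add
    ((measure_union_le _ _).trans (add_le_add ?_ ?_)) ?_))
  · exact measure_sum_sq_deviation_le v (by positivity) hn
  · have := measure_norm_starProjection_sq_ge_le hv (columnSpan X t) (θ := 63 / 64) (by norm_num)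
      (by norm_num) (1 / 128 * Real.log n) (finrank_columnSpan_le X t)
    rwa [h8] at this
  · have hs : ∀ s : Model p, μ {e | 2 * v * (67 / 64 * (s.card * Real.log n)) ≤
        ‖(residualSpan X t s).starProjection (WithLp.toLp 2 e)‖ ^ 2} ≤
        ENNReal.ofReal (a ^ s.card) := fun s => by
      have := measure_norm_starProjection_sq_ge_le hv (residualSpan X t s) (θ := 63 / 64)
        (by norm_num) (by norm_num) (67 / 64 * (s.card * Real.log n)) (finrank_residualSpan_le X t s)
      rw [h8] at this
      refine this.trans_eq ?_
      rw [ha, mul_pow, ← Real.exp_nat_mul]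
      congr 3; ring
    calc _ ≤ ∑ s ∈ (Finset.univ.erase ∅ : Finset (Model p)), ENNReal.ofReal (a ^ s.card) :=
          (measure_biUnion_finset_le _ _).trans (Finset.sum_le_sum fun s _ => hs s)
      _ = ENNReal.ofReal (∑ s ∈ (Finset.univ.erase ∅ : Finset (Model p)), a ^ s.card) :=
          (ENNReal.ofReal_sum_of_nonneg fun s _ => by positivity).symm
      _ ≤ _ := by
          refine ENNReal.ofReal_le_ofReal ?_
          have h1 : ∑ s : Model p, a ^ s.card = (a + 1) ^ p := by
            have := Finset.sum_pow_mul_eq_add_pow a 1 (Finset.univ : Finset (Fin p))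
            simpa using this
          have h2 := Finset.add_sum_erase Finset.univ (fun s : Model p => a ^ s.card)
            (Finset.mem_univ ∅)
          rw [h1] at h2
          simp only [Finset.card_empty, pow_zero] at h2
          have h3 : (a + 1) ^ p ≤ Real.exp (p * a) := by
            rw [Real.exp_nat_mul]
            exact pow_le_pow_left₀ (by positivity) (Real.add_one_le_exp a) p
          linarith

/-! ### Comparisons with log n, and the probability of tame noise -/

theorem tendsto_log_natCast : Tendsto (fun n : ℕ => Real.log n) atTop atTop :=
  Real.tendsto_log_atTop.comp tendsto_natCast_atTop_atTop

theorem isLittleO_rpow_rpow_of_lt {a b : ℝ} (h : a < b) :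
    (fun x : ℝ => x ^ a) =o[atTop] fun x : ℝ => x ^ b := by
  rw [isLittleO_iff_tendsto' (by
    filter_upwards [eventually_gt_atTop 0] with x hx h0
    exact absurd h0 (Real.rpow_pos_of_pos hx b).ne')]
  refine (tendsto_rpow_neg_atTop (sub_pos.2 h)).congr' ?_
  filter_upwards [eventually_gt_atTop 0] with x hx
  rw [← Real.rpow_sub hx, neg_sub]

/-- The rest of the argument needs only ε⁻¹ = o(log n). -/
theorem isLittleO_log_of_isBigO_log_rpow {f : ℕ → ℝ}
    (hf : f =O[atTop] fun n : ℕ => Real.log n ^ (1 / 8 : ℝ)) :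
    f =o[atTop] fun n : ℕ => Real.log n := by
  refine hf.trans_isLittleO ?_
  have h := (isLittleO_rpow_rpow_of_lt (a := 1 / 8) (b := 1) (by norm_num)).comp_tendsto
    tendsto_log_natCast
  simpa [Function.comp_def] using h

theorem eventually_le_mul_log {f : ℕ → ℝ} (hf : f =o[atTop] fun n : ℕ => Real.log n)
    {κ : ℝ} (hκ : 0 < κ) : ∀ᶠ n in atTop, f n ≤ κ * Real.log n := by
  filter_upwards [hf.bound hκ, tendsto_log_natCast.eventually_ge_atTop 0] with n h1 h2
  rw [Real.norm_of_nonneg h2] at h1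
  exact (Real.le_norm_self _).trans h1

theorem card_trueModel_le (t : Finset ℕ) (p : ℕ) : (trueModel t p).card ≤ t.card :=
  Finset.card_le_card_of_injOn (fun i => (i : ℕ)) (fun i hi => by simpa [trueModel] using hi)
    (fun _ _ _ _ h => Fin.ext h)

/-- Since p ≤ n ε⁻² ≤ n log² n eventually, the union bound over column sets is governed by log² n ·
n^{-125/4096}, which tends to 0. -/
theorem tendsto_measure_not_tameNoise {Ω : Type*} [MeasurableSpace Ω] (P : Measure Ω)
    [IsProbabilityMeasure P] (p : ℕ → ℕ) (X : ∀ n, Matrix (Fin n) (Fin (p n)) ℝ) (t : Finset ℕ)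
    {v : ℝ≥0} (hv : 0 < v) (noise : ∀ n, Fin n → Ω → ℝ)
    (hlaw : ∀ n i, HasLaw (noise n i) (gaussianReal 0 v) P)
    (hindep : ∀ n, iIndepFun (noise n) P) (ε : ℕ → ℝ) (hε : ∀ᶠ n in atTop, 0 < ε n ∧ ε n < 1)
    (hεo : (fun n => (ε n)⁻¹) =o[atTop] fun n : ℕ => Real.log n)
    (hX : ∀ᶠ n in atTop, EigenBound (X n) (ε n)) :
    Tendsto (fun n => P {ω | ¬ TameNoise (X n) (trueModel t (p n)) v (fun i => noise n i ω)})
      atTop (𝓝 0) := by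
  set K : ℝ := Var[fun x => x ^ 2; gaussianReal 0 v] / (v / 128 : ℝ) ^ 2
  have hlog := tendsto_log_natCast
  have h1 : Tendsto (fun n : ℕ => ENNReal.ofReal (K / n)) atTop (𝓝 0) := by
    have := ENNReal.tendsto_ofReal (tendsto_const_div_atTop_nhds_zero_nat K)
    simpa using this
  have h2 : Tendsto (fun n : ℕ => ENNReal.ofReal
      (8 ^ t.card * Real.exp (-(63 / 64 * (1 / 128 * Real.log n))))) atTop (𝓝 0) := by
    have : Tendsto (fun n : ℕ => 63 / 64 * (1 / 128 * Real.log n)) atTop atTop :=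
      (hlog.const_mul_atTop (by norm_num)).const_mul_atTop (by norm_num)
    have := ENNReal.tendsto_ofReal
      ((Real.tendsto_exp_neg_atTop_nhds_zero.comp this).const_mul ((8 : ℝ) ^ t.card))
    simpa using this
  have h3 : Tendsto (fun n : ℕ => ENNReal.ofReal
      (Real.exp (8 * (Real.log n ^ 2 * Real.exp (-(125 / 4096 * Real.log n)))) - 1))
      atTop (𝓝 0) := by
    have h4 : Tendsto (fun n : ℕ => 125 / 4096 * Real.log n) atTop atTop :=
      hlog.const_mul_atTop (by norm_num)
    have h5 := ((Real.tendsto_pow_mul_exp_neg_atTop_nhds_zero 2).comp h4).const_mul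
      (8 * (4096 / 125) ^ 2)
    have h6 : Tendsto (fun n : ℕ =>
        8 * (Real.log n ^ 2 * Real.exp (-(125 / 4096 * Real.log n)))) atTop (𝓝 0) := by
      rw [mul_zero] at h5
      refine h5.congr fun n => ?_
      simp only [Function.comp_apply]
      ring_nf
    have h7 := ENNReal.tendsto_ofReal (((Real.continuous_exp.tendsto 0).comp h6).sub_const 1)
    simpa using h7
  have hsum := (h1.add h2).add h3
  simp only [add_zero] at hsum
  refine tendsto_of_tendsto_of_tendsto_of_le_of_le' tendsto_const_nhds hsum
    (Eventually.of_forall fun _ => zero_le) ?_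
  filter_upwards [hε, hX, eventually_ge_atTop 1, eventually_le_mul_log hεo one_pos]
    with n hε hX hn hεlog
  have hn' : (0 : ℝ) < n := by exact_mod_cast hn
  have hlawn : HasLaw (fun ω i => noise n i ω) (Measure.pi fun _ : Fin n => gaussianReal 0 v) P :=
    (hindep n).hasLaw_pi (hlaw n)
  have h5 : P {ω | ¬ TameNoise (X n) (trueModel t (p n)) v (fun i => noise n i ω)} ≤
      (Measure.pi fun _ : Fin n => gaussianReal 0 v)
        {e | ¬ TameNoise (X n) (trueModel t (p n)) v e} := by
    rw [← hlawn.map_eq]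
    -- This inequality holds for any set, so measurability of the event is not needed.
    exact Measure.le_map_apply hlawn.aemeasurable _
  refine (h5.trans (measure_not_tameNoise_le (X n) _ hv hn)).trans ?_
  refine add_le_add (add_le_add le_rfl (ENNReal.ofReal_le_ofReal (mul_le_mul_of_nonneg_right
    (pow_le_pow_right₀ (by norm_num) (card_trueModel_le t (p n))) (Real.exp_pos _).le)))
    (ENNReal.ofReal_le_ofReal (sub_le_sub_right (Real.exp_le_exp.2 ?_) _))
  · have hp := hX.card_le hn hε.1
    have h6 : Real.exp (-(4221 / 4096 * Real.log n)) =
        (n : ℝ)⁻¹ * Real.exp (-(125 / 4096 * Real.log n)) := by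
      rw [← Real.exp_log (inv_pos.2 hn'), ← Real.exp_add, Real.log_inv]
      congr 1; ring
    rw [h6]
    have hinv : 0 < (ε n)⁻¹ := inv_pos.2 hε.1
    have h7 : (ε n)⁻¹ ^ 2 ≤ Real.log n ^ 2 := pow_le_pow_left₀ hinv.le (by linarith) 2
    calc (p n : ℝ) * (8 * ((n : ℝ)⁻¹ * Real.exp (-(125 / 4096 * Real.log n))))
        ≤ (n * (ε n)⁻¹ ^ 2) * (8 * ((n : ℝ)⁻¹ * Real.exp (-(125 / 4096 * Real.log n)))) := by
          gcongr
      _ = 8 * ((ε n)⁻¹ ^ 2 * Real.exp (-(125 / 4096 * Real.log n))) := by field_simp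
      _ ≤ _ := by gcongr

/-! ### The normalizing constant of the prior -/

theorem integrableOn_rpow_mul_exp_neg_mul {a B : ℝ} (ha : 0 < a) (hB : 0 < B) :
    IntegrableOn (fun t : ℝ => t ^ (a - 1) * Real.exp (-(B * t))) (Set.Ioi 0) := by
  have := integrableOn_rpow_mul_exp_neg_mul_rpow (p := 1) (s := a - 1) (b := B) (by linarith)
    one_pos hB
  simpa using this

/-- The integral of an unnormalized Inverse-Gamma density. -/
theorem lintegral_rpow_mul_exp_neg_div {a B : ℝ} (ha : 0 < a) (hB : 0 < B) :
    ∫⁻ v in Set.Ioi (0 : ℝ), ENNReal.ofReal (v ^ (-(a + 1)) * Real.exp (-B / v)) =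
      ENNReal.ofReal (Real.Gamma a * B ^ (-a)) := by
  -- The substitution v = 1/t turns the integral into the Gamma integral.
  set g : ℝ → ℝ := fun t => t ^ (a - 1) * Real.exp (-(B * t)) with hg
  have hcongr : ∀ v ∈ Set.Ioi (0 : ℝ), (|(-1 : ℝ)| * v ^ ((-1 : ℝ) - 1)) • g (v ^ (-1 : ℝ)) =
      v ^ (-(a + 1)) * Real.exp (-B / v) := fun v hv => by
    have hv : 0 < v := hv
    simp only [hg, abs_neg, abs_one, one_mul, smul_eq_mul]
    rw [← mul_assoc, ← Real.rpow_mul hv.le, ← Real.rpow_add hv, Real.rpow_neg_one]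
    congr 2
    · ring
    · field_simp
  have hint : IntegrableOn (fun v => v ^ (-(a + 1)) * Real.exp (-B / v)) (Set.Ioi 0) := by
    have := (integrableOn_Ioi_comp_rpow_iff g (p := -1) (by norm_num)).2
      (integrableOn_rpow_mul_exp_neg_mul ha hB)
    exact this.congr_fun hcongr measurableSet_Ioi
  rw [← ofReal_integral_eq_lintegral_ofReal hint
    ((ae_restrict_iff' measurableSet_Ioi).2 (ae_of_all _ fun v hv => by
      have : (0 : ℝ) < v := hv
      positivity)),
    ← setIntegral_congr_fun measurableSet_Ioi hcongr,
    integral_comp_rpow_Ioi g (by norm_num), hg, Real.integral_rpow_mul_exp_neg_mul_Ioi ha hB,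
    one_div, Real.inv_rpow hB.le, Real.rpow_neg hB.le, mul_comm]

/-- The moment integral `∫ x^{2r} exp(-a x²/2) dx`. -/
def gaussMoment (r : ℕ) (a : ℝ) : ℝ := ∫ x : ℝ, Real.exp (-(a * x ^ 2) / 2) * x ^ (2 * r)

theorem integrable_gaussMoment (r : ℕ) {a : ℝ} (ha : 0 < a) :
    Integrable fun x : ℝ => Real.exp (-(a * x ^ 2) / 2) * x ^ (2 * r) := by
  have h := integrable_rpow_mul_exp_neg_mul_sq (b := a / 2) (by positivity) (s := (2 * r : ℕ))
    (by have : (0 : ℝ) ≤ (2 * r : ℕ) := by positivity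
        linarith)
  refine h.congr (ae_of_all _ fun x => ?_)
  simp only [Real.rpow_natCast]
  rw [mul_comm]
  congr 2; ring

theorem gaussMoment_pos (r : ℕ) {a : ℝ} (ha : 0 < a) : 0 < gaussMoment r a := by
  have hnn : ∀ x : ℝ, 0 ≤ Real.exp (-(a * x ^ 2) / 2) * x ^ (2 * r) := fun x =>
    mul_nonneg (Real.exp_pos _).le (by rw [pow_mul]; positivity)
  rw [gaussMoment, integral_pos_iff_support_of_nonneg hnn (integrable_gaussMoment r ha)]
  have hsub : Set.Ioi (0 : ℝ) ⊆
      Function.support fun x : ℝ => Real.exp (-(a * x ^ 2) / 2) * x ^ (2 * r) := fun x hx => by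
    have : (0 : ℝ) < x := hx
    simp only [Function.mem_support]
    positivity
  exact lt_of_lt_of_le (by simp) (measure_mono hsub)

/-- The integral `∫ exp(-bᵀA_k b/2) ∏ b_i^{2r} db` that normalizes the prior. -/
def priorMoment {p : ℕ} (r : ℕ) (A : Matrix (Fin p) (Fin p) ℝ) (k : Model p) : ℝ :=
  ∫ b : k → ℝ, Real.exp (-(b ⬝ᵥ (prinSub A k *ᵥ b)) / 2) * ∏ i, b i ^ (2 * r)

theorem prod_pow_two_mul_nonneg {ι : Type*} [Fintype ι] (r : ℕ) (b : ι → ℝ) :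
    0 ≤ ∏ i, b i ^ (2 * r) :=
  Finset.prod_nonneg fun i _ => by rw [pow_mul]; positivity

theorem exp_sum_sq_mul_prod {ι : Type*} [Fintype ι] (r : ℕ) (a : ℝ) (b : ι → ℝ) :
    Real.exp (-(a * ∑ i, b i ^ 2) / 2) * ∏ i, b i ^ (2 * r) =
      ∏ i, (Real.exp (-(a * b i ^ 2) / 2) * b i ^ (2 * r)) := by
  rw [Finset.prod_mul_distrib, ← Real.exp_sum]
  congr 2
  rw [← Finset.sum_div, Finset.sum_neg_distrib, Finset.mul_sum]

theorem integrable_exp_sum_sq_mul_prod {ι : Type*} [Fintype ι] (r : ℕ) {a : ℝ} (ha : 0 < a) :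
    Integrable fun b : ι → ℝ => Real.exp (-(a * ∑ i, b i ^ 2) / 2) * ∏ i, b i ^ (2 * r) := by
  simp_rw [exp_sum_sq_mul_prod]
  exact Integrable.fintype_prod fun _ => integrable_gaussMoment r ha

theorem integral_exp_sum_sq_mul_prod {p : ℕ} (r : ℕ) (a : ℝ) (k : Model p) :
    ∫ b : k → ℝ, Real.exp (-(a * ∑ i, b i ^ 2) / 2) * ∏ i, b i ^ (2 * r) =
      gaussMoment r a ^ k.card := by
  simp_rw [exp_sum_sq_mul_prod]
  rw [integral_fintype_prod_volume_eq_pow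
    (fun x : ℝ => Real.exp (-(a * x ^ 2) / 2) * x ^ (2 * r)), Fintype.card_coe]
  rfl

theorem integrable_priorMoment {p : ℕ} (r : ℕ) {A : Matrix (Fin p) (Fin p) ℝ} {a₁ a₂ : ℝ}
    (hA : ScaleMatrixBound A a₁ a₂) (ha₁ : 0 < a₁) (k : Model p) :
    Integrable fun b : k → ℝ =>
      Real.exp (-(b ⬝ᵥ (prinSub A k *ᵥ b)) / 2) * ∏ i, b i ^ (2 * r) := by
  refine (integrable_exp_sum_sq_mul_prod r ha₁).mono' ?_ (ae_of_all _ fun b => ?_)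
  · refine Continuous.aestronglyMeasurable ?_
    simp only [dotProduct, Matrix.mulVec]
    fun_prop
  · rw [Real.norm_of_nonneg (mul_nonneg (Real.exp_pos _).le (prod_pow_two_mul_nonneg r b))]
    refine mul_le_mul_of_nonneg_right (Real.exp_le_exp.2 ?_) (prod_pow_two_mul_nonneg r b)
    have := hA.le_dotProduct_prinSub k b
    linarith

theorem priorMoment_le {p : ℕ} (r : ℕ) {A : Matrix (Fin p) (Fin p) ℝ} {a₁ a₂ : ℝ}
    (hA : ScaleMatrixBound A a₁ a₂) (ha₁ : 0 < a₁) (k : Model p) :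
    priorMoment r A k ≤ gaussMoment r a₁ ^ k.card := by
  rw [← integral_exp_sum_sq_mul_prod]
  refine integral_mono (integrable_priorMoment r hA ha₁ k) (integrable_exp_sum_sq_mul_prod r ha₁)
    fun b => mul_le_mul_of_nonneg_right (Real.exp_le_exp.2 ?_) (prod_pow_two_mul_nonneg r b)
  have := hA.le_dotProduct_prinSub k b
  linarith

/-- Replacing A_k by a multiple of the identity factorizes the integral, so the normalizing constant
is at worst exponential in |k|. The bound uses some a ≥ a₂ with a > 0, as positivity of a₂ is not
available here. -/
theorem le_priorMoment {p : ℕ} (r : ℕ) {A : Matrix (Fin p) (Fin p) ℝ} {a₁ a₂ : ℝ}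
    (hA : ScaleMatrixBound A a₁ a₂) (ha₁ : 0 < a₁) {a : ℝ} (ha : 0 < a) (ha₂ : a₂ ≤ a)
    (k : Model p) : gaussMoment r a ^ k.card ≤ priorMoment r A k := by
  rw [← integral_exp_sum_sq_mul_prod]
  refine integral_mono (integrable_exp_sum_sq_mul_prod r ha) (integrable_priorMoment r hA ha₁ k)
    fun b => mul_le_mul_of_nonneg_right (Real.exp_le_exp.2 ?_) (prod_pow_two_mul_nonneg r b)
  have h1 := hA.dotProduct_prinSub_le k b
  have h2 : a₂ * ∑ i, b i ^ 2 ≤ a * ∑ i, b i ^ 2 :=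
    mul_le_mul_of_nonneg_right ha₂ (Finset.sum_nonneg fun _ _ => sq_nonneg _)
  linarith

/-- In the prior density the determinant and the powers of `2π` cancel. -/
theorem pMOMDensity_eq {p : ℕ} (r : ℕ) {A : Matrix (Fin p) (Fin p) ℝ} {a₁ a₂ : ℝ}
    (hA : ScaleMatrixBound A a₁ a₂) (ha₁ : 0 < a₁) (k : Model p) (τ v : ℝ) (b : k → ℝ) :
    pMOMDensity r A k τ v b = (priorMoment r A k)⁻¹ * (τ * v) ^ (-((r + 1 / 2) * k.card : ℝ)) *
      Real.exp (-(b ⬝ᵥ (prinSub A k *ᵥ b)) / (2 * (τ * v))) * ∏ i, b i ^ (2 * r) := by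
  have hdet := hA.det_prinSub_pos ha₁ k
  set C : ℝ := (2 * Real.pi) ^ (-(k.card : ℝ) / 2) * (prinSub A k).det ^ (1 / 2 : ℝ) with hC
  have hC0 : C ≠ 0 := by have := Real.pi_pos; positivity
  have h1 : normConst r A k = C⁻¹ * (priorMoment r A k)⁻¹ := by
    rw [normConst, priorMoment, ← mul_inv, ← integral_const_mul]
    congr 2
    funext b
    simp only [pMOMKernel, Real.one_rpow, mul_one, hC]
    ring
  have h2 : (-(r : ℝ) * k.card - (k.card : ℝ) / 2) = -((r + 1 / 2) * k.card : ℝ) := by ring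
  rw [pMOMDensity, h1, pMOMKernel, h2]
  field_simp
  rw [hC]; ring

/-! ### Bounds on the marginal densities -/

/-- Since x^r e^{-x} ≤ r!, a quadratic weight l tames the nonlocal factor at the price (2v/l)^r. For
l of order nε this is the penalty n^{-r} of a spurious covariate. -/
theorem pow_two_mul_mul_exp_le (r : ℕ) {l v : ℝ} (hl : 0 < l) (hv : 0 < v) (b : ℝ) :
    b ^ (2 * r) * Real.exp (-(l * b ^ 2) / (2 * v)) ≤ (2 * v / l) ^ r * r.factorial := by
  set x : ℝ := l * b ^ 2 / (2 * v) with hx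
  have hx0 : 0 ≤ x := by positivity
  have h1 : b ^ (2 * r) = (2 * v / l) ^ r * x ^ r := by
    rw [pow_mul, ← mul_pow]; congr 1; rw [hx]; field_simp
  have h2 : x ^ r * Real.exp (-x) ≤ r.factorial := by
    have h3 := Real.pow_div_factorial_le_exp x hx0 r
    rw [div_le_iff₀ (by positivity)] at h3
    rw [Real.exp_neg, ← div_eq_mul_inv, div_le_iff₀ (Real.exp_pos _)]
    linarith
  rw [h1, neg_div, ← hx, mul_assoc]
  exact mul_le_mul_of_nonneg_left h2 (by positivity)

/-- Half of the exponential is spent on the negative power, through (u/x)^x ≤ e^u with u = m/(4τ).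
The other half keeps the integral over τ finite. -/
theorem rpow_neg_mul_exp_le {x m τ : ℝ} (hx : 0 ≤ x) (hm : 0 < m) (hτ : 0 < τ) :
    τ ^ (-x) * Real.exp (-(m / 2) / τ) ≤ (4 * x / m) ^ x * Real.exp (-(m / 4) / τ) := by
  rcases hx.eq_or_lt with rfl | hx
  · simp only [neg_zero, Real.rpow_zero, one_mul]
    refine Real.exp_le_exp.2 (div_le_div_of_nonneg_right ?_ hτ.le)
    linarith
  set u : ℝ := m / 4 / τ with hu
  have hu0 : 0 < u := by positivity
  have h1 : (u / x) ^ x ≤ Real.exp u := by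
    have h2 : u / x ≤ Real.exp (u / x) := (by linarith : u / x ≤ u / x + 1).trans
      (Real.add_one_le_exp _)
    calc (u / x) ^ x ≤ Real.exp (u / x) ^ x := Real.rpow_le_rpow (by positivity) h2 hx.le
      _ = Real.exp u := by rw [← Real.exp_mul]; congr 1; field_simp
  have h3 : τ ^ (-x) = (4 * x / m) ^ x * (u / x) ^ x := by
    rw [← Real.mul_rpow (by positivity) (by positivity), Real.rpow_neg hτ.le,
      ← Real.inv_rpow hτ.le]
    congr 1; rw [hu]; field_simp
  rw [h3, mul_assoc]
  refine mul_le_mul_of_nonneg_left ?_ (by positivity)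
  have h4 : Real.exp (-(m / 2) / τ) = Real.exp (-u) * Real.exp (-(m / 4) / τ) := by
    rw [← Real.exp_add]; congr 1; rw [hu]; ring
  rw [h4, ← mul_assoc]
  refine mul_le_of_le_one_left (Real.exp_pos _).le ?_
  rw [Real.exp_neg, ← div_eq_mul_inv]
  exact div_le_one_of_le₀ h1 (Real.exp_pos _).le

theorem lintegral_prod_exp_neg_sq {ι : Type*} [Fintype ι] {κ v : ℝ} (hκ : 0 < κ) (hv : 0 < v)
    (c : ι → ℝ) :
    ∫⁻ b : ι → ℝ, ENNReal.ofReal (∏ i, Real.exp (-(κ * (b i - c i) ^ 2) / (2 * v))) =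
      ENNReal.ofReal (√(2 * Real.pi * v / κ) ^ Fintype.card ι) := by
  have h1 : ∀ i, (fun x : ℝ => Real.exp (-(κ * (x - c i) ^ 2) / (2 * v))) =
      fun x : ℝ => (fun z => Real.exp (-(κ / (2 * v)) * z ^ 2)) (x - c i) := fun i => by
    funext x; congr 1; field_simp
  have hint : ∀ i, Integrable fun x : ℝ => Real.exp (-(κ * (x - c i) ^ 2) / (2 * v)) := fun i => by
    rw [h1]
    exact (integrable_exp_neg_mul_sq (by positivity)).comp_sub_right (c i)
  rw [volume_pi, ← ofReal_integral_eq_lintegral_ofReal (Integrable.fintype_prod hint)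
    (ae_of_all _ fun b => Finset.prod_nonneg fun i _ => (Real.exp_pos _).le),
    integral_fintype_prod_eq_prod
      (fun i x => Real.exp (-(κ * (x - c i) ^ 2) / (2 * v)))]
  congr 1
  have h2 : ∀ i, ∫ x : ℝ, Real.exp (-(κ * (x - c i) ^ 2) / (2 * v)) =
      √(2 * Real.pi * v / κ) := fun i => by
    rw [h1, integral_sub_right_eq_self (fun z => Real.exp (-(κ / (2 * v)) * z ^ 2)),
      integral_gaussian]
    congr 1; field_simp
  simp_rw [h2]
  simp

/-- The constant in the upper bound on the marginal density. -/
def marginalUpper (r n : ℕ) (α₁ α₂ g κ B : ℝ) (m : ℕ) (Λ : ℝ) : ℝ :=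
  (2 * Real.pi) ^ (-(n : ℝ) / 2) * (α₂ ^ α₁ / Real.Gamma α₁) * g⁻¹ ^ m *
    (√2 * (4 * ((r + 1 / 2) * m) / n) ^ ((r + 1 / 2) * m : ℝ)) *
    ((2 ^ r * r.factorial) ^ m * Λ) * √(2 * Real.pi / κ) ^ m *
    (Real.Gamma (n / 2 + α₁) * B ^ (-(n / 2 + α₁)))

/-- The three parts of the bound on the residual sum of squares have separate uses: Q goes to the
integral over σ², the κ-part is the Gaussian integrated over b, and the l-part absorbs ∏ b_i^{2r}.
The prior exponential in b is bounded by 1. -/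
theorem integrand_le {n p : ℕ} (r : ℕ) {α₁ α₂ : ℝ} (hα₁ : 0 < α₁) (hα₂ : 0 < α₂) (hn : 1 ≤ n)
    {X : Matrix (Fin n) (Fin p) ℝ} {A : Matrix (Fin p) (Fin p) ℝ} {a₁ a₂ a : ℝ}
    (hA : ScaleMatrixBound A a₁ a₂) (ha₁ : 0 < a₁) (ha : 0 < a) (ha₂ : a₂ ≤ a) {k : Model p}
    {y : Fin n → ℝ} {Q κ : ℝ} {l c : k → ℝ} (hl : ∀ i, 0 < l i)
    (hQ : ∀ b : k → ℝ, Q + κ * ∑ i, (b i - c i) ^ 2 + ∑ i, l i * b i ^ 2 ≤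
      ∑ i, (y i - (designSub X k *ᵥ b) i) ^ 2)
    {τ v : ℝ} (hτ : 0 < τ) (hv : 0 < v) (b : k → ℝ) :
    likelihood X k b v y * pMOMDensity r A k τ v b *
      invGammaDensity (1 / 2) ((n : ℝ) / 2) τ * invGammaDensity α₁ α₂ v ≤
    ((2 * Real.pi) ^ (-(n : ℝ) / 2) * (α₂ ^ α₁ / Real.Gamma α₁) *
      (gaussMoment r a)⁻¹ ^ k.card * ((2 ^ r * r.factorial) ^ k.card * ∏ i, (l i)⁻¹ ^ r) *
      ((n / 2 : ℝ) ^ (1 / 2 : ℝ) / Real.Gamma (1 / 2) *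
        (4 * ((r + 1 / 2) * k.card) / n) ^ ((r + 1 / 2) * k.card : ℝ))) *
      (τ ^ (-(1 / 2 + 1) : ℝ) * Real.exp (-(n / 4) / τ)) *
      (v ^ (-(n / 2 + α₁ + 1)) * Real.exp (-(α₂ + Q / 2) / v)) *
      (v ^ (-(k.card : ℝ) / 2) * ∏ i, Real.exp (-(κ * (b i - c i) ^ 2) / (2 * v))) := by
  have hpi := Real.pi_pos
  have hn' : (0 : ℝ) < n := by exact_mod_cast hn
  have hΓ := Real.Gamma_pos_of_pos hα₁
  have hΓ' := Real.Gamma_pos_of_pos (show (0 : ℝ) < 1 / 2 by norm_num)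
  have hg := gaussMoment_pos r ha
  set m := k.card with hm
  set x : ℝ := (r + 1 / 2) * m with hx
  have hx0 : 0 ≤ x := by positivity
  set E : ℝ := ∏ i, Real.exp (-(κ * (b i - c i) ^ 2) / (2 * v)) with hE
  have hE0 : 0 < E := Finset.prod_pos fun i _ => Real.exp_pos _
  set D : ℝ := ∏ i, (b i ^ (2 * r) * Real.exp (-(l i * b i ^ 2) / (2 * v))) with hD
  have hlik : likelihood X k b v y * ∏ i, b i ^ (2 * r) ≤
      ((2 * Real.pi) ^ (-(n : ℝ) / 2) * v ^ (-(n : ℝ) / 2)) *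
        (Real.exp (-(Q / 2) / v) * E * D) := by
    rw [likelihood, Real.mul_rpow (by positivity) hv.le, mul_assoc]
    refine mul_le_mul_of_nonneg_left ?_ (by positivity)
    rw [hD, Finset.prod_mul_distrib, mul_comm _ (∏ i, b i ^ (2 * r)), mul_left_comm]
    refine mul_le_mul_of_nonneg_left ?_ (prod_pow_two_mul_nonneg r b)
    rw [hE, ← Real.exp_sum, ← Real.exp_sum, ← Real.exp_add, ← Real.exp_add]
    refine Real.exp_le_exp.2 ?_
    have h1 := hQ b
    have h2 : ∑ i, -(l i * b i ^ 2) / (2 * v) = -(∑ i, l i * b i ^ 2) / (2 * v) := by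
      rw [← Finset.sum_div, Finset.sum_neg_distrib]
    have h3 : ∑ i, -(κ * (b i - c i) ^ 2) / (2 * v) = -(κ * ∑ i, (b i - c i) ^ 2) / (2 * v) := by
      rw [← Finset.sum_div, Finset.sum_neg_distrib, Finset.mul_sum]
    rw [h2, h3, show -(Q / 2) / v = -Q / (2 * v) by field_simp, ← add_div, ← add_div]
    refine div_le_div_of_nonneg_right ?_ (by positivity)
    linarith
  have hDle : D ≤ (2 ^ r * r.factorial) ^ m * (∏ i, (l i)⁻¹ ^ r) * v ^ (r * m : ℝ) := by
    calc D ≤ ∏ i : k, ((2 ^ r * r.factorial) * v ^ r * (l i)⁻¹ ^ r) := by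
          refine Finset.prod_le_prod (fun i _ => ?_) fun i _ => ?_
          · exact mul_nonneg (by rw [pow_mul]; positivity) (Real.exp_pos _).le
          · refine (pow_two_mul_mul_exp_le r (hl i) hv (b i)).trans_eq ?_
            rw [div_eq_mul_inv, mul_pow, mul_pow]; ring
      _ = _ := by
          rw [Finset.prod_mul_distrib, Finset.prod_const, Finset.card_univ, Fintype.card_coe,
            mul_pow, ← pow_mul, ← hm, ← Nat.cast_mul, Real.rpow_natCast]
          ring
  have hJ : (priorMoment r A k)⁻¹ ≤ (gaussMoment r a)⁻¹ ^ m := by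
    rw [inv_pow]
    exact inv_anti₀ (by positivity) (le_priorMoment r hA ha₁ ha ha₂ k)
  have hJ0 : 0 ≤ (priorMoment r A k)⁻¹ :=
    inv_nonneg.2 ((pow_pos hg m).le.trans (le_priorMoment r hA ha₁ ha ha₂ k))
  have hexp : Real.exp (-(b ⬝ᵥ (prinSub A k *ᵥ b)) / (2 * (τ * v))) ≤ 1 := by
    refine Real.exp_le_one_iff.2 (div_nonpos_of_nonpos_of_nonneg ?_ (by positivity))
    have h1 := hA.le_dotProduct_prinSub k b
    have h2 : 0 ≤ a₁ * ∑ i, b i ^ 2 :=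
      mul_nonneg ha₁.le (Finset.sum_nonneg fun _ _ => sq_nonneg _)
    linarith
  have hτle := rpow_neg_mul_exp_le hx0 hn' hτ
  -- Of the prior power (r + 1/2)m, the part rm cancels against the bound on the nonlocal factor,
  -- and m/2 is left to cancel the Gaussian integral over b. The final power of v is therefore free
  -- of m.
  have hvpow : v ^ (-(n : ℝ) / 2) * v ^ (r * m : ℝ) * v ^ (-x) * v ^ (-(α₁ + 1)) =
      v ^ (-(n / 2 + α₁ + 1)) * v ^ (-(m : ℝ) / 2) := by
    rw [← Real.rpow_add hv, ← Real.rpow_add hv, ← Real.rpow_add hv, ← Real.rpow_add hv]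
    congr 1; rw [hx]; ring
  have hvexp : Real.exp (-(Q / 2) / v) * Real.exp (-α₂ / v) =
      Real.exp (-(α₂ + Q / 2) / v) := by
    rw [← Real.exp_add]; congr 1; ring
  rw [pMOMDensity_eq r hA ha₁, Real.mul_rpow hτ.le hv.le, invGammaDensity, invGammaDensity]
  calc _ = (likelihood X k b v y * ∏ i, b i ^ (2 * r)) * (priorMoment r A k)⁻¹ *
        Real.exp (-(b ⬝ᵥ (prinSub A k *ᵥ b)) / (2 * (τ * v))) *
        (τ ^ (-x) * Real.exp (-(n / 2) / τ)) *
        ((n / 2 : ℝ) ^ (1 / 2 : ℝ) / Real.Gamma (1 / 2) * τ ^ (-(1 / 2 + 1) : ℝ)) *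
        (v ^ (-x) * (α₂ ^ α₁ / Real.Gamma α₁ * v ^ (-(α₁ + 1)) * Real.exp (-α₂ / v))) := by
        rw [← hx]; ring
    _ ≤ (((2 * Real.pi) ^ (-(n : ℝ) / 2) * v ^ (-(n : ℝ) / 2)) * (Real.exp (-(Q / 2) / v) * E *
          ((2 ^ r * r.factorial) ^ m * (∏ i, (l i)⁻¹ ^ r) * v ^ (r * m : ℝ)))) *
        (gaussMoment r a)⁻¹ ^ m * 1 *
        ((4 * x / n) ^ x * Real.exp (-(n / 4) / τ)) *
        ((n / 2 : ℝ) ^ (1 / 2 : ℝ) / Real.Gamma (1 / 2) * τ ^ (-(1 / 2 + 1) : ℝ)) *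
        (v ^ (-x) * (α₂ ^ α₁ / Real.Gamma α₁ * v ^ (-(α₁ + 1)) * Real.exp (-α₂ / v))) := by
        have hP : 0 ≤ ∏ i, (l i)⁻¹ ^ r :=
          Finset.prod_nonneg fun i _ => pow_nonneg (inv_nonneg.2 (hl i).le) r
        refine mul_le_mul_of_nonneg_right (mul_le_mul_of_nonneg_right (mul_le_mul (mul_le_mul
          (mul_le_mul (hlik.trans ?_) hJ hJ0 (by positivity)) hexp (Real.exp_pos _).le
            (by positivity)) hτle (by positivity) (by positivity)) (by positivity)) (by positivity)
        gcongr
    _ = ((2 * Real.pi) ^ (-(n : ℝ) / 2) * (α₂ ^ α₁ / Real.Gamma α₁) *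
      (gaussMoment r a)⁻¹ ^ m * ((2 ^ r * r.factorial) ^ m * ∏ i, (l i)⁻¹ ^ r) *
      ((n / 2 : ℝ) ^ (1 / 2 : ℝ) / Real.Gamma (1 / 2) * (4 * x / n) ^ x)) *
      (τ ^ (-(1 / 2 + 1) : ℝ) * Real.exp (-(n / 4) / τ)) *
      ((v ^ (-(n : ℝ) / 2) * v ^ (r * m : ℝ) * v ^ (-x) * v ^ (-(α₁ + 1))) *
        (Real.exp (-(Q / 2) / v) * Real.exp (-α₂ / v))) * E := by ring
    _ = _ := by rw [hvpow, hvexp]; ring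

theorem marginal_le {n p : ℕ} (r : ℕ) {α₁ α₂ : ℝ} (hα₁ : 0 < α₁) (hα₂ : 0 < α₂) (hn : 1 ≤ n)
    {X : Matrix (Fin n) (Fin p) ℝ} {A : Matrix (Fin p) (Fin p) ℝ} {a₁ a₂ a : ℝ}
    (hA : ScaleMatrixBound A a₁ a₂) (ha₁ : 0 < a₁) (ha : 0 < a) (ha₂ : a₂ ≤ a) {k : Model p}
    {y : Fin n → ℝ} {Q κ : ℝ} {l c : k → ℝ} (hl : ∀ i, 0 < l i) (hκ : 0 < κ)
    (hB : 0 < α₂ + Q / 2)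
    (hQ : ∀ b : k → ℝ, Q + κ * ∑ i, (b i - c i) ^ 2 + ∑ i, l i * b i ^ 2 ≤
      ∑ i, (y i - (designSub X k *ᵥ b) i) ^ 2) :
    marginal r α₁ α₂ X A k y ≤ ENNReal.ofReal
      (marginalUpper r n α₁ α₂ (gaussMoment r a) κ (α₂ + Q / 2) k.card (∏ i, (l i)⁻¹ ^ r)) := by
  have hpi := Real.pi_pos
  have hn' : (0 : ℝ) < n := by exact_mod_cast hn
  have hΓ := Real.Gamma_pos_of_pos hα₁
  have hΓ' := Real.Gamma_pos_of_pos (show (0 : ℝ) < 1 / 2 by norm_num)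
  have hg := gaussMoment_pos r ha
  have hP : 0 ≤ ∏ i, (l i)⁻¹ ^ r :=
    Finset.prod_nonneg fun i _ => pow_nonneg (inv_nonneg.2 (hl i).le) r
  set C : ℝ := (2 * Real.pi) ^ (-(n : ℝ) / 2) * (α₂ ^ α₁ / Real.Gamma α₁) *
      (gaussMoment r a)⁻¹ ^ k.card * ((2 ^ r * r.factorial) ^ k.card * ∏ i, (l i)⁻¹ ^ r) *
      ((n / 2 : ℝ) ^ (1 / 2 : ℝ) / Real.Gamma (1 / 2) *
        (4 * ((r + 1 / 2) * k.card) / n) ^ ((r + 1 / 2) * k.card : ℝ)) with hC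
  have hC0 : 0 ≤ C := by positivity
  have hinner : ∀ τ ∈ Set.Ioi (0 : ℝ), ∀ v ∈ Set.Ioi (0 : ℝ), (∫⁻ b : k → ℝ,
      ENNReal.ofReal (likelihood X k b v y * pMOMDensity r A k τ v b *
        invGammaDensity (1 / 2) ((n : ℝ) / 2) τ * invGammaDensity α₁ α₂ v)) ≤
      ENNReal.ofReal (C * √(2 * Real.pi / κ) ^ k.card *
        (τ ^ (-(1 / 2 + 1) : ℝ) * Real.exp (-(n / 4) / τ))) *
      ENNReal.ofReal (v ^ (-(n / 2 + α₁ + 1)) * Real.exp (-(α₂ + Q / 2) / v)) := by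
    intro τ hτ v hv
    have hτ : 0 < τ := hτ
    have hv : 0 < v := hv
    calc _ ≤ ∫⁻ b : k → ℝ, ENNReal.ofReal (C *
            (τ ^ (-(1 / 2 + 1) : ℝ) * Real.exp (-(n / 4) / τ)) *
            (v ^ (-(n / 2 + α₁ + 1)) * Real.exp (-(α₂ + Q / 2) / v)) * v ^ (-(k.card : ℝ) / 2)) *
            ENNReal.ofReal (∏ i, Real.exp (-(κ * (b i - c i) ^ 2) / (2 * v))) := by
          refine lintegral_mono fun b => ?_
          rw [← ENNReal.ofReal_mul (by positivity)]
          refine ENNReal.ofReal_le_ofReal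
            ((integrand_le r hα₁ hα₂ hn hA ha₁ ha ha₂ hl hQ hτ hv b).trans_eq ?_)
          rw [← hC]; ring
      _ = _ := by
          rw [lintegral_const_mul' _ _ ENNReal.ofReal_ne_top, lintegral_prod_exp_neg_sq hκ hv,
            ← ENNReal.ofReal_mul (by positivity), ← ENNReal.ofReal_mul (by positivity),
            Fintype.card_coe]
          congr 1
          have h1 : √(2 * Real.pi * v / κ) ^ k.card =
              √(2 * Real.pi / κ) ^ k.card * v ^ ((k.card : ℝ) / 2) := by
            rw [show 2 * Real.pi * v / κ = 2 * Real.pi / κ * v by ring,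
              Real.sqrt_mul (by positivity), mul_pow, Real.sqrt_eq_rpow v, ← Real.rpow_mul_natCast hv.le]
            congr 2; ring
          have h2 : v ^ (-(k.card : ℝ) / 2) * v ^ ((k.card : ℝ) / 2) = 1 := by
            rw [← Real.rpow_add hv, neg_div, neg_add_cancel, Real.rpow_zero]
          rw [h1]
          linear_combination (C * (τ ^ (-(1 / 2 + 1) : ℝ) * Real.exp (-(n / 4) / τ)) *
            (v ^ (-(n / 2 + α₁ + 1)) * Real.exp (-(α₂ + Q / 2) / v)) *
            √(2 * Real.pi / κ) ^ k.card) * h2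
  have hΓN := Real.Gamma_pos_of_pos (show (0 : ℝ) < n / 2 + α₁ by positivity)
  calc marginal r α₁ α₂ X A k y
      ≤ ∫⁻ τ in Set.Ioi (0 : ℝ), ∫⁻ v in Set.Ioi (0 : ℝ),
        ENNReal.ofReal (C * √(2 * Real.pi / κ) ^ k.card *
          (τ ^ (-(1 / 2 + 1) : ℝ) * Real.exp (-(n / 4) / τ))) *
        ENNReal.ofReal (v ^ (-(n / 2 + α₁ + 1)) * Real.exp (-(α₂ + Q / 2) / v)) :=
        setLIntegral_mono' measurableSet_Ioi fun τ hτ =>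
          setLIntegral_mono' measurableSet_Ioi fun v hv => hinner τ hτ v hv
    _ = ∫⁻ τ in Set.Ioi (0 : ℝ), ENNReal.ofReal (C * √(2 * Real.pi / κ) ^ k.card *
          (Real.Gamma (n / 2 + α₁) * (α₂ + Q / 2) ^ (-(n / 2 + α₁)))) *
          ENNReal.ofReal (τ ^ (-(1 / 2 + 1) : ℝ) * Real.exp (-(n / 4) / τ)) := by
        refine setLIntegral_congr_fun measurableSet_Ioi fun τ hτ => ?_
        have hτ : 0 < τ := hτ
        rw [lintegral_const_mul' _ _ ENNReal.ofReal_ne_top,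
          lintegral_rpow_mul_exp_neg_div (by positivity) hB, ← ENNReal.ofReal_mul (by positivity),
          ← ENNReal.ofReal_mul (by positivity)]
        congr 1; ring
    _ = _ := by
        rw [lintegral_const_mul' _ _ ENNReal.ofReal_ne_top,
          lintegral_rpow_mul_exp_neg_div (by norm_num) (by positivity),
          ← ENNReal.ofReal_mul (by positivity)]
        congr 1
        have h1 : (n / 2 : ℝ) ^ (1 / 2 : ℝ) * (n / 4 : ℝ) ^ (-(1 / 2) : ℝ) = √2 := by
          rw [Real.rpow_neg (by positivity), ← Real.inv_rpow (by positivity),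
            ← Real.mul_rpow (by positivity) (by positivity), Real.sqrt_eq_rpow]
          congr 1; field_simp; norm_num
        rw [marginalUpper, ← h1, hC]
        field_simp

/-- The constant in the lower bound on the marginal density. -/
def marginalLower (r n : ℕ) (α₁ α₂ G B : ℝ) (m : ℕ) (w ρ : ℝ) : ℝ :=
  (2 * Real.pi) ^ (-(n : ℝ) / 2) * (α₂ ^ α₁ / Real.Gamma α₁) * G⁻¹ ^ m * ρ *
    (Real.exp (-(1 / 2)) / (4 * Real.Gamma (1 / 2)) * (2 * n : ℝ) ^ (-((r + 1 / 2) * m) : ℝ)) *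
    w ^ m * (Real.Gamma (n / 2 + α₁ + (r + 1 / 2) * m) * B ^ (-(n / 2 + α₁ + (r + 1 / 2) * m)))

/-- For τ ≥ n the prior form b'A_t b/τ is at most (a/n)∑ b_i², so it joins the residual sum of
squares inside Q. For τ ≤ 2n the powers of τ are bounded below. -/
theorem le_integrand {n p : ℕ} (r : ℕ) {α₁ α₂ : ℝ} (hα₁ : 0 < α₁) (hα₂ : 0 < α₂) (hn : 1 ≤ n)
    {X : Matrix (Fin n) (Fin p) ℝ} {A : Matrix (Fin p) (Fin p) ℝ} {a₁ a₂ a : ℝ}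
    (hA : ScaleMatrixBound A a₁ a₂) (ha₁ : 0 < a₁) (ha : 0 < a) (ha₂ : a₂ ≤ a) {t : Model p}
    {y : Fin n → ℝ} {Q ρ : ℝ} (hρ : 0 ≤ ρ) {b : t → ℝ}
    (hb : ∑ i, (y i - (designSub X t *ᵥ b) i) ^ 2 + a / n * ∑ i, b i ^ 2 ≤ Q)
    (hb' : ρ ≤ ∏ i, b i ^ (2 * r)) {τ v : ℝ} (hτ : τ ∈ Set.Icc (n : ℝ) (2 * n)) (hv : 0 < v) :
    ((2 * Real.pi) ^ (-(n : ℝ) / 2) * (α₂ ^ α₁ / Real.Gamma α₁) *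
      (gaussMoment r a₁)⁻¹ ^ t.card * ρ *
      (Real.exp (-(1 / 2)) / (4 * Real.Gamma (1 / 2)) *
        (2 * n : ℝ) ^ (-((r + 1 / 2) * t.card) : ℝ)) * (n : ℝ)⁻¹) *
      (v ^ (-(n / 2 + α₁ + (r + 1 / 2) * t.card + 1)) * Real.exp (-(α₂ + Q / 2) / v)) ≤
    likelihood X t b v y * pMOMDensity r A t τ v b *
      invGammaDensity (1 / 2) ((n : ℝ) / 2) τ * invGammaDensity α₁ α₂ v := by
  have hpi := Real.pi_pos
  have hn' : (0 : ℝ) < n := by exact_mod_cast hn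
  have hΓ := Real.Gamma_pos_of_pos hα₁
  have hΓ' := Real.Gamma_pos_of_pos (show (0 : ℝ) < 1 / 2 by norm_num)
  have hg := gaussMoment_pos r ha₁
  have hτ0 : 0 < τ := hn'.trans_le hτ.1
  set m := t.card with hm
  set x : ℝ := (r + 1 / 2) * m with hx
  have hx0 : 0 ≤ x := by positivity
  set S : ℝ := ∑ i, (y i - (designSub X t *ᵥ b) i) ^ 2 with hS
  have hexp : Real.exp (-(Q / 2) / v) ≤ Real.exp (-S / (2 * v)) *
      Real.exp (-(b ⬝ᵥ (prinSub A t *ᵥ b)) / (2 * (τ * v))) := by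
    rw [← Real.exp_add]
    refine Real.exp_le_exp.2 ?_
    have h1 := hA.dotProduct_prinSub_le t b
    have hs0 : 0 ≤ ∑ i, b i ^ 2 := Finset.sum_nonneg fun _ _ => sq_nonneg _
    have h2 : (b ⬝ᵥ (prinSub A t *ᵥ b)) / τ ≤ a / n * ∑ i, b i ^ 2 := by
      rw [div_le_iff₀ hτ0]
      calc _ ≤ a * ∑ i, b i ^ 2 := h1.trans (mul_le_mul_of_nonneg_right ha₂ hs0)
        _ = a / n * (∑ i, b i ^ 2) * n := by field_simp
        _ ≤ _ := mul_le_mul_of_nonneg_left hτ.1 (by positivity)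
    have h3 : -S / (2 * v) + -(b ⬝ᵥ (prinSub A t *ᵥ b)) / (2 * (τ * v)) =
        -((S + (b ⬝ᵥ (prinSub A t *ᵥ b)) / τ) / 2) / v := by field_simp; ring
    rw [h3]
    refine div_le_div_of_nonneg_right ?_ hv.le
    linarith
  have hJ : (gaussMoment r a₁)⁻¹ ^ m ≤ (priorMoment r A t)⁻¹ := by
    rw [inv_pow]
    exact inv_anti₀ ((pow_pos (gaussMoment_pos r ha) _).trans_le
      (le_priorMoment r hA ha₁ ha ha₂ t)) (priorMoment_le r hA ha₁ t)
  have hτx : (2 * n : ℝ) ^ (-x) ≤ τ ^ (-x) :=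
    Real.rpow_le_rpow_of_nonpos hτ0 hτ.2 (by linarith)
  have hτ3 : (2 * n : ℝ) ^ (-(1 / 2 + 1) : ℝ) ≤ τ ^ (-(1 / 2 + 1) : ℝ) :=
    Real.rpow_le_rpow_of_nonpos hτ0 hτ.2 (by norm_num)
  have hτe : Real.exp (-(1 / 2)) ≤ Real.exp (-(n / 2) / τ) := by
    refine Real.exp_le_exp.2 ?_
    rw [neg_div, neg_le_neg_iff, div_le_iff₀ hτ0]
    linarith [hτ.1]
  -- The density of τ on [n, 2n] is of order 1/n; the length n of that interval cancels this factor
  -- in `le_marginal`.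
  have hquarter : (n / 2 : ℝ) ^ (1 / 2 : ℝ) * (2 * n : ℝ) ^ (-(1 / 2 + 1) : ℝ) = (n : ℝ)⁻¹ / 4 := by
    rw [neg_add, Real.rpow_add (by positivity), Real.rpow_neg_one, Real.rpow_neg (by positivity),
      ← Real.inv_rpow (by positivity), ← mul_assoc,
      ← Real.mul_rpow (by positivity) (by positivity),
      show (n / 2 : ℝ) * (2 * (n : ℝ))⁻¹ = (1 / 2) ^ (2 : ℝ) by
        rw [Real.rpow_two]; field_simp,
      ← Real.rpow_mul (by norm_num)]
    norm_num
    ring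
  have hvpow : v ^ (-(n / 2 + α₁ + x + 1)) =
      v ^ (-(n : ℝ) / 2) * v ^ (-x) * v ^ (-(α₁ + 1)) := by
    rw [← Real.rpow_add hv, ← Real.rpow_add hv]
    congr 1; ring
  have hvexp : Real.exp (-(α₂ + Q / 2) / v) =
      Real.exp (-(Q / 2) / v) * Real.exp (-α₂ / v) := by
    rw [← Real.exp_add]; congr 1; ring
  rw [pMOMDensity_eq r hA ha₁, Real.mul_rpow hτ0.le hv.le, invGammaDensity, invGammaDensity,
    likelihood, Real.mul_rpow (by positivity) hv.le, ← hS]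
  calc _ = ((2 * Real.pi) ^ (-(n : ℝ) / 2) * v ^ (-(n : ℝ) / 2)) * (gaussMoment r a₁)⁻¹ ^ m *
        ρ * Real.exp (-(Q / 2) / v) * ((2 * n : ℝ) ^ (-x) * v ^ (-x)) *
        ((n / 2 : ℝ) ^ (1 / 2 : ℝ) / Real.Gamma (1 / 2) *
          (2 * n : ℝ) ^ (-(1 / 2 + 1) : ℝ) * Real.exp (-(1 / 2))) *
        (α₂ ^ α₁ / Real.Gamma α₁ * v ^ (-(α₁ + 1)) * Real.exp (-α₂ / v)) := by
        rw [hvpow, hvexp]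
        linear_combination (-((2 * Real.pi) ^ (-(n : ℝ) / 2) * v ^ (-(n : ℝ) / 2)) *
          (gaussMoment r a₁)⁻¹ ^ m * ρ * Real.exp (-(Q / 2) / v) *
          ((2 * n : ℝ) ^ (-x) * v ^ (-x)) * ((Real.Gamma (1 / 2))⁻¹ * Real.exp (-(1 / 2))) *
          (α₂ ^ α₁ / Real.Gamma α₁ * v ^ (-(α₁ + 1)) * Real.exp (-α₂ / v))) * hquarter
    _ ≤ ((2 * Real.pi) ^ (-(n : ℝ) / 2) * v ^ (-(n : ℝ) / 2)) * (priorMoment r A t)⁻¹ *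
        (∏ i, b i ^ (2 * r)) * (Real.exp (-S / (2 * v)) *
          Real.exp (-(b ⬝ᵥ (prinSub A t *ᵥ b)) / (2 * (τ * v)))) * (τ ^ (-x) * v ^ (-x)) *
        ((n / 2 : ℝ) ^ (1 / 2 : ℝ) / Real.Gamma (1 / 2) *
          τ ^ (-(1 / 2 + 1) : ℝ) * Real.exp (-(n / 2) / τ)) *
        (α₂ ^ α₁ / Real.Gamma α₁ * v ^ (-(α₁ + 1)) * Real.exp (-α₂ / v)) := by
        have hJ0 : 0 ≤ (priorMoment r A t)⁻¹ := (by positivity : (0 : ℝ) ≤ _).trans hJ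
        have hprod := prod_pow_two_mul_nonneg r b
        gcongr
    _ = _ := by rw [← hx]; ring

theorem le_marginal {n p : ℕ} (r : ℕ) {α₁ α₂ : ℝ} (hα₁ : 0 < α₁) (hα₂ : 0 < α₂) (hn : 1 ≤ n)
    {X : Matrix (Fin n) (Fin p) ℝ} {A : Matrix (Fin p) (Fin p) ℝ} {a₁ a₂ a : ℝ}
    (hA : ScaleMatrixBound A a₁ a₂) (ha₁ : 0 < a₁) (ha : 0 < a) (ha₂ : a₂ ≤ a) {t : Model p}
    {y : Fin n → ℝ} {Q ρ w : ℝ} (hρ : 0 ≤ ρ) (hw : 0 ≤ w) {c : t → ℝ} (hB : 0 < α₂ + Q / 2)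
    (hbox : ∀ b ∈ Set.Icc c (fun i => c i + w),
      ∑ i, (y i - (designSub X t *ᵥ b) i) ^ 2 + a / n * ∑ i, b i ^ 2 ≤ Q ∧
        ρ ≤ ∏ i, b i ^ (2 * r)) :
    ENNReal.ofReal (marginalLower r n α₁ α₂ (gaussMoment r a₁) (α₂ + Q / 2) t.card w ρ) ≤
      marginal r α₁ α₂ X A t y := by
  have hpi := Real.pi_pos
  have hn' : (0 : ℝ) < n := by exact_mod_cast hn
  have hΓ := Real.Gamma_pos_of_pos hα₁
  have hΓ' := Real.Gamma_pos_of_pos (show (0 : ℝ) < 1 / 2 by norm_num)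
  have hg := gaussMoment_pos r ha₁
  set x : ℝ := (r + 1 / 2) * t.card with hx
  have hx0 : 0 ≤ x := by positivity
  have hΓN := Real.Gamma_pos_of_pos (show (0 : ℝ) < n / 2 + α₁ + x by positivity)
  set C : ℝ := (2 * Real.pi) ^ (-(n : ℝ) / 2) * (α₂ ^ α₁ / Real.Gamma α₁) *
      (gaussMoment r a₁)⁻¹ ^ t.card * ρ *
      (Real.exp (-(1 / 2)) / (4 * Real.Gamma (1 / 2)) * (2 * n : ℝ) ^ (-x)) * (n : ℝ)⁻¹ with hC
  have hC0 : 0 ≤ C := by positivity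
  have hvol : volume (Set.Icc c (fun i => c i + w)) = ENNReal.ofReal (w ^ t.card) := by
    rw [Real.volume_Icc_pi]
    simp [ENNReal.ofReal_pow hw]
  have hinner : ∀ τ ∈ Set.Icc (n : ℝ) (2 * n), ∀ v ∈ Set.Ioi (0 : ℝ),
      ENNReal.ofReal (C * w ^ t.card) *
        ENNReal.ofReal (v ^ (-(n / 2 + α₁ + x + 1)) * Real.exp (-(α₂ + Q / 2) / v)) ≤
      ∫⁻ b : t → ℝ, ENNReal.ofReal (likelihood X t b v y * pMOMDensity r A t τ v b *
        invGammaDensity (1 / 2) ((n : ℝ) / 2) τ * invGammaDensity α₁ α₂ v) := by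
    intro τ hτ v hv
    have hv : 0 < v := hv
    calc _ = ∫⁻ _b in Set.Icc c (fun i => c i + w), ENNReal.ofReal (C *
          (v ^ (-(n / 2 + α₁ + x + 1)) * Real.exp (-(α₂ + Q / 2) / v))) := by
          rw [setLIntegral_const, hvol, ← ENNReal.ofReal_mul (by positivity),
            ← ENNReal.ofReal_mul (by positivity)]
          congr 1; ring
      _ ≤ ∫⁻ b in Set.Icc c (fun i => c i + w), ENNReal.ofReal
          (likelihood X t b v y * pMOMDensity r A t τ v b *
            invGammaDensity (1 / 2) ((n : ℝ) / 2) τ * invGammaDensity α₁ α₂ v) :=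
          setLIntegral_mono' measurableSet_Icc fun b hb => ENNReal.ofReal_le_ofReal
            (le_integrand r hα₁ hα₂ hn hA ha₁ ha ha₂ hρ (hbox b hb).1 (hbox b hb).2 hτ hv)
      _ ≤ _ := setLIntegral_le_lintegral _ _
  calc _ = ∫⁻ _τ in Set.Icc (n : ℝ) (2 * n), ENNReal.ofReal (C * w ^ t.card *
        (Real.Gamma (n / 2 + α₁ + x) * (α₂ + Q / 2) ^ (-(n / 2 + α₁ + x)))) := by
        rw [setLIntegral_const, Real.volume_Icc, ← ENNReal.ofReal_mul (by positivity)]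
        congr 1
        rw [marginalLower, hC, ← hx]
        field_simp
        ring
    _ = ∫⁻ _τ in Set.Icc (n : ℝ) (2 * n), ∫⁻ v in Set.Ioi (0 : ℝ),
        ENNReal.ofReal (C * w ^ t.card) *
        ENNReal.ofReal (v ^ (-(n / 2 + α₁ + x + 1)) * Real.exp (-(α₂ + Q / 2) / v)) := by
        rw [lintegral_const_mul' _ _ ENNReal.ofReal_ne_top,
          lintegral_rpow_mul_exp_neg_div (by positivity) hB, ← ENNReal.ofReal_mul (by positivity)]
    _ ≤ ∫⁻ τ in Set.Icc (n : ℝ) (2 * n), ∫⁻ v in Set.Ioi (0 : ℝ), ∫⁻ b : t → ℝ,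
        ENNReal.ofReal (likelihood X t b v y * pMOMDensity r A t τ v b *
          invGammaDensity (1 / 2) ((n : ℝ) / 2) τ * invGammaDensity α₁ α₂ v) :=
        setLIntegral_mono' measurableSet_Icc fun τ hτ =>
          setLIntegral_mono' measurableSet_Ioi fun v hv => hinner τ hτ v hv
    _ ≤ _ := lintegral_mono_set fun τ hτ => hn'.trans_le hτ.1

/-! ### Bounds on the residual sums of squares -/

theorem response_sub_mulVec {n p : ℕ} (X : Matrix (Fin n) (Fin p) ℝ) (β₀ : ℕ → ℝ) (e : Fin n → ℝ)
    (k : Model p) (b : k → ℝ) (i : Fin n) :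
    response X β₀ e i - (designSub X k *ᵥ b) i =
      e i - (X *ᵥ fun j => extendZero k b j - β₀ j) i := by
  have : (fun j : Fin p => extendZero k b j - β₀ j) =
      extendZero k b - fun j : Fin p => β₀ j := rfl
  rw [designSub_mulVec, response, this, Matrix.mulVec_sub]
  simp only [Pi.add_apply, Pi.sub_apply]
  ring

theorem sum_extendZero_sub_sq {p : ℕ} (k : Model p) (b : k → ℝ) (β : Fin p → ℝ) :
    ∑ j, (extendZero k b j - β j) ^ 2 =
      ∑ i : k, (b i - β i) ^ 2 + ∑ j ∈ kᶜ, β j ^ 2 := by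
  rw [← Finset.sum_add_sum_compl k, ← Finset.sum_coe_sort k]
  congr 1
  · simp [extendZero_of_mem]
  · refine Finset.sum_congr rfl fun j hj => ?_
    rw [extendZero_of_notMem b (by simpa using hj)]
    ring

/-- The residual sum of squares, less a small multiple of the squared coefficients, stays above
that of the noise up to a projection, and gains a term of order `n` for every omitted covariate. -/
theorem le_residual_sum_sq {n p : ℕ} {X : Matrix (Fin n) (Fin p) ℝ} {ε : ℝ} (hX : EigenBound X ε)
    (hn : 1 ≤ n) (hnε : 128 ≤ n * ε) {t k : Model p} (hk : (k ∪ t).card ≤ n) {β₀ : ℕ → ℝ}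
    (hβ : ∀ j : Fin p, j ∉ t → β₀ j = 0) (e : Fin n → ℝ) {W : ℝ}
    (hW : ‖(columnSpan X t).starProjection (WithLp.toLp 2 e)‖ ^ 2 +
      ‖(residualSpan X t (k \ t)).starProjection (WithLp.toLp 2 e)‖ ^ 2 ≤ W) (b : k → ℝ) :
    (∑ i, e i ^ 2 - 64 / 61 * W - 2 * ∑ j : Fin p, β₀ j ^ 2 +
        n * ε / 64 * ∑ j ∈ kᶜ, β₀ j ^ 2) +
      n * ε / 64 * ∑ i : k, (b i - β₀ (i : Fin p)) ^ 2 +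
      ∑ i : k, (if (i : Fin p) ∈ t then 1 else n * ε / 64) * b i ^ 2 ≤
    ∑ i, (response X β₀ e i - (designSub X k *ᵥ b) i) ^ 2 := by
  set h : Fin p → ℝ := fun j => extendZero k b j - β₀ j with hh
  have hsupp : ∀ j ∉ k ∪ t, h j = 0 := fun j hj => by
    simp only [Finset.mem_union, not_or] at hj
    simp [hh, extendZero_of_notMem b hj.1, hβ j hj.2]
  have hlow := hX.le_sum_mulVec_sq hn hk hsupp
  rw [hh, sum_extendZero_sub_sq k b (fun j : Fin p => β₀ j), ← hh] at hlow
  have hcs := inner_mulVec_sq_le X t (k \ t) e (h := h) fun j h1 h2 => hsupp j (by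
    simp only [Finset.mem_sdiff, not_and, not_not] at h2
    simp only [Finset.mem_union, not_or]
    exact ⟨fun hjk => h1 (h2 hjk), h1⟩)
  set Z : ℝ := ∑ i, (X *ᵥ h) i ^ 2 with hZ
  set c : ℝ := ∑ i, e i * (X *ᵥ h) i with hc
  have hZ0 : 0 ≤ Z := Finset.sum_nonneg fun _ _ => sq_nonneg _
  have hexpand : ∑ i, (response X β₀ e i - (designSub X k *ᵥ b) i) ^ 2 =
      ∑ i, e i ^ 2 - 2 * c + Z := by
    rw [hc, hZ, Finset.mul_sum, ← Finset.sum_sub_distrib, ← Finset.sum_add_distrib]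
    refine Finset.sum_congr rfl fun i _ => ?_
    rw [response_sub_mulVec, ← hh]
    ring
  have hcW : c ^ 2 ≤ W * Z := hcs.trans (mul_le_mul_of_nonneg_right hW hZ0)
  have hW0 : 0 ≤ W := le_trans (by positivity) hW
  -- The weights keep the constant of W close to 1, as the final exponent requires, and leave
  -- (3/64)Z, that is, three shares of nε/64. Two are needed on k, for the κ-part and the l-part,
  -- and one off k, for the omitted signal.
  have h2c : 2 * c ≤ 64 / 61 * W + 61 / 64 * Z := by
    refine le_of_sq_le_sq ?_ (by positivity)
    nlinarith [sq_nonneg (64 / 61 * W - 61 / 64 * Z)]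
  have hl : ∑ i : k, (if (i : Fin p) ∈ t then 1 else n * ε / 64) * b i ^ 2 ≤
      2 * ∑ j : Fin p, β₀ j ^ 2 + n * ε / 64 * ∑ i : k, (b i - β₀ (i : Fin p)) ^ 2 := by
    have h1 : ∑ i : k, β₀ (i : Fin p) ^ 2 ≤ ∑ j : Fin p, β₀ j ^ 2 := by
      rw [Finset.sum_coe_sort k fun j : Fin p => β₀ j ^ 2]
      exact Finset.sum_le_sum_of_subset_of_nonneg (Finset.subset_univ k)
        fun _ _ _ => sq_nonneg _
    calc _ ≤ ∑ i : k, (2 * β₀ (i : Fin p) ^ 2 + n * ε / 64 * (b i - β₀ (i : Fin p)) ^ 2) := by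
          refine Finset.sum_le_sum fun i _ => ?_
          split_ifs with hit
          -- For a true covariate b² ≤ 2β² + 2(b - β)², and 2 ≤ nε/64; hence the weight 1 and the
          -- loss 2∑β². A spurious one has β = 0 and keeps the full weight.
          · have h2 : 2 * (b i - β₀ (i : Fin p)) ^ 2 ≤ n * ε / 64 * (b i - β₀ (i : Fin p)) ^ 2 :=
              mul_le_mul_of_nonneg_right (by linarith) (sq_nonneg _)
            nlinarith [sq_nonneg (b i - 2 * β₀ (i : Fin p))]
          · rw [hβ i hit]; simp
      _ = 2 * ∑ i : k, β₀ (i : Fin p) ^ 2 +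
          n * ε / 64 * ∑ i : k, (b i - β₀ (i : Fin p)) ^ 2 := by
          rw [Finset.sum_add_distrib, Finset.mul_sum, Finset.mul_sum]
      _ ≤ _ := by linarith
  have hpos : 0 ≤ n * ε * ∑ j ∈ kᶜ, β₀ j ^ 2 :=
    mul_nonneg (by linarith) (Finset.sum_nonneg fun _ _ => sq_nonneg _)
  rw [hexpand]
  nlinarith

/-- On a cube of side n^{-1/2} the fitted mean moves by at most Tε⁻¹ in squared norm, so the
residual exceeds the noise only by lower-order terms. With s = ∅ the residual span is trivial and
only the columns of t meet the noise. -/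
theorem residual_sum_sq_le {n p : ℕ} {X : Matrix (Fin n) (Fin p) ℝ} {ε : ℝ} (hX : EigenBound X ε)
    (hn : 1 ≤ n) (hε : 0 < ε) {t : Model p} {β₀ : ℕ → ℝ}
    (hβ : ∀ j : Fin p, j ∉ t → β₀ j = 0) (e : Fin n → ℝ) {W a : ℝ} (ha : 0 ≤ a)
    (hW : ‖(columnSpan X t).starProjection (WithLp.toLp 2 e)‖ ^ 2 +
      ‖(residualSpan X t ∅).starProjection (WithLp.toLp 2 e)‖ ^ 2 ≤ W) {b : t → ℝ}
    (hb : b ∈ Set.Icc (fun i : t => β₀ (i : Fin p))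
      (fun i : t => β₀ (i : Fin p) + (√n)⁻¹)) :
    ∑ i, (response X β₀ e i - (designSub X t *ᵥ b) i) ^ 2 + a / n * ∑ i, b i ^ 2 ≤
      ∑ i, e i ^ 2 + W + 2 * t.card * ε⁻¹ + a * (2 * ∑ j : Fin p, β₀ j ^ 2 + 2 * t.card) := by
  have hn' : (1 : ℝ) ≤ n := by exact_mod_cast hn
  set h : Fin p → ℝ := fun j => extendZero t b j - β₀ j with hh
  have hsupp : ∀ j, j ∉ t → j ∉ (∅ : Model p) → h j = 0 := fun j hj _ => by
    simp [hh, extendZero_of_notMem b hj, hβ j hj]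
  have hcompl : ∑ j ∈ tᶜ, β₀ j ^ 2 = 0 := Finset.sum_eq_zero fun j hj => by
    rw [hβ j (by simpa using hj)]; simp
  have hup := hX.sum_mulVec_sq_le hn h
  rw [hh, sum_extendZero_sub_sq t b (fun j : Fin p => β₀ j), hcompl, add_zero, ← hh] at hup
  have hsq : ∀ i : t, (b i - β₀ (i : Fin p)) ^ 2 ≤ (n : ℝ)⁻¹ := fun i => by
    have h1 := hb.1 i
    have h2 := hb.2 i
    simp only at h1 h2
    calc _ ≤ ((√n)⁻¹) ^ 2 := pow_le_pow_left₀ (by linarith) (by linarith) 2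
      _ = _ := by rw [inv_pow, Real.sq_sqrt (by positivity)]
  have hsum : ∑ i : t, (b i - β₀ (i : Fin p)) ^ 2 ≤ t.card * (n : ℝ)⁻¹ :=
    (Finset.sum_le_sum fun i _ => hsq i).trans_eq (by simp)
  have hcs := inner_mulVec_sq_le X t ∅ e (h := h) hsupp
  set Z : ℝ := ∑ i, (X *ᵥ h) i ^ 2 with hZ
  set c : ℝ := ∑ i, e i * (X *ᵥ h) i with hc
  have hZ0 : 0 ≤ Z := Finset.sum_nonneg fun _ _ => sq_nonneg _
  have hZle : Z ≤ t.card * ε⁻¹ := by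
    refine hup.trans ?_
    calc n * ε⁻¹ * ∑ i : t, (b i - β₀ (i : Fin p)) ^ 2 ≤ n * ε⁻¹ * (t.card * (n : ℝ)⁻¹) := by
          gcongr
      _ = _ := by field_simp
  have hexpand : ∑ i, (response X β₀ e i - (designSub X t *ᵥ b) i) ^ 2 =
      ∑ i, e i ^ 2 - 2 * c + Z := by
    rw [hc, hZ, Finset.mul_sum, ← Finset.sum_sub_distrib, ← Finset.sum_add_distrib]
    refine Finset.sum_congr rfl fun i _ => ?_
    rw [response_sub_mulVec, ← hh]
    ring
  have hcW : c ^ 2 ≤ W * Z := hcs.trans (mul_le_mul_of_nonneg_right hW hZ0)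
  have hW0 : 0 ≤ W := le_trans (by positivity) hW
  have h2c : 2 * (-c) ≤ W + Z := by
    refine le_of_sq_le_sq ?_ (by positivity)
    nlinarith [sq_nonneg (W - Z)]
  have hbsum : ∑ i, b i ^ 2 ≤ 2 * ∑ j : Fin p, β₀ j ^ 2 + 2 * t.card := by
    have h1 : ∑ i : t, β₀ (i : Fin p) ^ 2 ≤ ∑ j : Fin p, β₀ j ^ 2 := by
      rw [Finset.sum_coe_sort t fun j : Fin p => β₀ j ^ 2]
      exact Finset.sum_le_sum_of_subset_of_nonneg (Finset.subset_univ t)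
        fun _ _ _ => sq_nonneg _
    have h2 : ∑ i, b i ^ 2 ≤ ∑ i : t, (2 * β₀ (i : Fin p) ^ 2 +
        2 * (b i - β₀ (i : Fin p)) ^ 2) :=
      Finset.sum_le_sum fun i _ => by nlinarith [sq_nonneg (b i - 2 * β₀ (i : Fin p))]
    rw [Finset.sum_add_distrib, ← Finset.mul_sum, ← Finset.mul_sum] at h2
    have h3 : (t.card : ℝ) * (n : ℝ)⁻¹ ≤ t.card :=
      mul_le_of_le_one_right (by positivity) (inv_le_one_of_one_le₀ hn')
    linarith
  have hbs0 : 0 ≤ ∑ i, b i ^ 2 := Finset.sum_nonneg fun _ _ => sq_nonneg _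
  have hlast : a / n * ∑ i, b i ^ 2 ≤ a * (2 * ∑ j : Fin p, β₀ j ^ 2 + 2 * t.card) :=
    mul_le_mul (div_le_self ha hn') hbsum hbs0 ha
  rw [hexpand]
  linarith

theorem le_prod_pow_of_mem_Icc {p : ℕ} {t : Model p} {β₀ : ℕ → ℝ} {w b₀ : ℝ} (r : ℕ)
    (hb₀ : 0 ≤ b₀) (hβ : ∀ j ∈ t, b₀ ≤ |β₀ (j : Fin p)|) (hw : w ≤ b₀ / 2) {b : t → ℝ}
    (hb : b ∈ Set.Icc (fun i : t => β₀ (i : Fin p)) (fun i : t => β₀ (i : Fin p) + w)) :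
    ((b₀ / 2) ^ (2 * r)) ^ t.card ≤ ∏ i, b i ^ (2 * r) := by
  have hcard : ((b₀ / 2) ^ (2 * r)) ^ t.card = ∏ _i : t, (b₀ / 2) ^ (2 * r) := by simp
  rw [hcard]
  refine Finset.prod_le_prod (fun i _ => by positivity) fun i _ => ?_
  rw [pow_mul, pow_mul]
  refine pow_le_pow_left₀ (by positivity) ?_ r
  rw [← sq_abs (b i)]
  refine pow_le_pow_left₀ (by positivity) ?_ 2
  have h1 := hb.1 i
  have h2 := hb.2 i
  have h3 := hβ i i.2
  simp only at h1 h2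
  have h4 : |β₀ (i : Fin p) - b i| ≤ b₀ / 2 := by
    rw [abs_le]; constructor <;> linarith
  have h5 := abs_sub_abs_le_abs_sub (β₀ (i : Fin p)) (b i)
  linarith

/-! ### The ratio of the bounds on the marginal densities -/

/-- Log-convexity of Γ, with N as a convex combination of N + a and N - 1, followed by Γ(N) = (N -
1)Γ(N - 1). -/
theorem Gamma_mul_rpow_le {N a : ℝ} (hN : 1 < N) (ha : 0 ≤ a) :
    Real.Gamma N * (N - 1) ^ a ≤ Real.Gamma (N + a) := by
  rcases ha.eq_or_lt with rfl | ha
  · simp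
  have h1 : 0 < N - 1 := by linarith
  have hG1 := Real.Gamma_pos_of_pos h1
  have hGN := Real.Gamma_pos_of_pos (show 0 < N by linarith)
  have hGa := Real.Gamma_pos_of_pos (show 0 < N + a by linarith)
  have hconv := Real.Gamma_mul_add_mul_le_rpow_Gamma_mul_rpow_Gamma (s := N + a) (t := N - 1)
    (a := 1 / (a + 1)) (b := a / (a + 1)) (by linarith) h1 (by positivity) (by positivity)
    (by field_simp; ring)
  rw [show 1 / (a + 1) * (N + a) + a / (a + 1) * (N - 1) = N by field_simp; ring] at hconv
  have hpow := Real.rpow_le_rpow hGN.le hconv (show 0 ≤ a + 1 by linarith)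
  rw [Real.mul_rpow (by positivity) (by positivity), ← Real.rpow_mul hGa.le,
    ← Real.rpow_mul hG1.le, show 1 / (a + 1) * (a + 1) = 1 by field_simp,
    show a / (a + 1) * (a + 1) = a by field_simp, Real.rpow_one, Real.rpow_add hGN,
    Real.rpow_one] at hpow
  have hrec : Real.Gamma N = (N - 1) * Real.Gamma (N - 1) := by
    have := Real.Gamma_add_one h1.ne'
    rwa [sub_add_cancel] at this
  have hsplit : Real.Gamma N ^ a = (N - 1) ^ a * Real.Gamma (N - 1) ^ a := by
    conv_lhs => rw [hrec]
    exact Real.mul_rpow h1.le hG1.le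
  rw [hsplit] at hpow
  refine le_of_mul_le_mul_right (a := Real.Gamma (N - 1) ^ a) ?_ (by positivity)
  linarith

/-- The prefactor left outside the exponential is the one in `marginalLower_eq_exp`, so it cancels
in the ratio. -/
theorem marginalUpper_eq_exp (r n : ℕ) (hn : 1 ≤ n) {α₁ α₂ g κ B : ℝ} (hα₁ : 0 < α₁)
    (hg : 0 < g) (hκ : 0 < κ) (hB : 0 < B) (m s : ℕ) :
    marginalUpper r n α₁ α₂ g κ B m ((κ⁻¹ ^ r) ^ s) =
      (2 * Real.pi) ^ (-(n : ℝ) / 2) * (α₂ ^ α₁ / Real.Gamma α₁) *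
      Real.exp (-(m * Real.log g) + 1 / 2 * Real.log 2 +
        (r + 1 / 2) * m * (Real.log (4 * r + 2) + Real.log m - Real.log n) +
        m * Real.log (2 ^ r * r.factorial) - r * s * Real.log κ +
        m / 2 * (Real.log (2 * Real.pi) - Real.log κ) +
        Real.log (Real.Gamma (n / 2 + α₁)) - (n / 2 + α₁) * Real.log B) := by
  have hpi := Real.pi_pos
  have hn' : (0 : ℝ) < n := by exact_mod_cast hn
  have hΓN := Real.Gamma_pos_of_pos (show (0 : ℝ) < n / 2 + α₁ by positivity)
  have h1 : g⁻¹ ^ m = Real.exp (-(m * Real.log g)) := by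
    rw [inv_pow, Real.exp_neg, Real.exp_nat_mul, Real.exp_log hg]
  have h2 : √2 = Real.exp (1 / 2 * Real.log 2) := by
    rw [Real.sqrt_eq_rpow, Real.rpow_def_of_pos (by norm_num), mul_comm]
  have h3 : (4 * ((r + 1 / 2) * m) / n : ℝ) ^ ((r + 1 / 2) * m : ℝ) =
      Real.exp ((r + 1 / 2) * m * (Real.log (4 * r + 2) + Real.log m - Real.log n)) := by
    -- At m = 0 the base is 0 and 0^0 = 1; on the right log 0 = 0 has coefficient 0.
    rcases Nat.eq_zero_or_pos m with rfl | hm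
    · simp
    · have hm' : (0 : ℝ) < m := by exact_mod_cast hm
      rw [Real.rpow_def_of_pos (by positivity), mul_comm,
        show (4 * ((r + 1 / 2) * m) / n : ℝ) = (4 * r + 2) * m / n by ring,
        Real.log_div (by positivity) (by positivity), Real.log_mul (by positivity) (by positivity)]
  have h4 : ((2 : ℝ) ^ r * r.factorial) ^ m =
      Real.exp (m * Real.log (2 ^ r * r.factorial)) := by
    rw [Real.exp_nat_mul, Real.exp_log (by positivity)]
  have h5 : (κ⁻¹ ^ r) ^ s = Real.exp (-(r * s * Real.log κ)) := by
    rw [← pow_mul, inv_pow, Real.exp_neg, ← Nat.cast_mul, Real.exp_nat_mul, Real.exp_log hκ]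
  have h6 : √(2 * Real.pi / κ) ^ m =
      Real.exp (m / 2 * (Real.log (2 * Real.pi) - Real.log κ)) := by
    rw [← Real.log_div (by positivity) hκ.ne', div_mul_comm, mul_comm (_ / 2) (m : ℝ),
      Real.exp_nat_mul, Real.sqrt_eq_rpow, Real.rpow_def_of_pos (by positivity)]
    congr 2; ring
  have h7 : Real.Gamma (n / 2 + α₁) * B ^ (-(n / 2 + α₁)) =
      Real.exp (Real.log (Real.Gamma (n / 2 + α₁)) - (n / 2 + α₁) * Real.log B) := by
    rw [Real.rpow_def_of_pos hB, sub_eq_add_neg, Real.exp_add, Real.exp_log hΓN]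
    congr 2; ring
  rw [marginalUpper, h1, h2, h3, h4, h5, h6, h7]
  rw [mul_assoc _ (Real.exp _) (Real.exp _ * Real.exp _), ← Real.exp_add, ← Real.exp_add,
    mul_assoc _ (Real.exp _) (Real.exp _ * Real.exp _), ← Real.exp_add, ← Real.exp_add,
    mul_assoc _ (Real.exp _) (Real.exp _), ← Real.exp_add, mul_assoc _ (Real.exp _) (Real.exp _),
    ← Real.exp_add]
  congr 2; ring

theorem marginalLower_eq_exp (r n : ℕ) (hn : 1 ≤ n) {α₁ α₂ G B d : ℝ} (hα₁ : 0 < α₁)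
    (hG : 0 < G) (hB : 0 < B) (hd : 0 < d) (m : ℕ) :
    marginalLower r n α₁ α₂ G B m (√n)⁻¹ (d ^ m) =
      (2 * Real.pi) ^ (-(n : ℝ) / 2) * (α₂ ^ α₁ / Real.Gamma α₁) *
      Real.exp (-(m * Real.log G) + m * Real.log d +
        Real.log (Real.exp (-(1 / 2)) / (4 * Real.Gamma (1 / 2))) -
        (r + 1 / 2) * m * (Real.log 2 + Real.log n) - m / 2 * Real.log n +
        Real.log (Real.Gamma (n / 2 + α₁ + (r + 1 / 2) * m)) -
        (n / 2 + α₁ + (r + 1 / 2) * m) * Real.log B) := by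
  have hn' : (0 : ℝ) < n := by exact_mod_cast hn
  have hΓN := Real.Gamma_pos_of_pos (show (0 : ℝ) < n / 2 + α₁ + (r + 1 / 2) * m by positivity)
  have hΓ' := Real.Gamma_pos_of_pos (show (0 : ℝ) < 1 / 2 by norm_num)
  have h1 : G⁻¹ ^ m = Real.exp (-(m * Real.log G)) := by
    rw [inv_pow, Real.exp_neg, Real.exp_nat_mul, Real.exp_log hG]
  have h2 : d ^ m = Real.exp (m * Real.log d) := by
    rw [Real.exp_nat_mul, Real.exp_log hd]
  have h3 : Real.exp (-(1 / 2)) / (4 * Real.Gamma (1 / 2)) =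
      Real.exp (Real.log (Real.exp (-(1 / 2)) / (4 * Real.Gamma (1 / 2)))) :=
    (Real.exp_log (by positivity)).symm
  have h4 : (2 * n : ℝ) ^ (-((r + 1 / 2) * m) : ℝ) =
      Real.exp (-((r + 1 / 2) * m * (Real.log 2 + Real.log n))) := by
    rw [Real.rpow_def_of_pos (by positivity), Real.log_mul (by norm_num) hn'.ne']
    congr 1; ring
  have h5 : ((√n)⁻¹) ^ m = Real.exp (-(m / 2 * Real.log n)) := by
    rw [inv_pow, Real.exp_neg, div_mul_eq_mul_div, mul_div_assoc, Real.exp_nat_mul,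
      Real.sqrt_eq_rpow, Real.rpow_def_of_pos hn']
    congr 3; ring
  have h6 : Real.Gamma (n / 2 + α₁ + (r + 1 / 2) * m) * B ^ (-(n / 2 + α₁ + (r + 1 / 2) * m)) =
      Real.exp (Real.log (Real.Gamma (n / 2 + α₁ + (r + 1 / 2) * m)) -
        (n / 2 + α₁ + (r + 1 / 2) * m) * Real.log B) := by
    rw [Real.rpow_def_of_pos hB, sub_eq_add_neg, Real.exp_add, Real.exp_log hΓN]
    congr 2; ring
  rw [marginalLower, h1, h2, h3, h4, h5, h6, Real.log_exp]
  rw [mul_assoc _ (Real.exp _) (Real.exp _), ← Real.exp_add,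
    mul_assoc _ (Real.exp _) (Real.exp _ * Real.exp _), ← Real.exp_add, ← Real.exp_add,
    mul_assoc _ (Real.exp _) (Real.exp _), ← Real.exp_add, mul_assoc _ (Real.exp _) (Real.exp _),
    ← Real.exp_add]
  congr 2; ring

theorem linear_terms_le {K₁ K₀ r m l c : ℝ} (hK₁ : 0 ≤ K₁) (hK₀ : 0 ≤ K₀) (hr : 0 ≤ r)
    (hm : 0 ≤ m) (hl : 0 ≤ l) (hc : 0 ≤ c) :
    m * K₁ + K₀ + (r + 1) * m * (l + c) ≤
      (K₁ + K₀ + (r + 1) * (1 + c)) * (1 + m) * (1 + l) := by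
  have f0 : 0 ≤ m * l := by positivity
  have f1 : m * K₁ ≤ K₁ * ((1 + m) * (1 + l)) := by
    rw [mul_comm]; exact mul_le_mul_of_nonneg_left (by linarith) hK₁
  have f2 : K₀ ≤ K₀ * ((1 + m) * (1 + l)) := le_mul_of_one_le_right hK₀ (by linarith)
  have f4 : l + c ≤ (1 + c) * (1 + l) := by linarith [mul_nonneg hc hl]
  have f3 : (r + 1) * m * (l + c) ≤ (r + 1) * (1 + m) * ((1 + c) * (1 + l)) :=
    mul_le_mul (mul_le_mul_of_nonneg_left (by linarith) (by linarith)) f4 (by positivity)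
      (by positivity)
  linarith

set_option maxHeartbeats 800000 in
/-- Comparison of the upper bound for a model with `m` covariates, `s` of them spurious, with the
lower bound for the true model with `T` covariates. -/
theorem exists_marginalUpper_le (r : ℕ) {α₁ α₂ g G d M : ℝ} (hα₁ : 0 < α₁) (hα₂ : 0 < α₂)
    (hg : 0 < g) (hG : 0 < G) (hd : 0 < d) (hM : 1 ≤ M) (T₀ : ℕ) :
    ∃ K : ℝ, 0 ≤ K ∧ ∀ (n m s T : ℕ) (ε B B' : ℝ), 4 ≤ n → 0 < ε → ε < 1 → s ≤ m → T ≤ T₀ →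
      0 < B → 0 < B' → B' ≤ M * n →
      marginalUpper r n α₁ α₂ g (n * ε / 64) B m (((n * ε / 64)⁻¹ ^ r) ^ s) ≤
        marginalLower r n α₁ α₂ G B' T (√n)⁻¹ (d ^ T) *
        Real.exp (K * (1 + m) * (1 + Real.log ε⁻¹) +
          (r + 1 / 2) * m * (Real.log m - Real.log n) - (r * s + m / 2) * Real.log n +
          ((r + 1 / 2) * T + T / 2) * Real.log n + (n / 2 + α₁) * ((B' - B) / B)) := by
  set K₁ : ℝ := |Real.log g| + (r + 1 / 2) * Real.log (4 * r + 2) +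
    Real.log (2 ^ r * r.factorial) + 1 / 2 * Real.log (2 * Real.pi) with hK₁
  set K₀ : ℝ := 1 / 2 * Real.log 2 + T₀ * |Real.log G| + T₀ * |Real.log d| +
    |Real.log (Real.exp (-(1 / 2)) / (4 * Real.Gamma (1 / 2)))| +
    (r + 1 / 2) * T₀ * (Real.log 2 + Real.log 4 + Real.log M) with hK₀
  set K₂ : ℝ := (r + 1) * (1 + Real.log 64) with hK₂
  have hl2 : 0 ≤ Real.log 2 := Real.log_nonneg (by norm_num)
  have hl4 : 0 ≤ Real.log 4 := Real.log_nonneg (by norm_num)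
  have hl64 : 0 ≤ Real.log 64 := Real.log_nonneg (by norm_num)
  have hlM : 0 ≤ Real.log M := Real.log_nonneg hM
  have hr0 : (0 : ℝ) ≤ r := Nat.cast_nonneg r
  have hlr : 0 ≤ Real.log (4 * r + 2) := Real.log_nonneg (by linarith)
  have hlf : 0 ≤ Real.log (2 ^ r * r.factorial) := by
    refine Real.log_nonneg (one_le_mul_of_one_le_of_one_le (one_le_pow₀ (by norm_num)) ?_)
    exact_mod_cast Nat.one_le_iff_ne_zero.2 (Nat.factorial_ne_zero r)
  have hlpi : 0 ≤ Real.log (2 * Real.pi) := Real.log_nonneg (by linarith [Real.pi_gt_three])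
  have hK₁0 : 0 ≤ K₁ := by positivity
  have hK₀0 : 0 ≤ K₀ := by positivity
  have hK₂0 : 0 ≤ K₂ := by positivity
  refine ⟨K₁ + K₀ + K₂, by positivity, ?_⟩
  intro n m s T ε B B' hn hε0 hε1 hsm hT hB hB' hB'M
  have hpi := Real.pi_pos
  have hn4 : (4 : ℝ) ≤ n := by exact_mod_cast hn
  have hn0 : (0 : ℝ) < n := by linarith
  have hΓ := Real.Gamma_pos_of_pos hα₁
  have hsm' : (s : ℝ) ≤ m := by exact_mod_cast hsm
  have hT' : (T : ℝ) ≤ T₀ := by exact_mod_cast hT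
  have hm0 : (0 : ℝ) ≤ m := Nat.cast_nonneg m
  have hs0 : (0 : ℝ) ≤ s := Nat.cast_nonneg s
  have hT0 : (0 : ℝ) ≤ T := Nat.cast_nonneg T
  have hlε : 0 ≤ Real.log ε⁻¹ := Real.log_nonneg ((one_le_inv₀ hε0).2 hε1.le)
  set ℓ := Real.log n with hℓ
  set ℓε := Real.log ε⁻¹ with hℓε
  set N : ℝ := n / 2 + α₁ with hN
  set a : ℝ := (r + 1 / 2) * T with ha
  have ha0 : 0 ≤ a := by positivity
  have hκ : Real.log (n * ε / 64) = ℓ - ℓε - Real.log 64 := by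
    rw [Real.log_div (by positivity) (by norm_num), Real.log_mul hn0.ne' hε0.ne', hℓε,
      Real.log_inv]
    ring
  have hΓN := Real.Gamma_pos_of_pos (show (0 : ℝ) < N by positivity)
  -- This is where n ≥ 4 is needed. The resulting gain (n/4)^a offsets B'^{-a} ≥ (Mn)^{-a}, leaving
  -- only constants.
  have hN1 : (n : ℝ) / 4 ≤ N - 1 := by rw [hN]; linarith
  have hgam : Real.log (Real.Gamma N) + a * (ℓ - Real.log 4) ≤ Real.log (Real.Gamma (N + a)) := by
    have h1 := Gamma_mul_rpow_le (N := N) (by linarith) ha0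
    have h2 := Real.log_le_log (mul_pos hΓN (Real.rpow_pos_of_pos (by linarith) a)) h1
    rw [Real.log_mul hΓN.ne' (Real.rpow_pos_of_pos (by linarith) a).ne',
      Real.log_rpow (by linarith)] at h2
    have h3 : ℓ - Real.log 4 ≤ Real.log (N - 1) := by
      rw [hℓ, ← Real.log_div hn0.ne' (by norm_num)]
      exact Real.log_le_log (by positivity) hN1
    have h4 := mul_le_mul_of_nonneg_left h3 ha0
    linarith
  have hlB' : Real.log B' ≤ Real.log M + ℓ := by
    rw [hℓ, ← Real.log_mul (by linarith) hn0.ne']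
    exact Real.log_le_log hB' hB'M
  -- Here log x ≤ x - 1 at x = B'/B.
  have hratio : N * (Real.log B' - Real.log B) ≤ N * ((B' - B) / B) := by
    refine mul_le_mul_of_nonneg_left ?_ (by positivity)
    rw [← Real.log_div hB'.ne' hB.ne', sub_div, div_self hB.ne']
    exact Real.log_le_sub_one_of_pos (by positivity)
  rw [marginalUpper_eq_exp r n (by linarith) hα₁ hg (by positivity) hB,
    marginalLower_eq_exp r n (by linarith) hα₁ hG hB' hd, mul_assoc _ (Real.exp _) (Real.exp _),
    ← Real.exp_add, hκ, ← hℓ, ← hN, ← ha]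
  refine mul_le_mul_of_nonneg_left (Real.exp_le_exp.2 ?_) (by positivity)
  clear_value ℓ ℓε a N
  have e1 : -(m * Real.log g) ≤ m * |Real.log g| := by
    rw [← mul_neg]; exact mul_le_mul_of_nonneg_left (neg_le_abs _) hm0
  have e2 : T * Real.log G ≤ T₀ * |Real.log G| :=
    (mul_le_mul_of_nonneg_left (le_abs_self _) hT0).trans
      (mul_le_mul_of_nonneg_right hT' (abs_nonneg _))
  have e3 : -(T * Real.log d) ≤ T₀ * |Real.log d| := by
    rw [← mul_neg]
    exact (mul_le_mul_of_nonneg_left (neg_le_abs _) hT0).trans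
      (mul_le_mul_of_nonneg_right hT' (abs_nonneg _))
  have e4 := neg_le_abs (Real.log (Real.exp (-(1 / 2)) / (4 * Real.Gamma (1 / 2))))
  have e5 : a * (Real.log 2 + Real.log 4 + Real.log M) ≤
      (r + 1 / 2) * T₀ * (Real.log 2 + Real.log 4 + Real.log M) := by
    rw [ha]; gcongr
  have e6 : (r * s + m / 2) * (ℓε + Real.log 64) ≤ (r + 1) * m * (ℓε + Real.log 64) := by
    refine mul_le_mul_of_nonneg_right ?_ (by positivity)
    have := mul_le_mul_of_nonneg_left hsm' hr0
    linarith
  have e7 : m * K₁ + K₀ + (r + 1) * m * (ℓε + Real.log 64) ≤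
      (K₁ + K₀ + K₂) * (1 + m) * (1 + ℓε) := by
    rw [hK₂]; exact linear_terms_le hK₁0 hK₀0 hr0 hm0 hlε hl64
  have e8 := mul_le_mul_of_nonneg_left hlB' ha0
  have e9 : m * K₁ = m * |Real.log g| + m * ((r + 1 / 2) * Real.log (4 * r + 2)) +
      m * Real.log (2 ^ r * r.factorial) + m * (1 / 2 * Real.log (2 * Real.pi)) := by
    rw [hK₁]; ring
  clear_value K₁ K₀ K₂
  linarith

/-! ### The true model dominates when the noise is tame -/

theorem prod_ite_inv_pow {p : ℕ} (k t : Model p) (κ : ℝ) (r : ℕ) :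
    ∏ i : k, (if (i : Fin p) ∈ t then 1 else κ)⁻¹ ^ r = (κ⁻¹ ^ r) ^ (k \ t).card := by
  rw [Finset.prod_coe_sort k fun j => (if j ∈ t then 1 else κ)⁻¹ ^ r,
    ← Finset.prod_inter_mul_prod_sdiff k t]
  have h1 : ∏ j ∈ k ∩ t, (if j ∈ t then 1 else κ)⁻¹ ^ r = 1 :=
    Finset.prod_eq_one fun j hj => by simp [(Finset.mem_inter.1 hj).2]
  rw [h1, one_mul, ← Finset.prod_const]
  refine Finset.prod_congr rfl fun j hj => ?_
  simp [(Finset.mem_sdiff.1 hj).2]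

/-- Lower bound on the penalized residual sum of squares of a model with `s` spurious covariates;
`E` is the squared norm of the noise, `S` and `S'` the squared norms of all and of the omitted
coefficients. -/
def rssLower (n : ℕ) (ε v E S S' : ℝ) (s : ℕ) : ℝ :=
  E - 64 / 61 * (v / 64 * Real.log n + 2 * v * (67 / 64 * (s * Real.log n))) - 2 * S +
    n * ε / 64 * S'

/-- Upper bound on the penalized residual sum of squares of the true model near the truth. -/
def rssUpper (n : ℕ) (ε v a E S : ℝ) (T : ℕ) : ℝ :=
  E + v / 64 * Real.log n + 2 * T * ε⁻¹ + a * (2 * S + 2 * T)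

section Comparison

variable {n p : ℕ} {r : ℕ} {α₁ α₂ : ℝ} {X : Matrix (Fin n) (Fin p) ℝ}
  {A : Matrix (Fin p) (Fin p) ℝ} {a₁ a₂ a ε v : ℝ} {t : Model p} {β₀ : ℕ → ℝ} {e : Fin n → ℝ}

theorem marginal_le_of_tameNoise (hα₁ : 0 < α₁) (hα₂ : 0 < α₂) (hn : 1 ≤ n)
    (hA : ScaleMatrixBound A a₁ a₂) (ha₁ : 0 < a₁) (ha : 0 < a) (ha₂ : a₂ ≤ a)
    (hX : EigenBound X ε) (hnε : 128 ≤ n * ε) (hβ : ∀ j : Fin p, j ∉ t → β₀ j = 0)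
    (he : TameNoise X t v e) {k : Model p} (hk : (k ∪ t).card ≤ n)
    (hB : 0 < α₂ + rssLower n ε v (∑ i, e i ^ 2) (∑ j : Fin p, β₀ j ^ 2) (∑ j ∈ kᶜ, β₀ j ^ 2)
      (k \ t).card / 2) :
    marginal r α₁ α₂ X A k (response X β₀ e) ≤ ENNReal.ofReal
      (marginalUpper r n α₁ α₂ (gaussMoment r a) (n * ε / 64)
        (α₂ + rssLower n ε v (∑ i, e i ^ 2) (∑ j : Fin p, β₀ j ^ 2) (∑ j ∈ kᶜ, β₀ j ^ 2)
          (k \ t).card / 2) k.card (((n * ε / 64)⁻¹ ^ r) ^ (k \ t).card)) := by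
  rw [← prod_ite_inv_pow k t]
  refine marginal_le r hα₁ hα₂ hn hA ha₁ ha ha₂ (c := fun i => β₀ (i : Fin p)) (fun i => ?_)
    (by linarith) hB fun b => ?_
  · split_ifs
    · exact one_pos
    · linarith
  · exact le_residual_sum_sq hX hn hnε hk hβ e (add_le_add he.proj (he.resid _)) b

theorem le_marginal_of_tameNoise (hα₁ : 0 < α₁) (hα₂ : 0 < α₂) (hn : 1 ≤ n)
    (hA : ScaleMatrixBound A a₁ a₂) (ha₁ : 0 < a₁) (ha : 0 < a) (ha₂ : a₂ ≤ a)
    (hX : EigenBound X ε) (hε : 0 < ε) (hβ : ∀ j : Fin p, j ∉ t → β₀ j = 0)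
    {b₀ : ℝ} (hb₀ : 0 < b₀) (hβt : ∀ j ∈ t, b₀ ≤ |β₀ (j : Fin p)|) (hw : (√n)⁻¹ ≤ b₀ / 2)
    (he : TameNoise X t v e)
    (hB : 0 < α₂ + rssUpper n ε v a (∑ i, e i ^ 2) (∑ j : Fin p, β₀ j ^ 2) t.card / 2) :
    ENNReal.ofReal (marginalLower r n α₁ α₂ (gaussMoment r a₁)
        (α₂ + rssUpper n ε v a (∑ i, e i ^ 2) (∑ j : Fin p, β₀ j ^ 2) t.card / 2) t.card
        (√n)⁻¹ (((b₀ / 2) ^ (2 * r)) ^ t.card)) ≤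
      marginal r α₁ α₂ X A t (response X β₀ e) := by
  refine le_marginal r hα₁ hα₂ hn hA ha₁ ha ha₂ (c := fun i => β₀ (i : Fin p)) (by positivity)
    (by positivity) hB fun b hb => ⟨?_, le_prod_pow_of_mem_Icc r hb₀.le hβt hw hb⟩
  refine residual_sum_sq_le hX hn hε hβ e ha.le ?_ hb
  have := he.resid ∅
  simp only [Finset.card_empty, Nat.cast_zero, zero_mul, mul_zero] at this
  linarith [he.proj]

end Comparison

/-! ### Arithmetic of the exponents -/

theorem mul_div_le_of_superset {N B B' n v L s : ℝ} (hn : 0 < n) (hv : 0 < v) (hL : 0 ≤ L)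
    (hs : 0 ≤ s) (hdiff : B' - B ≤ 9 / 8 * (v * L * s)) (hB : 63 / 128 * (n * v) ≤ B)
    (hN0 : 0 ≤ N) (hN : N ≤ 65 / 128 * n) : N * ((B' - B) / B) ≤ 5 / 4 * (L * s) := by
  have hB0 : 0 < B := lt_of_lt_of_le (by positivity) hB
  have hLs : 0 ≤ L * s := by positivity
  rw [← mul_div_assoc, div_le_iff₀ hB0]
  calc N * (B' - B) ≤ N * (9 / 8 * (v * L * s)) := mul_le_mul_of_nonneg_left hdiff hN0
    _ ≤ 65 / 128 * n * (9 / 8 * (v * L * s)) := mul_le_mul_of_nonneg_right hN (by positivity)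
    _ ≤ 5 / 4 * (L * s) * (63 / 128 * (n * v)) := by
        have : 0 ≤ L * s * (n * v) := by positivity
        linarith
    _ ≤ _ := mul_le_mul_of_nonneg_left hB (by positivity)

theorem mul_div_le_of_not_superset {N B B' n M x : ℝ} (hn : 0 < n) (hM : 0 < M) (hx : 0 ≤ x)
    (hB0 : 0 < B) (hdiff : B' - B ≤ -x) (hB : B ≤ M * n) (hN : n / 2 ≤ N) :
    N * ((B' - B) / B) ≤ -(x / (2 * M)) := by
  rw [← mul_div_assoc, div_le_iff₀ hB0]
  have h1 : N * (B' - B) ≤ N * (-x) := mul_le_mul_of_nonneg_left hdiff (by linarith)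
  have h2 : x / (2 * M) * B ≤ x / (2 * M) * (M * n) := mul_le_mul_of_nonneg_left hB (by positivity)
  have h3 : x / (2 * M) * (M * n) = n / 2 * x := by field_simp
  have h4 := mul_le_mul_of_nonneg_right hN hx
  linarith

/-- The powers of n sum to at most (r + 1/2)sL - (2r + 1)sL = -(r + 1/2)sL, the noise gives back
(5/4)sL, and r ≥ 1 leaves -sL/4. Half of this pays for all terms of order (1 + m)(1 + log ε⁻¹). -/
theorem exponent_le_of_superset {K r m s T T₀ L l lm D : ℝ} (hK : 0 ≤ K) (hr : 1 ≤ r)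
    (hs : 1 ≤ s) (hT : 0 ≤ T) (hTT : T ≤ T₀) (hm : m = T + s) (hl : 0 ≤ l) (hL : 0 ≤ L)
    (hlm : lm ≤ L) (hlmm : lm ≤ m)
    (hD : D ≤ 5 / 4 * (L * s)) (hC : 8 * ((2 + T₀) * (K + (r + 1) * T₀)) * (1 + l) ≤ L) :
    K * (1 + m) * (1 + l) + (r + 1 / 2) * m * (lm - L) - (r * s + m / 2) * L +
      ((r + 1 / 2) * T + T / 2) * L + D ≤ -(L / 8) := by
  have hm0 : 0 ≤ m := by linarith
  have hT₀ : 0 ≤ T₀ := hT.trans hTT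
  -- On the true part log m is bounded by m, not by L: a term T·L would be too large when s = 1,
  -- while T₀m is absorbed by the error terms.
  have h1 : m * lm ≤ s * L + T₀ * m := by
    have h2 : s * lm ≤ s * L := mul_le_mul_of_nonneg_left hlm (by linarith)
    have h3 : T * lm ≤ T * m := mul_le_mul_of_nonneg_left hlmm hT
    have h4 : T * m ≤ T₀ * m := mul_le_mul_of_nonneg_right hTT hm0
    calc m * lm = s * lm + T * lm := by rw [hm]; ring
      _ ≤ _ := by linarith
  have h1' := mul_le_mul_of_nonneg_left h1 (show 0 ≤ r + 1 / 2 by linarith)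
  have h5 : 1 + m ≤ (2 + T₀) * s := by
    have := mul_le_mul_of_nonneg_left hs hT₀
    rw [hm]; linarith
  have h6 : K * (1 + m) * (1 + l) + (r + 1 / 2) * (T₀ * m) ≤
      (2 + T₀) * s * ((K + (r + 1) * T₀) * (1 + l)) := by
    have h7 : (r + 1 / 2) * (T₀ * m) ≤ (1 + m) * ((r + 1) * T₀ * (1 + l)) := by
      have i1 : (r + 1 / 2) * (T₀ * m) ≤ (r + 1) * (T₀ * (1 + m)) := by gcongr <;> linarith
      have i2 : 0 ≤ (1 + m) * ((r + 1) * T₀) * l := by positivity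
      linarith
    calc _ ≤ (1 + m) * ((K + (r + 1) * T₀) * (1 + l)) := by linarith
      _ ≤ _ := mul_le_mul_of_nonneg_right h5 (by positivity)
  have h8 : (2 + T₀) * s * ((K + (r + 1) * T₀) * (1 + l)) ≤ s * (L / 8) := by
    have := mul_le_mul_of_nonneg_left hC (show 0 ≤ s by linarith)
    linarith
  have h9 : 1 * (s * L) ≤ r * (s * L) := mul_le_mul_of_nonneg_right hr (by positivity)
  have h10 : 1 * L ≤ s * L := mul_le_mul_of_nonneg_right hs hL
  have h11 : (r + 1 / 2) * m * (lm - L) - (r * s + m / 2) * L + ((r + 1 / 2) * T + T / 2) * L =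
      (r + 1 / 2) * (m * lm) - (2 * r + 1) * (s * L) := by rw [hm]; ring
  linarith

/-- The gain x from the missing signal exceeds every term in favour of k, all of order (1 + q)L, so
crude bounds suffice. -/
theorem exponent_le_of_not_superset {K r m s T T₀ L l lm D q x : ℝ} (hK : 0 ≤ K) (hr : 0 ≤ r)
    (hs : 0 ≤ s) (hTT : T ≤ T₀) (hT : 0 ≤ T) (hm : 0 ≤ m) (hmq : m ≤ q)
    (hL : 0 ≤ L) (hlm : lm ≤ L) (hl : 1 + l ≤ L) (hD : D ≤ -x)
    (hx : (K + (r + 1) * T₀ + 1) * (1 + q) * L ≤ x) :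
    K * (1 + m) * (1 + l) + (r + 1 / 2) * m * (lm - L) - (r * s + m / 2) * L +
      ((r + 1 / 2) * T + T / 2) * L + D ≤ -(L / 8) := by
  have hT₀ : 0 ≤ T₀ := hT.trans hTT
  have h1 : K * (1 + m) * (1 + l) ≤ K * (1 + q) * L := by
    calc _ ≤ K * (1 + m) * L := mul_le_mul_of_nonneg_left hl (by positivity)
      _ ≤ _ := by gcongr
  have h2 : (r + 1 / 2) * m * (lm - L) ≤ 0 :=
    mul_nonpos_of_nonneg_of_nonpos (by positivity) (by linarith)
  have h3 : 0 ≤ (r * s + m / 2) * L := by positivity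
  have h4 : ((r + 1 / 2) * T + T / 2) * L ≤ (r + 1) * T₀ * L := by
    refine mul_le_mul_of_nonneg_right ?_ hL
    have := mul_le_mul_of_nonneg_left hTT (show 0 ≤ r + 1 by linarith)
    linarith
  have h5 : 0 ≤ ((r + 1) * T₀ + 1) * q * L :=
    mul_nonneg (mul_nonneg (by positivity) (hm.trans hmq)) hL
  linarith

/-- Requirements on a constant `C` that governs how large `n` has to be. -/
structure LargeConst (r T₀ : ℕ) (α₁ a v b₀ S₀ K M C : ℝ) : Prop where
  c640 : 640 ≤ C
  card : (T₀ : ℝ) + 1 ≤ C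
  shape : 128 * α₁ ≤ C
  drift : 64 * (2 * T₀ + a * (2 * S₀ + 2 * T₀) + 2 * S₀) ≤ C * v
  signal : 4 ≤ C * b₀ ^ 2
  noise : 384 * v ≤ C * b₀ ^ 2
  superset : 8 * ((2 + T₀) * (K + (r + 1) * T₀)) ≤ C
  -- The factor 512M comes from x/(2M) with x = nεb₀²/256, the gap left by an omitted covariate
  -- after the noise is paid.
  omitted : (K + (r + 1) * T₀ + 1) * (512 * M) ≤ C * b₀ ^ 2

theorem exists_largeConst (r T₀ : ℕ) (α₁ a S₀ K M : ℝ) {v b₀ : ℝ} (hv : 0 < v) (hb₀ : 0 < b₀) :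
    ∃ C, LargeConst r T₀ α₁ a v b₀ S₀ K M C := by
  have hC : ∀ᶠ C : ℝ in atTop, LargeConst r T₀ α₁ a v b₀ S₀ K M C := by
    have hlin : Tendsto (fun C : ℝ => C * b₀ ^ 2) atTop atTop :=
      tendsto_id.atTop_mul_const (by positivity)
    have hlinv : Tendsto (fun C : ℝ => C * v) atTop atTop := tendsto_id.atTop_mul_const hv
    filter_upwards [eventually_ge_atTop 640, eventually_ge_atTop ((T₀ : ℝ) + 1),
      eventually_ge_atTop (128 * α₁), hlinv.eventually_ge_atTop _, hlin.eventually_ge_atTop _,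
      hlin.eventually_ge_atTop _, eventually_ge_atTop _, hlin.eventually_ge_atTop _]
      with C h1 h2 h3 h4 h5 h6 h7 h8
    exact ⟨h1, h2, h3, h4, h5, h6, h7, h8⟩
  exact hC.exists

/-- Deterministic core: n, the design and one tame noise vector are fixed, and all asymptotics are
in the inequalities involving C. Finiteness and positivity are recorded because the posterior
divides in [0, ∞]. -/
theorem marginal_trueModel_dominates {n p r T₀ : ℕ} {α₁ α₂ : ℝ} (hr : 1 ≤ r) (hα₁ : 0 < α₁)
    (hα₂ : 0 < α₂) {X : Matrix (Fin n) (Fin p) ℝ} {A : Matrix (Fin p) (Fin p) ℝ}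
    {a₁ a₂ a ε v b₀ S₀ K M C q : ℝ} (hA : ScaleMatrixBound A a₁ a₂) (ha₁ : 0 < a₁) (ha : 0 < a)
    (ha₂ : a₂ ≤ a) (hX : EigenBound X ε) (hε0 : 0 < ε) (hε1 : ε < 1) {t : Model p}
    (hT : t.card ≤ T₀) {β₀ : ℕ → ℝ} (hβ : ∀ j : Fin p, j ∉ t → β₀ j = 0) (hb₀ : 0 < b₀)
    (hβt : ∀ j ∈ t, b₀ ≤ |β₀ (j : Fin p)|) (hS : ∑ j : Fin p, β₀ j ^ 2 ≤ S₀) (hv : 0 < v)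
    (hK0 : 0 ≤ K) (hM : M = 1 + α₂ + 2 * v + S₀)
    (hK : ∀ (n m s T : ℕ) (ε B B' : ℝ), 4 ≤ n → 0 < ε → ε < 1 → s ≤ m → T ≤ T₀ →
      0 < B → 0 < B' → B' ≤ M * n →
      marginalUpper r n α₁ α₂ (gaussMoment r a) (n * ε / 64) B m (((n * ε / 64)⁻¹ ^ r) ^ s) ≤
        marginalLower r n α₁ α₂ (gaussMoment r a₁) B' T (√n)⁻¹ (((b₀ / 2) ^ (2 * r)) ^ T) *
        Real.exp (K * (1 + m) * (1 + Real.log ε⁻¹) +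
          (r + 1 / 2) * m * (Real.log m - Real.log n) - (r * s + m / 2) * Real.log n +
          ((r + 1 / 2) * T + T / 2) * Real.log n + (n / 2 + α₁) * ((B' - B) / B)))
    (hC : LargeConst r T₀ α₁ a v b₀ S₀ K M C) (hq : 0 ≤ q)
    (hnq : C * ((1 + q) * Real.log n) ≤ n * ε) (hlogε : C * (1 + Real.log ε⁻¹) ≤ Real.log n)
    (hεlog : C * (1 + ε⁻¹) ≤ Real.log n) {e : Fin n → ℝ} (he : TameNoise X t v e) :
    0 < marginal r α₁ α₂ X A t (response X β₀ e) ∧ ∀ k : Model p, (k.card : ℝ) ≤ q →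
      marginal r α₁ α₂ X A k (response X β₀ e) ≠ ∞ ∧
      (k ≠ t → marginal r α₁ α₂ X A k (response X β₀ e) ≤
        ENNReal.ofReal (Real.exp (-(Real.log n / 8))) *
          marginal r α₁ α₂ X A t (response X β₀ e)) := by
  set L := Real.log n with hL
  set E := ∑ i, e i ^ 2 with hE
  set S := ∑ j : Fin p, β₀ j ^ 2 with hSdef
  have hC0 : 0 < C := by linarith [hC.c640]
  have hεi : 1 ≤ ε⁻¹ := (one_le_inv₀ hε0).2 hε1.le
  have hlε0 : 0 ≤ Real.log ε⁻¹ := Real.log_nonneg hεi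
  have hLC : C ≤ L := by
    have : C * 1 ≤ C * (1 + ε⁻¹) := mul_le_mul_of_nonneg_left (by linarith) hC0.le
    linarith
  have hL1 : 1 ≤ L := by linarith [hC.c640]
  -- As log 0 = 0, the bound 1 ≤ L excludes n = 0.
  have hLn : L ≤ n := (Real.log_le_sub_one_of_pos (by
    by_contra h
    have h0 : (n : ℝ) = 0 := le_antisymm (not_lt.1 h) (Nat.cast_nonneg n)
    rw [hL, h0, Real.log_zero] at hL1
    linarith)).trans (by linarith)
  have hCn : C ≤ n := hLC.trans hLn
  have hn0 : (0 : ℝ) < n := by linarith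
  have hn1 : 1 ≤ n := by
    have : (1 : ℝ) ≤ n := by linarith
    exact_mod_cast this
  have hn4 : 4 ≤ n := by
    have : (4 : ℝ) ≤ n := by linarith [hC.c640]
    exact_mod_cast this
  have hqL : 0 ≤ q * L := by positivity
  have hnε_le : n * ε ≤ n := mul_le_of_le_one_right hn0.le hε1.le
  have hnε : 128 ≤ n * ε := by
    have : C * 1 ≤ C * ((1 + q) * L) := mul_le_mul_of_nonneg_left (by linarith) hC0.le
    linarith [hC.c640]
  have hT' : (t.card : ℝ) ≤ T₀ := by exact_mod_cast hT
  have hT0 : (0 : ℝ) ≤ t.card := Nat.cast_nonneg _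
  have hS0 : 0 ≤ S := Finset.sum_nonneg fun _ _ => sq_nonneg _
  have hS₀0 : 0 ≤ S₀ := hS0.trans hS
  have hdrift : 2 * t.card * ε⁻¹ + a * (2 * S + 2 * t.card) + 2 * S ≤ v / 64 * L := by
    have h1 : 2 * t.card * ε⁻¹ ≤ 2 * T₀ * (1 + ε⁻¹) := by
      gcongr; linarith
    have h2 : a * (2 * S + 2 * t.card) ≤ a * (2 * S₀ + 2 * T₀) :=
      mul_le_mul_of_nonneg_left (by linarith) ha.le
    have h3 : a * (2 * S₀ + 2 * T₀) + 2 * S₀ ≤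
        (a * (2 * S₀ + 2 * T₀) + 2 * S₀) * (1 + ε⁻¹) :=
      le_mul_of_one_le_right (by positivity) (by linarith)
    have h4 := mul_le_mul_of_nonneg_right hC.drift (show 0 ≤ 1 + ε⁻¹ by linarith)
    have h5 := mul_le_mul_of_nonneg_left hεlog hv.le
    linarith
  have hvL : 0 ≤ v * L := by positivity
  have hvqL : 0 ≤ v * (q * L) := by positivity
  have haS : 0 ≤ a * (2 * S + 2 * t.card) := by positivity
  have hTε : 0 ≤ 2 * t.card * ε⁻¹ := by positivity
  have hlow := he.lower
  have hup := he.upper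
  rw [← hE] at hlow hup
  have hE0 : 0 ≤ E := Finset.sum_nonneg fun _ _ => sq_nonneg _
  have hw : (√n)⁻¹ ≤ b₀ / 2 := by
    rw [inv_le_comm₀ (by positivity) (by positivity)]
    refine Real.le_sqrt_of_sq_le ?_
    rw [inv_div, div_pow, div_le_iff₀ (by positivity)]
    have := mul_le_mul_of_nonneg_right hCn (sq_nonneg b₀)
    linarith [hC.signal]
  set B' : ℝ := α₂ + rssUpper n ε v a E S t.card / 2 with hB'
  have hB'0 : 0 < B' := by rw [hB', rssUpper]; positivity
  have hB'M : B' ≤ M * n := by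
    rw [hB', rssUpper, hM]
    have h1 : α₂ * 1 ≤ α₂ * n := mul_le_mul_of_nonneg_left (by linarith [hC.c640]) hα₂.le
    have h2 : v * L ≤ v * n := mul_le_mul_of_nonneg_left hLn hv.le
    have h3 : 0 ≤ S₀ * n := by positivity
    linarith
  have hlower := le_marginal_of_tameNoise (r := r) (A := A) hα₁ hα₂ hn1 hA ha₁ ha ha₂ hX hε0 hβ
    hb₀ hβt hw he hB'0
  rw [← hE, ← hSdef, ← hB'] at hlower
  have hlowpos : 0 < marginalLower r n α₁ α₂ (gaussMoment r a₁) B' t.card (√n)⁻¹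
      (((b₀ / 2) ^ (2 * r)) ^ t.card) := by
    have hΓ := Real.Gamma_pos_of_pos hα₁
    have := Real.pi_pos
    rw [marginalLower_eq_exp r n hn1 hα₁ (gaussMoment_pos r ha₁) hB'0 (by positivity)]
    positivity
  refine ⟨(ENNReal.ofReal_pos.2 hlowpos).trans_le hlower, fun k hkq => ?_⟩
  set s := (k \ t).card with hs
  have hsm : s ≤ k.card := Finset.card_le_card Finset.sdiff_subset
  have hsq : (s : ℝ) ≤ q := (by exact_mod_cast hsm : (s : ℝ) ≤ k.card).trans hkq
  have hs0 : (0 : ℝ) ≤ s := Nat.cast_nonneg s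
  have hk0 : (0 : ℝ) ≤ k.card := Nat.cast_nonneg _
  set S' := ∑ j ∈ kᶜ, β₀ j ^ 2 with hS'
  have hS'0 : 0 ≤ S' := Finset.sum_nonneg fun _ _ => sq_nonneg _
  have hS'S : S' ≤ S := Finset.sum_le_sum_of_subset_of_nonneg (Finset.subset_univ _)
    fun _ _ _ => sq_nonneg _
  have hkt : (k ∪ t).card ≤ n := by
    have h1 : ((k ∪ t).card : ℝ) ≤ k.card + t.card := by exact_mod_cast Finset.card_union_le k t
    have h2 : (1 + q) * 1 ≤ (1 + q) * L := mul_le_mul_of_nonneg_left hL1 (by linarith)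
    have h3 := mul_le_mul_of_nonneg_left h2 hC0.le
    have h4 : ((T₀ : ℝ) + 1) * ((1 + q) * 1) ≤ C * ((1 + q) * 1) :=
      mul_le_mul_of_nonneg_right hC.card (by linarith)
    have h5 : 0 ≤ (T₀ : ℝ) * q := by positivity
    have h6 : ((k ∪ t).card : ℝ) ≤ n := by linarith
    exact_mod_cast h6
  have hsL : v * (s * L) ≤ v * (q * L) := by gcongr
  have hvsL : 0 ≤ v * (s * L) := by positivity
  have hnεS : 0 ≤ n * ε * S' := by positivity
  -- Half the noise norm gives 127/256 of nv. The remaining 1/256 pays for the projections, because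
  -- n ≥ 640(1 + q)L.
  set B : ℝ := α₂ + rssLower n ε v E S S' s / 2 with hB
  have hBlow : 63 / 128 * (n * v) ≤ B := by
    rw [hB, rssLower]
    have h1 : 640 * ((1 + q) * L) ≤ n := by
      have := mul_le_mul_of_nonneg_right hC.c640 (show 0 ≤ (1 + q) * L by positivity)
      linarith
    have h2 := mul_le_mul_of_nonneg_left h1 hv.le
    linarith
  have hB0 : 0 < B := lt_of_lt_of_le (by positivity) hBlow
  have hupper := marginal_le_of_tameNoise (r := r) (A := A) hα₁ hα₂ hn1 hA ha₁ ha ha₂ hX hnε hβ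
    he hkt hB0
  rw [← hE, ← hSdef, ← hS', ← hs, ← hB] at hupper
  refine ⟨(hupper.trans_lt ENNReal.ofReal_lt_top).ne, fun hne => ?_⟩
  have hcomp := hK n k.card s t.card ε B B' hn4 hε0 hε1 hsm hT hB0 hB'0 hB'M
  refine hupper.trans ((ENNReal.ofReal_le_ofReal ?_).trans ((ENNReal.ofReal_mul
    (Real.exp_pos _).le).le.trans (mul_le_mul_right hlower _)))
  refine hcomp.trans ?_
  rw [mul_comm]
  refine mul_le_mul_of_nonneg_right (Real.exp_le_exp.2 ?_) hlowpos.le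
  have hN : (n : ℝ) / 2 + α₁ ≤ 65 / 128 * n := by linarith [hC.shape]
  have hlm : Real.log k.card ≤ L := by
    rcases Nat.eq_zero_or_pos k.card with h0 | h0
    · rw [h0]; simp only [Nat.cast_zero, Real.log_zero]; linarith
    · refine Real.log_le_log (by exact_mod_cast h0) ?_
      exact_mod_cast (Finset.card_le_card Finset.subset_union_left).trans hkt
  have hlmm : Real.log k.card ≤ k.card := Real.log_le_self hk0
  -- Without s there are vL/64 from the truth, vL/64 from the drift and vL/61 from the projection
  -- onto the columns of t; 61/1280 exceeds the sum of these constants. Also 134/61 =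
  -- (64/61)·2·(67/64).
  have hdiff : B' - B ≤ 1 / 2 * (v * L * (61 / 1280) + 134 / 61 * (v * (s * L)) -
      n * ε / 64 * S') := by
    rw [hB, hB', rssLower, rssUpper]
    linarith
  by_cases hsub : t ⊆ k
  · have hcard : s + t.card = k.card := Finset.card_sdiff_add_card_eq_card hsub
    have hs1 : 1 ≤ s := by
      rw [hs, Nat.one_le_iff_ne_zero, Finset.card_ne_zero, Finset.sdiff_nonempty]
      exact fun h => hne (h.antisymm hsub)
    have hs1' : (1 : ℝ) ≤ s := by exact_mod_cast hs1
    have hvLs : v * L * 1 ≤ v * L * s := mul_le_mul_of_nonneg_left hs1' hvL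
    have hD := mul_div_le_of_superset (N := n / 2 + α₁) (B := B) (B' := B') (s := s) hn0 hv
      (by linarith : 0 ≤ L) hs0 (by linarith) hBlow (by positivity) hN
    refine exponent_le_of_superset hK0 (by exact_mod_cast hr) hs1' hT0 hT' ?_ hlε0
      (by linarith) hlm hlmm hD ?_
    · rw [← hcard]; push_cast; ring
    · exact (mul_le_mul_of_nonneg_right hC.superset (by linarith)).trans hlogε
  · obtain ⟨j, hjt, hjk⟩ := Finset.not_subset.1 hsub
    have hS'b : b₀ ^ 2 ≤ S' := by
      calc b₀ ^ 2 ≤ |β₀ j| ^ 2 := pow_le_pow_left₀ hb₀.le (hβt j hjt) 2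
        _ = β₀ j ^ 2 := sq_abs _
        _ ≤ S' := Finset.single_le_sum (f := fun j : Fin p => β₀ j ^ 2)
            (fun _ _ => sq_nonneg _) (by simpa using hjk)
    have hM0 : 0 < M := by rw [hM]; positivity
    have hnεb : n * ε * b₀ ^ 2 ≤ n * ε * S' := mul_le_mul_of_nonneg_left hS'b (by positivity)
    have hbnq := mul_le_mul_of_nonneg_right hnq (sq_nonneg b₀)
    have hdiff' : B' - B ≤ -(n * ε * b₀ ^ 2 / 256) := by
      have h1 := mul_le_mul_of_nonneg_right hC.noise (show 0 ≤ (1 + q) * L by positivity)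
      linarith
    have hBM : B ≤ M * n := by
      have h1 : α₂ * 1 ≤ α₂ * n := mul_le_mul_of_nonneg_left (by linarith [hC.c640]) hα₂.le
      have h2 : n * ε * S' ≤ n * S₀ := mul_le_mul hnε_le (hS'S.trans hS) hS'0 hn0.le
      have h3 : 0 ≤ n * v := by positivity
      have h4 : 0 ≤ n * S₀ := by positivity
      rw [hB, rssLower, hM]
      linarith
    have hD := mul_div_le_of_not_superset (N := n / 2 + α₁) hn0 hM0 (by positivity) hB0 hdiff'
      hBM (by linarith)
    refine exponent_le_of_not_superset (T₀ := T₀) (q := q) hK0 (Nat.cast_nonneg r) hs0 hT' hT0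
      hk0 hkq (by linarith) hlm ?_ hD ?_
    · have h1 : 1 * (1 + Real.log ε⁻¹) ≤ C * (1 + Real.log ε⁻¹) :=
        mul_le_mul_of_nonneg_right (by linarith [hC.c640]) (by linarith)
      linarith
    · rw [le_div_iff₀ (by positivity), le_div_iff₀ (by norm_num)]
      have h1 := mul_le_mul_of_nonneg_right hC.omitted (show 0 ≤ (1 + q) * L by positivity)
      linarith

/-! ### Posterior consistency -/

theorem sum_fin_sq_le {t : Finset ℕ} {β₀ : ℕ → ℝ} (hβ₀ : ∀ j, β₀ j ≠ 0 ↔ j ∈ t) (p : ℕ) :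
    ∑ j : Fin p, β₀ j ^ 2 ≤ ∑ j ∈ t, β₀ j ^ 2 := by
  rw [Fin.sum_univ_eq_sum_range (fun j => β₀ j ^ 2) p]
  calc ∑ j ∈ Finset.range p, β₀ j ^ 2 = ∑ j ∈ Finset.range p ∩ t, β₀ j ^ 2 := by
        refine (Finset.sum_subset Finset.inter_subset_left fun j hj hjt => ?_).symm
        have : j ∉ t := fun h => hjt (Finset.mem_inter.2 ⟨hj, h⟩)
        rw [← hβ₀, not_not] at this
        simp [this]
    _ ≤ _ := Finset.sum_le_sum_of_subset_of_nonneg Finset.inter_subset_right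
        fun _ _ _ => sq_nonneg _

theorem exists_pos_le_abs {t : Finset ℕ} {β₀ : ℕ → ℝ} (hβ₀ : ∀ j, β₀ j ≠ 0 ↔ j ∈ t) :
    ∃ b₀ : ℝ, 0 < b₀ ∧ ∀ j ∈ t, b₀ ≤ |β₀ j| := by
  rcases t.eq_empty_or_nonempty with rfl | ht
  · exact ⟨1, one_pos, by simp⟩
  · obtain ⟨i, hi, hmin⟩ := t.exists_min_image (fun j => |β₀ j|) ht
    exact ⟨|β₀ i|, abs_pos.2 ((hβ₀ i).2 hi), hmin⟩

theorem eventually_mul_log_le {ε q : ℕ → ℝ} {ξ : ℝ} (hξ : ξ < 1)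
    (hq : q =O[atTop] fun n : ℕ => (n : ℝ) ^ ξ) (hε : ∀ᶠ n in atTop, 0 < ε n ∧ ε n < 1)
    (hεo : (fun n => (ε n)⁻¹) =o[atTop] fun n : ℕ => Real.log n) {C : ℝ} (hC : 0 < C) :
    ∀ᶠ n : ℕ in atTop, C * ((1 + |q n|) * Real.log n) ≤ n * ε n := by
  -- The exponent ξ may be negative, while the constant 1 must also be O(n^ζ).
  set ζ := max ξ 0 with hζ
  have hζ1 : ζ < 1 := max_lt hξ one_pos
  have h1 : (fun n : ℕ => 1 + |q n|) =O[atTop] fun n : ℕ => (n : ℝ) ^ ζ := by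
    refine IsBigO.add ?_ ?_
    · refine IsBigO.of_bound 1 ?_
      filter_upwards [eventually_ge_atTop 1] with n hn
      have hn' : (1 : ℝ) ≤ n := by exact_mod_cast hn
      have := Real.one_le_rpow hn' (le_max_right ξ 0)
      rw [norm_one, Real.norm_of_nonneg (by positivity)]
      linarith
    · refine IsBigO.abs_left (hq.trans (IsBigO.of_bound 1 ?_))
      filter_upwards [eventually_ge_atTop 1] with n hn
      have hn' : (1 : ℝ) ≤ n := by exact_mod_cast hn
      rw [Real.norm_of_nonneg (by positivity), Real.norm_of_nonneg (by positivity), one_mul]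
      exact Real.rpow_le_rpow_of_exponent_le hn' (le_max_left ξ 0)
  -- One logarithm is in the claim; the other pays for ε, through 1 ≤ ε log n.
  have h2 : (fun n : ℕ => Real.log n ^ (2 : ℝ)) =o[atTop] fun n : ℕ => (n : ℝ) ^ (1 - ζ) :=
    (isLittleO_log_rpow_rpow_atTop 2 (sub_pos.2 hζ1)).comp_tendsto tendsto_natCast_atTop_atTop
  have h3 := h1.mul_isLittleO h2
  filter_upwards [h3.bound (inv_pos.2 hC), hε, eventually_le_mul_log hεo one_pos,
    eventually_ge_atTop 1] with n h4 hε hlog hn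
  have hn0 : (0 : ℝ) < n := by exact_mod_cast hn
  have hL0 : 0 < Real.log n := by
    have := inv_pos.2 hε.1
    linarith
  rw [← Real.rpow_add hn0, add_sub_cancel, Real.rpow_one, Real.rpow_two,
    Real.norm_of_nonneg (by positivity), Real.norm_of_nonneg hn0.le,
    le_inv_mul_iff₀ hC] at h4
  have h5 : 1 ≤ Real.log n * ε n := by
    rw [one_mul, inv_le_iff_one_le_mul₀ hε.1] at hlog
    exact hlog
  calc C * ((1 + |q n|) * Real.log n)
      ≤ C * ((1 + |q n|) * Real.log n) * (Real.log n * ε n) :=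
        le_mul_of_one_le_right (by positivity) h5
    _ = C * ((1 + |q n|) * Real.log n ^ 2) * ε n := by ring
    _ ≤ _ := mul_le_mul_of_nonneg_right h4 hε.1.le

theorem eventually_marginal_trueModel_dominates (r : ℕ) (hr : 1 ≤ r) (α₁ α₂ : ℝ) (hα₁ : 0 < α₁)
    (hα₂ : 0 < α₂) (p : ℕ → ℕ) (X : ∀ n, Matrix (Fin n) (Fin (p n)) ℝ)
    (A : ∀ n, Matrix (Fin (p n)) (Fin (p n)) ℝ) (t : Finset ℕ) (β₀ : ℕ → ℝ)
    (hβ₀ : ∀ j, β₀ j ≠ 0 ↔ j ∈ t) {v : ℝ} (hv : 0 < v)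
    (ε : ℕ → ℝ) (hε : ∀ᶠ n in atTop, 0 < ε n ∧ ε n < 1)
    (hεo : (fun n => (ε n)⁻¹) =o[atTop] fun n : ℕ => Real.log n)
    (hX : ∀ᶠ n in atTop, EigenBound (X n) (ε n))
    (q : ℕ → ℝ) (ξ : ℝ) (hξ : ξ < 1) (hq : q =O[atTop] fun n : ℕ => (n : ℝ) ^ ξ)
    (a₁ a₂ : ℝ) (ha₁ : 0 < a₁) (hA : ∀ᶠ n in atTop, ScaleMatrixBound (A n) a₁ a₂) :
    ∀ᶠ n in atTop, ∀ e : Fin n → ℝ, TameNoise (X n) (trueModel t (p n)) v e →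
      0 < marginal r α₁ α₂ (X n) (A n) (trueModel t (p n)) (response (X n) β₀ e) ∧
      ∀ k : Model (p n), (k.card : ℝ) ≤ q n →
        marginal r α₁ α₂ (X n) (A n) k (response (X n) β₀ e) ≠ ∞ ∧
        (k ≠ trueModel t (p n) → marginal r α₁ α₂ (X n) (A n) k (response (X n) β₀ e) ≤
          ENNReal.ofReal (Real.exp (-(Real.log n / 8))) *
            marginal r α₁ α₂ (X n) (A n) (trueModel t (p n)) (response (X n) β₀ e)) := by
  obtain ⟨b₀, hb₀, hβt⟩ := exists_pos_le_abs hβ₀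
  set S₀ : ℝ := ∑ j ∈ t, β₀ j ^ 2 with hS₀
  have hS₀0 : 0 ≤ S₀ := Finset.sum_nonneg fun _ _ => sq_nonneg _
  -- When p = 0 there are no eigenvalues, so the hypothesis on A need not make a₂ positive.
  set a : ℝ := max a₂ 1 with ha
  have ha0 : 0 < a := lt_of_lt_of_le one_pos (le_max_right _ _)
  obtain ⟨K, hK0, hK⟩ := exists_marginalUpper_le r (α₁ := α₁) (α₂ := α₂) (g := gaussMoment r a)
    (G := gaussMoment r a₁) (d := (b₀ / 2) ^ (2 * r)) (M := 1 + α₂ + 2 * v + S₀) hα₁ hα₂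
    (gaussMoment_pos r ha0) (gaussMoment_pos r ha₁) (by positivity) (by linarith) t.card
  obtain ⟨C, hC⟩ := exists_largeConst r t.card α₁ a S₀ K (1 + α₂ + 2 * v + S₀) hv hb₀
  have hC0 : 0 < C := by linarith [hC.c640]
  filter_upwards [hε, hX, hA, eventually_mul_log_le hξ hq hε hεo hC0,
    eventually_le_mul_log hεo (show 0 < (2 * C)⁻¹ by positivity)]
    with n hε hX hA hnq hεlog e he
  have hεi : 1 ≤ (ε n)⁻¹ := (one_le_inv₀ hε.1).2 hε.2.le
  rw [← div_eq_inv_mul, le_div_iff₀ (by positivity)] at hεlog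
  have h1 : C * 1 ≤ C * (ε n)⁻¹ := mul_le_mul_of_nonneg_left hεi hC0.le
  have h2 : C * (1 + Real.log (ε n)⁻¹) ≤ C * (ε n)⁻¹ :=
    mul_le_mul_of_nonneg_left
      (by linarith [Real.log_le_sub_one_of_pos (show 0 < (ε n)⁻¹ by linarith)]) hC0.le
  obtain ⟨hpos, hall⟩ := marginal_trueModel_dominates (q := |q n|) hr hα₁ hα₂ hA ha₁ ha0
    (le_max_left _ _) hX hε.1 hε.2 (card_trueModel_le t (p n))
    (fun j hj => by
      by_contra h
      exact hj (by simpa [trueModel] using (hβ₀ j).1 h)) hb₀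
    (fun j hj => hβt j (by simpa [trueModel] using hj)) (sum_fin_sq_le hβ₀ (p n)) hv hK0 rfl hK
    hC (abs_nonneg _) hnq (by linarith) (by linarith) he
  exact ⟨hpos, fun k hk => hall k (hk.trans (le_abs_self _))⟩

/-- If the marginal density of `t` dominates those of all models charged by the prior, then the
posterior probability of `t` dominates the others. -/
theorem posterior_le_mul_posterior {n p r : ℕ} {α₁ α₂ : ℝ} {X : Matrix (Fin n) (Fin p) ℝ}
    {A : Matrix (Fin p) (Fin p) ℝ} {prior : PMF (Model p)} {y : Fin n → ℝ} {t : Model p}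
    {c : ℝ} (hc : 0 < c) (hprior : ∀ k, 0 < prior k → ENNReal.ofReal c < prior t / prior k)
    {δ : ℝ≥0∞} (hpos : 0 < marginal r α₁ α₂ X A t y)
    (hfin : ∀ k, prior k ≠ 0 → marginal r α₁ α₂ X A k y ≠ ∞)
    (hle : ∀ k, prior k ≠ 0 → k ≠ t →
      marginal r α₁ α₂ X A k y ≤ δ * marginal r α₁ α₂ X A t y) :
    0 < posterior r α₁ α₂ X A prior y t ∧ posterior r α₁ α₂ X A prior y t ≠ ∞ ∧
      ∀ k, k ≠ t → posterior r α₁ α₂ X A prior y k ≤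
        ((ENNReal.ofReal c)⁻¹ * δ) * posterior r α₁ α₂ X A prior y t := by
  have hc' : ENNReal.ofReal c ≠ 0 := by simpa using hc
  have hle_prior : ∀ k, prior k ≠ 0 → prior k ≤ (ENNReal.ofReal c)⁻¹ * prior t := fun k hk => by
    have h1 := (hprior k (pos_iff_ne_zero.2 hk)).le
    rw [ENNReal.le_div_iff_mul_le (Or.inl hk) (Or.inl (prior.apply_ne_top k))] at h1
    rw [mul_comm, ← div_eq_mul_inv, ENNReal.le_div_iff_mul_le (Or.inl hc')
      (Or.inl ENNReal.ofReal_ne_top), mul_comm]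
    exact h1
  -- Some model is charged, and its prior mass is at most a constant times that of t.
  have ht : prior t ≠ 0 := by
    obtain ⟨k, hk⟩ := prior.support_nonempty
    intro h0
    have := hle_prior k hk
    rw [h0, mul_zero] at this
    exact hk (le_antisymm this zero_le)
  have hterm : ∀ k, prior k * marginal r α₁ α₂ X A k y ≠ ∞ := fun k => by
    by_cases hk : prior k = 0
    · simp [hk]
    · exact ENNReal.mul_ne_top (prior.apply_ne_top k) (hfin k hk)
  have hnum : prior t * marginal r α₁ α₂ X A t y ≠ 0 := mul_ne_zero ht hpos.ne'
  have hsum_top : ∑ j, prior j * marginal r α₁ α₂ X A j y ≠ ∞ :=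
    ENNReal.sum_ne_top.2 fun j _ => hterm j
  have hsum_ne : ∑ j, prior j * marginal r α₁ α₂ X A j y ≠ 0 := fun h =>
    hnum (Finset.sum_eq_zero_iff.1 h t (Finset.mem_univ t))
  refine ⟨ENNReal.div_pos hnum hsum_top, ENNReal.div_ne_top (hterm t) hsum_ne, fun k hkt => ?_⟩
  rw [posterior, posterior, ← mul_div_assoc]
  refine ENNReal.div_le_div_right ?_ _
  by_cases hk : prior k = 0
  · simp [hk]
  · calc prior k * marginal r α₁ α₂ X A k y
        ≤ ((ENNReal.ofReal c)⁻¹ * prior t) * (δ * marginal r α₁ α₂ X A t y) :=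
          mul_le_mul' (hle_prior k hk) (hle k hk hkt)
      _ = _ := by ring

end HyperPMOM

end

theorem theorem1
    {Ω : Type*} [MeasurableSpace Ω] (P : Measure Ω) [IsProbabilityMeasure P]
    -- hyperparameters of the hierarchical model
    (r : ℕ) (hr : 1 ≤ r) (α₁ α₂ : ℝ) (hα₁ : 0 < α₁) (hα₂ : 0 < α₂)
    -- dimensions, designs, scale matrices and model priors, one for each sample size
    (p : ℕ → ℕ) (X : ∀ n, Matrix (Fin n) (Fin (p n)) ℝ)
    (A : ∀ n, Matrix (Fin (p n)) (Fin (p n)) ℝ)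
    (prior : ∀ n, PMF (HyperPMOM.Model (p n)))
    -- the truth: fixed support, coefficients and error variance; i.i.d. Gaussian errors
    (t : Finset ℕ) (β₀ : ℕ → ℝ) (hβ₀ : ∀ j, β₀ j ≠ 0 ↔ j ∈ t)
    (htp : ∀ᶠ n in atTop, ∀ j ∈ t, j < p n)
    (σ₀sq : ℝ≥0) (hσ₀ : 0 < σ₀sq)
    (noise : ∀ n, Fin n → Ω → ℝ)
    (hlaw : ∀ n i, HasLaw (noise n i) (gaussianReal 0 σ₀sq) P)
    (hindep : ∀ n, iIndepFun (noise n) P)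
    -- eigenvalues of the Gram matrices
    (ε : ℕ → ℝ) (hε : ∀ᶠ n in atTop, 0 < ε n ∧ ε n < 1)
    (hεO : (fun n => (ε n)⁻¹) =O[atTop] fun n : ℕ => Real.log n ^ (1 / 8 : ℝ))
    (hX : ∀ᶠ n in atTop, HyperPMOM.EigenBound (X n) (ε n))
    -- no prior mass on large models
    (q : ℕ → ℝ) (ξ : ℝ) (hξ : ξ < 1)
    (hq : q =O[atTop] fun n : ℕ => (n : ℝ) ^ ξ)
    (hsize : ∀ᶠ n in atTop, ∀ k, q n < (k.card : ℝ) → prior n k = 0)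
    -- prior ratios bounded below
    (c : ℝ) (hc : 0 < c)
    (hprior : ∀ᶠ n in atTop, ∀ k, 0 < prior n k →
      ENNReal.ofReal c < prior n (HyperPMOM.trueModel t (p n)) / prior n k)
    -- eigenvalues of the scale matrices
    (a₁ a₂ : ℝ) (ha₁ : 0 < a₁)
    (hA : ∀ᶠ n in atTop, HyperPMOM.ScaleMatrixBound (A n) a₁ a₂) :
    (∀ η : ℝ≥0∞, 0 < η → Tendsto (fun n => P {ω | η ≤
        HyperPMOM.maxRatio
          (HyperPMOM.posterior r α₁ α₂ (X n) (A n) (prior n)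
            (HyperPMOM.response (X n) β₀ fun i => noise n i ω))
          (HyperPMOM.trueModel t (p n))}) atTop (𝓝 0)) ∧
      Tendsto (fun n => P {ω |
        HyperPMOM.IsUniqueMode
          (HyperPMOM.posterior r α₁ α₂ (X n) (A n) (prior n)
            (HyperPMOM.response (X n) β₀ fun i => noise n i ω))
          (HyperPMOM.trueModel t (p n))}) atTop (𝓝 1) := by
  have hεo := HyperPMOM.isLittleO_log_of_isBigO_log_rpow hεO
  have htame := HyperPMOM.tendsto_measure_not_tameNoise P p X t hσ₀ noise hlaw hindep ε hε hεo hX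
  have hdom := HyperPMOM.eventually_marginal_trueModel_dominates r hr α₁ α₂ hα₁ hα₂ p X A t β₀ hβ₀
    (show (0 : ℝ) < σ₀sq from hσ₀) ε hε hεo hX q ξ hξ hq a₁ a₂ ha₁ hA
  set θ : ℕ → ℝ≥0∞ := fun n =>
    (ENNReal.ofReal c)⁻¹ * ENNReal.ofReal (Real.exp (-(Real.log n / 8))) with hθ
  have hθ0 : Tendsto θ atTop (𝓝 0) := by
    have h1 : Tendsto (fun n : ℕ => Real.log n / 8) atTop atTop :=
      HyperPMOM.tendsto_log_natCast.atTop_div_const (by norm_num)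
    have h2 := ENNReal.tendsto_ofReal (Real.tendsto_exp_neg_atTop_nhds_zero.comp h1)
    rw [ENNReal.ofReal_zero] at h2
    have h3 := ENNReal.Tendsto.const_mul (a := (ENNReal.ofReal c)⁻¹) h2
      (Or.inr (by simpa using hc))
    rwa [mul_zero] at h3
  have hpost : ∀ᶠ n in atTop, ∀ ω, HyperPMOM.TameNoise (X n) (HyperPMOM.trueModel t (p n)) σ₀sq
      (fun i => noise n i ω) →
      0 < HyperPMOM.posterior r α₁ α₂ (X n) (A n) (prior n)
        (HyperPMOM.response (X n) β₀ fun i => noise n i ω) (HyperPMOM.trueModel t (p n)) ∧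
      HyperPMOM.posterior r α₁ α₂ (X n) (A n) (prior n)
        (HyperPMOM.response (X n) β₀ fun i => noise n i ω) (HyperPMOM.trueModel t (p n)) ≠ ∞ ∧
      ∀ k, k ≠ HyperPMOM.trueModel t (p n) →
        HyperPMOM.posterior r α₁ α₂ (X n) (A n) (prior n)
          (HyperPMOM.response (X n) β₀ fun i => noise n i ω) k ≤
        θ n * HyperPMOM.posterior r α₁ α₂ (X n) (A n) (prior n)
          (HyperPMOM.response (X n) β₀ fun i => noise n i ω) (HyperPMOM.trueModel t (p n)) := by
    filter_upwards [hdom, hsize, hprior] with n hdom hsize hprior ω hω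
    obtain ⟨hpos, hall⟩ := hdom _ hω
    have hcard : ∀ k, prior n k ≠ 0 → (k.card : ℝ) ≤ q n := fun k hk =>
      not_lt.1 fun h => hk (hsize k h)
    exact HyperPMOM.posterior_le_mul_posterior hc hprior hpos
      (fun k hk => (hall k (hcard k hk)).1) (fun k hk => (hall k (hcard k hk)).2)
  constructor
  · intro η hη
    refine tendsto_of_tendsto_of_tendsto_of_le_of_le' tendsto_const_nhds htame
      (Eventually.of_forall fun _ => zero_le) ?_
    filter_upwards [hpost, hθ0.eventually (gt_mem_nhds hη)] with n hpost hθη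
    refine measure_mono fun ω hω hT => ?_
    refine absurd (lt_of_le_of_lt ?_ hθη) (not_lt.2 hω)
    exact iSup₂_le fun k hk => ENNReal.div_le_of_le_mul ((hpost ω hT).2.2 k hk)
  · have hlim : Tendsto (fun n => 1 - P {ω | ¬ HyperPMOM.TameNoise (X n)
        (HyperPMOM.trueModel t (p n)) σ₀sq (fun i => noise n i ω)}) atTop (𝓝 1) := by
      have := ENNReal.Tendsto.sub (tendsto_const_nhds (x := (1 : ℝ≥0∞))) htame (Or.inl (by simp))
      rwa [tsub_zero] at this
    refine tendsto_of_tendsto_of_tendsto_of_le_of_le' hlim tendsto_const_nhds ?_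
      (Eventually.of_forall fun _ => prob_le_one)
    filter_upwards [hpost, hθ0.eventually (gt_mem_nhds one_pos)] with n hpost hθ1
    rw [tsub_le_iff_right]
    -- The events are not known to be measurable, so subadditivity replaces taking complements.
    calc 1 = P Set.univ := measure_univ.symm
      _ ≤ P (_ ∪ _) := measure_mono fun ω _ => by
          by_cases hT : HyperPMOM.TameNoise (X n) (HyperPMOM.trueModel t (p n)) σ₀sq
            (fun i => noise n i ω)
          · obtain ⟨h0, htop, hle⟩ := hpost ω hT
            refine Or.inl fun k hk => (hle k hk).trans_lt ?_
            calc _ < 1 * _ := ENNReal.mul_lt_mul_left h0.ne' htop hθ1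
              _ = _ := one_mul _
          · exact Or.inr hT
      _ ≤ _ := measure_union_le _ _
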